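/- **Setting.** Let $\gamma>0$, let $N\ge 2$ be even, and consider on $N$ spins-$\tfrac12$, with periodic boundary condition $\sigma^a_{N+1}\equiv\sigma^a_1$, the non-Hermitian (iKSEA) Hamiltonian $$H_N(h,\gamma,K)=\sum_{j=1}^N\Big[\tfrac{1+i\gamma}{4}\sigma^x_j\sigma^x_{j+1}+\tfrac{1-i\gamma}{4}\sigma^y_j\sigma^y_{j+1}+\tfrac K4(\sigma^x_j\sigma^y_{j+1}+\sigma^y_j\sigma^x_{j+1})+\tfrac h2\sigma^z_j\Big],$$ and, for $\phi_p=(2p-1)\pi/N$, $p=1,\dots,N/2$, its momentum blocks $$\mathcal H_p(h,\gamma,K)=\begin{pmatrix}-(h+\cos\phi_p)&-(\gamma+K)\sin\phi_p\\(\gamma-K)\sin\phi_p&h+\cos\phi_p\end{pmatrix}.$$ A ground state of a matrix is a right eigenvector of Dirac norm $1$ with a real eigenvalue that is lowest in the spectrum. The quantum Fisher information (QFI) about $h$ is $4\,\mathrm{Re}\big(\langle d_h\psi|d_h\psi\rangle-|\langle d_h\psi|\psi\rangle|^2\big)$ for a family $\psi(h)$ of ground states that is differentiable at the given field. Put $K=\gamma+\kappa$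 with $\kappa>0$, and let $\mathcal F_N(\kappa)$ and $\mathcal F_{N,p}(\kappa)$ be the QFI at the critical field $h=1$ of the ground states of $H_N$ and of $\mathcal H_p$. **Corollary 1.** 1. For all even $N\ge2$ and $\kappa>0$ the QFIs $\mathcal F_N(\kappa)$ and $\mathcal F_{N,p}(\kappa)$ are well defined (differentiable families of ground states exist near $h=1$, and all of them give the same value), and $\mathcal F_N(\kappa)=\sum_{p=1}^{N/2}\mathcal F_{N,p}(\kappa)$. 2. (Leading order.) For each fixed even $N\ge 2$, as $\kappa\to0^+$, $$\mathcal F_{N,p}(\kappa)=\frac{\sin^2\phi_p}{(1+\cos\phi_p)^4}\,\kappa^2+O(\kappa^3)\quad(1\le p\le N/2),\qquad \mathcal F_N(\kappa)=\sum_{p=1}^{N/2}\frac{\sin^2\phi_p}{(1+\cos\phi_p)^4}\,\kappa^2+O(\kappa^3).$$ The largest coefficient is the one at the momentum nearest $\pi$, $\phi_{N/2}=\pi-\pi/N$. 3. (Super-Heisenberg scaling of the leading order.) Along even $N\to\infty$, $\dfrac{\sin^2\phi_{N/2}}{(1+\cos\phi_{N/2})^4}\Big/\Big(\dfrac N\pi\Big)^6\to16$,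 and $\sum_{p=1}^{N/2}\dfrac{\sin^2\phi_p}{(1+\cos\phi_p)^4}=\Theta\big((N/\pi)^6\big)$. 4. (Moderate system sizes.) For every $\varepsilon>0$ there are $c>0$ and $N_0$, depending only on $\gamma$ and $\varepsilon$, such that $\Big|\dfrac{\mathcal F_{N,N/2}(\kappa)}{16\,\kappa^2(N/\pi)^6}-1\Big|\le\varepsilon$ for all even $N\ge \max(2,N_0)$ and $0<\kappa\le c\,(\pi/N)^2$. Moreover there are $c,C_1,C_2>0$ depending only on $\gamma$ such that $C_1\kappa^2(N/\pi)^6\le\mathcal F_N(\kappa)\le C_2\kappa^2(N/\pi)^6$ for all even $N\ge2$ and $0<\kappa\le c\,(\pi/N)^2$. 5. (Thermodynamic limit.) For each fixed $\kappa>0$, as $N\to\infty$ along even $N$, $\mathcal F_{N,N/2}(\kappa)=\dfrac1{(\gamma+\kappa)^2}\Big(\dfrac N\pi\Big)^2+O(N)$ and $\mathcal F_N(\kappa)=\Theta(N^2)$ (Heisenberg scaling). -/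

import Mathlib

open Filter Topology Asymptotics

noncomputable section

namespace IKSEA

/-! ### The spin chain -/

/-- Pauli matrix `σˣ`; the index `0` is spin up, `1` is spin down. -/
def pauliX : Matrix (Fin 2) (Fin 2) ℂ := !![0, 1; 1, 0]

/-- Pauli matrix `σʸ`. -/
def pauliY : Matrix (Fin 2) (Fin 2) ℂ := !![0, -Complex.I; Complex.I, 0]

/-- Pauli matrix `σᶻ`. -/
def pauliZ : Matrix (Fin 2) (Fin 2) ℂ := !![1, 0; 0, -1]

/-- Basis configurations of `N` spins `1/2`. -/
abbrev Config (N : ℕ) : Type := Fin N → Fin 2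

/-- The operator `1 ⊗ ⋯ ⊗ A ⊗ ⋯ ⊗ 1` on `N` spins, with `A` at site `j`. -/
def siteOp {N : ℕ} (A : Matrix (Fin 2) (Fin 2) ℂ) (j : Fin N) :
    Matrix (Config N) (Config N) ℂ :=
  Matrix.of fun s t => if ∀ i, i ≠ j → s i = t i then A (s j) (t j) else 0

/-- The non-Hermitian transverse `XY` Hamiltonian with KSEA interaction on `N` spins
(field `h`, anisotropy `γ`, KSEA strength `K`), with periodic boundary condition:
`finRotate N` sends the site `j` to `j + 1` and the last site to the first one. -/
def chainHamiltonian (N : ℕ) (h γ K : ℝ) : Matrix (Config N) (Config N) ℂ :=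
  ∑ j : Fin N,
    (((1 + Complex.I * (γ : ℂ)) / 4) • (siteOp pauliX j * siteOp pauliX (finRotate N j))
      + ((1 - Complex.I * (γ : ℂ)) / 4) • (siteOp pauliY j * siteOp pauliY (finRotate N j))
      + ((K : ℂ) / 4) • (siteOp pauliX j * siteOp pauliY (finRotate N j)
          + siteOp pauliY j * siteOp pauliX (finRotate N j))
      + ((h : ℂ) / 2) • siteOp pauliZ j)

/-! ### The momentum blocks -/

/-- The momenta `φ_p = (2p-1)π/N`, `p = 1, …, N/2`, of the even parity sector. -/
def momentum (N p : ℕ) : ℝ := (2 * (p : ℝ) - 1) * Real.pi / (N : ℝ)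

/-- The momentum block of the chain at the momentum `φ`, in the basis
`|0⟩, c†_φ c†_{-φ} |0⟩`. -/
def blockHamiltonian (φ h γ K : ℝ) : Matrix (Fin 2) (Fin 2) ℂ :=
  !![-((h + Real.cos φ : ℝ) : ℂ), -(((γ + K) * Real.sin φ : ℝ) : ℂ);
     (((γ - K) * Real.sin φ : ℝ) : ℂ), ((h + Real.cos φ : ℝ) : ℂ)]

/-! ### Ground states and quantum Fisher information -/

section QFI

variable {n : Type*} [Fintype n] [DecidableEq n]

/-- `ψ` is a ground state of the (possibly non-Hermitian) Hamiltonian `H`: a right eigenvector,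
normalized in the Dirac norm, with a real eigenvalue that is lowest in the spectrum. -/
def IsGroundState (H : Matrix n n ℂ) (ψ : EuclideanSpace ℂ n) : Prop :=
  ‖ψ‖ = 1 ∧ ∃ E : ℝ, H.toEuclideanLin ψ = (E : ℂ) • ψ ∧
    ∀ μ : ℂ, Module.End.HasEigenvalue H.toEuclideanLin μ → E ≤ μ.re

/-- `ψ` is a family of normalized ground states of `H h` for `h` near `h₀`,
differentiable at `h₀`. -/
def IsGroundFamily (H : ℝ → Matrix n n ℂ) (h₀ : ℝ) (ψ : ℝ → EuclideanSpace ℂ n) : Prop :=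
  (∀ᶠ h in 𝓝 h₀, IsGroundState (H h) (ψ h)) ∧ DifferentiableAt ℝ ψ h₀

/-- Quantum Fisher information `4 Re(⟨dψ|dψ⟩ - |⟨dψ|ψ⟩|²)` of a normalized family of pure
states. -/
def qfi (ψ : ℝ → EuclideanSpace ℂ n) (h₀ : ℝ) : ℝ :=
  4 * (inner ℂ (deriv ψ h₀) (deriv ψ h₀)
    - ((‖inner ℂ (deriv ψ h₀) (ψ h₀)‖ ^ 2 : ℝ) : ℂ)).re

/-- The quantum Fisher information of the ground state of `H h` about `h` is well defined at
`h₀` and equal to `F`: differentiable normalized ground state families exist, and all of them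
(whatever the choice of phase) have the quantum Fisher information `F`. -/
def HasGroundQFI (H : ℝ → Matrix n n ℂ) (h₀ F : ℝ) : Prop :=
  (∃ ψ, IsGroundFamily H h₀ ψ) ∧ ∀ ψ, IsGroundFamily H h₀ ψ → qfi ψ h₀ = F

open Classical in
/-- The number `F` with `HasGroundQFI H h₀ F` (and `0` if there is none). -/
def groundQFI (H : ℝ → Matrix n n ℂ) (h₀ : ℝ) : ℝ :=
  if hF : ∃ F, HasGroundQFI H h₀ F then hF.choose else 0

end QFI

/-- At the critical field `h = 1` and `K = γ + κ`: quantum Fisher information about `h` of the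
ground state of the chain of `N` spins. -/
def chainQFI (γ : ℝ) (N : ℕ) (κ : ℝ) : ℝ :=
  groundQFI (fun h => chainHamiltonian N h γ (γ + κ)) 1

/-- At the critical field `h = 1` and `K = γ + κ`: quantum Fisher information about `h` of the
ground state of the block with momentum `φ_p`. -/
def blockQFI (γ : ℝ) (N p : ℕ) (κ : ℝ) : ℝ :=
  groundQFI (fun h => blockHamiltonian (momentum N p) h γ (γ + κ)) 1

/-- The coefficient `sin² φ / (1 + cos φ)⁴`. -/
def leadingCoeff (φ : ℝ) : ℝ := Real.sin φ ^ 2 / (1 + Real.cos φ) ^ 4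

end IKSEA

end

/-!
The chain is solved by free fermions. The Jordan–Wigner operators `jw` satisfy the canonical
anticommutation relations (`car_jw`), and on states of a given fermion parity the chain is a
quadratic Hamiltonian on a ring, antiperiodic in the even and periodic in the odd sector
(`chainHamiltonian_mulVec`). Its Fourier transform splits into terms `X_p` for pairs of opposite
momenta (`fermiHam_antiperiodic`, `fermiHam_periodic`). The annihilator `b_p` of a pair is a
hard-core boson, and `X_p = A (b† b - b b†) + C b† + D b` acts on the empty and the doubly occupied
state as the momentum block.

Although the Hamiltonian is not normal, the commuting operators `X_p` satisfy `X_p³ = E_p² X_p` with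
the real dispersion `E_p`, and this alone bounds the spectrum of `∑ X_p` from below by `-∑ E_p`, with
joint eigenvectors in the case of equality (`neg_sum_le_re_of_cube`,
`eigenvector_of_sum_eq_neg_sum`). In the even sector the bound is attained by exactly one state, the
product of the two-component ground states `cos θ_p + sin θ_p b_p†` on the vacuum
(`PairModes.pairHam_pairState`, `PairModes.eq_smul_pairState`). As `θ_p` is real, the derivative of
this state is orthogonal to it, with squared norm `∑ θ_p'²`, so that the quantum Fisher information
is `4 ∑ θ_p'²` (`PairModes.hasGroundQFI`); a single block is the case of one pair.

The odd sector has to be excluded: the half sum of `E` over the periodic momenta is strictly less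
than that over the antiperiodic ones at `h = 1` (`sum_disp_lt`). There `E = (1 + cos φ) √y` with a
fractional linear function `y` of `cos φ`; the square root is a superposition of the resolvents
`y / (t + y)`, and for these both sums are geometric series over roots of unity. By continuity the
inequality persists for `h` near `1`.

What remains is calculus. With `φ = π - 2 x` and `τ = tan (φ/2) = cot x`, the information of a block
is its leading order times a factor that depends on `κ (2γ + κ) τ²` and `κ² τ²` and lies between
`1 - 15 η` and `1` if both of these are at most `η ≤ 1` (`blockValue_eq`, `le_correction`). At the
last momentum `x` is `π / (2 N)`, so `τ² κ` is small when `κ` is small compared with `(π / N)²`. At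
fixed `κ`, the information divided by `τ²` is a smooth function of `1 / τ` at `0` with value
`1 / (4 (γ + κ)²)` (`scaledBlockValue`). In the sums over all momenta, the bounds by powers of
`π / (π - φ)` make the terms decay like powers of the odd numbers (`sum_momenta_le`).
-/

noncomputable section

namespace IKSEA

/-! ### Hard-core pair operators -/

/-- A hard-core annihilator: with `b† = star b`, the operators `b† b` and `b b†` are orthogonal
projections onto the occupied and the empty states of a two-level system. -/
structure HardCore {R : Type*} [Ring R] [StarRing R] (b : R) : Prop where
  sq : b * b = 0
  triple : b * star b * b = b

/-- The operator `A (b† b - b b†) + C b† + D b`, whose matrix in the basis `(empty, occupied)` is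
`!![-A, D; C, A]`. -/
def pairHam {R : Type*} [Ring R] [StarRing R] [Algebra ℂ R] (b : R) (A C D : ℂ) : R :=
  A • (star b * b - b * star b) + C • star b + D • b

section Ring

variable {R : Type*} [Ring R] [StarRing R] {b : R}

theorem HardCore.star_sq (hb : HardCore b) : star b * star b = 0 := by
  rw [← star_mul, hb.sq, star_zero]

theorem HardCore.star_triple (hb : HardCore b) : star b * b * star b = star b := by
  have := congrArg star hb.triple
  simpa [star_mul, mul_assoc] using this

variable [Algebra ℂ R]

theorem HardCore.pairHam_sq (hb : HardCore b) (A C D : ℂ) :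
    pairHam b A C D * pairHam b A C D = (A ^ 2 + C * D) • (star b * b + b * star b) := by
  have h1 := hb.sq
  have h2 := hb.star_sq
  have h3 := hb.triple
  have h4 := hb.star_triple
  rw [mul_assoc] at h3 h4
  have h5 : ∀ x, b * (b * x) = 0 := fun x => by rw [← mul_assoc, h1, zero_mul]
  have h6 : ∀ x, star b * (star b * x) = 0 := fun x => by rw [← mul_assoc, h2, zero_mul]
  have h7 : ∀ x, b * (star b * (b * x)) = b * x := fun x => by
    rw [← mul_assoc, ← mul_assoc, hb.triple]
  have h8 : ∀ x, star b * (b * (star b * x)) = star b * x := fun x => by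
    rw [← mul_assoc, ← mul_assoc, hb.star_triple]
  simp only [pairHam, mul_add, add_mul, mul_sub, sub_mul, smul_mul_assoc, mul_smul_comm, smul_add,
    smul_sub, mul_assoc, h1, h2, h3, h4, h5, h6, smul_zero, mul_zero]
  module

theorem HardCore.pairHam_mul_proj (hb : HardCore b) (A C D : ℂ) :
    pairHam b A C D * (star b * b + b * star b) = pairHam b A C D := by
  have h1 := hb.sq
  have h2 := hb.star_sq
  have h3 := hb.triple
  have h4 := hb.star_triple
  rw [mul_assoc] at h3 h4
  have h5 : ∀ x, b * (b * x) = 0 := fun x => by rw [← mul_assoc, h1, zero_mul]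
  have h6 : ∀ x, star b * (star b * x) = 0 := fun x => by rw [← mul_assoc, h2, zero_mul]
  simp only [pairHam, mul_add, add_mul, sub_mul, smul_mul_assoc, mul_assoc, h3, h4, h5, h6,
    smul_zero, mul_zero]
  module

/-- As `X² = (A² + C D) (b† b + b b†)` and `b† b + b b†` is the unit of the two-level system, the
possible eigenvalues of `X` are `0` and the two square roots of `A² + C D`. -/
theorem HardCore.pairHam_cube (hb : HardCore b) (A C D : ℂ) :
    pairHam b A C D * pairHam b A C D * pairHam b A C D = (A ^ 2 + C * D) • pairHam b A C D := by
  rw [mul_assoc, hb.pairHam_sq, mul_smul_comm, hb.pairHam_mul_proj]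

theorem commute_pairHam {x : R} (h : Commute x b) (h' : Commute x (star b)) (A C D : ℂ) :
    Commute x (pairHam b A C D) := by
  unfold pairHam
  exact (((h'.mul_right h).sub_right (h.mul_right h')).smul_right A |>.add_right
    (h'.smul_right C)).add_right (h.smul_right D)

end Ring

/-! ### Canonical anticommutation relations -/

section CAR

variable {R : Type*} [Ring R] [StarRing R] [Algebra ℂ R]

/-- The canonical anticommutation relations for the annihilators `c j`. -/
structure CAR {ι : Type*} [DecidableEq ι] (c : ι → R) : Prop where
  anti : ∀ i j, c i * c j + c j * c i = 0
  anti_star : ∀ i j, c i * star (c j) + star (c j) * c i = if i = j then 1 else 0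

theorem commute_mul_of_anticommute {R : Type*} [Ring R] {a x y : R} (hx : a * x + x * a = 0)
    (hy : a * y + y * a = 0) : Commute a (x * y) := by
  rw [add_eq_zero_iff_eq_neg] at hx hy
  change a * (x * y) = x * y * a
  rw [← mul_assoc, hx, neg_mul, mul_assoc, hy, mul_neg, neg_neg, mul_assoc]

/-- The annihilator `∑ conj (u j) c j` of the one-particle state `u`. -/
def ann {ι : Type*} [Fintype ι] (c : ι → R) (u : ι → ℂ) : R := ∑ j, star (u j) • c j

variable {ι : Type*} [Fintype ι] [DecidableEq ι] {c : ι → R}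

theorem CAR.ann_anti (hc : CAR c) (u v : ι → ℂ) :
    ann c u * ann c v + ann c v * ann c u = 0 := by
  simp only [ann, Finset.sum_mul_sum]
  rw [Finset.sum_comm (s := Finset.univ) (t := Finset.univ) (f := fun i j => (star (v i) • c i) *
    (star (u j) • c j)), ← Finset.sum_add_distrib]
  refine Finset.sum_eq_zero fun i _ => ?_
  rw [← Finset.sum_add_distrib]
  refine Finset.sum_eq_zero fun j _ => ?_
  rw [smul_mul_smul_comm, smul_mul_smul_comm, mul_comm (star (v j)), ← smul_add, hc.anti,
    smul_zero]

theorem CAR.ann_sq (hc : CAR c) (u : ι → ℂ) : ann c u * ann c u = 0 := by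
  have h := hc.ann_anti u u
  rw [← two_smul ℂ] at h
  exact (smul_eq_zero_iff_right (two_ne_zero)).1 h

variable [StarModule ℂ R]

omit [DecidableEq ι] in
theorem star_ann (u : ι → ℂ) : star (ann c u) = ∑ j, u j • star (c j) := by
  simp [ann, star_sum, star_smul]

theorem CAR.ann_anti_star (hc : CAR c) (u v : ι → ℂ) :
    ann c u * star (ann c v) + star (ann c v) * ann c u = (star u ⬝ᵥ v) • (1 : R) := by
  rw [star_ann]
  simp only [ann, Finset.sum_mul_sum]
  rw [Finset.sum_comm (s := Finset.univ) (t := Finset.univ) (f := fun i j => (v i • star (c i)) *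
    (star (u j) • c j)), ← Finset.sum_add_distrib, dotProduct, Finset.sum_smul]
  refine Finset.sum_congr rfl fun i _ => ?_
  rw [← Finset.sum_add_distrib]
  have : ∀ j, star (u i) • c i * v j • star (c j) + v j • star (c j) * star (u i) • c i =
      if i = j then (star (u i) * v j) • (1 : R) else 0 := fun j => by
    rw [smul_mul_smul_comm, smul_mul_smul_comm, mul_comm (v j), ← smul_add, hc.anti_star]
    split_ifs <;> simp
  rw [Finset.sum_congr rfl fun j _ => this j]
  simp

/-- The pair annihilator `a(w) a(u)`, whose adjoint creates first `w` and then `u`. -/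
def pairAnn (c : ι → R) (u w : ι → ℂ) : R := ann c w * ann c u

theorem pairAnn_hardCore_aux {R : Type*} [Ring R] [StarRing R] {x y : R} (hx : x * x = 0)
    (hy : y * y = 0)
    (hxx : x * star x + star x * x = 1) (hyy : y * star y + star y * y = 1)
    (hxy : y * x + x * y = 0) (hxy' : y * star x + star x * y = 0)
    (hyx' : x * star y + star y * x = 0) :
    HardCore (y * x) ∧ star (y * x) * (y * x) - (y * x) * star (y * x) =
      star x * x + star y * y - 1 := by
  have e1 : x * star x = 1 - star x * x := eq_sub_of_add_eq hxx
  have e2 : y * star y = 1 - star y * y := eq_sub_of_add_eq hyy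
  have e3 : y * x = -(x * y) := eq_neg_of_add_eq_zero_left hxy
  have cyx : Commute x (star y * y) := commute_mul_of_anticommute hyx' (by rwa [add_comm] at hxy)
  have cyx' : Commute x (y * star y) := commute_mul_of_anticommute (by rwa [add_comm] at hxy) hyx'
  have sx : star x * star x = 0 := by rw [← star_mul, hx, star_zero]
  have ccx : Commute (star x) (star y * y) := by
    have := cyx.star_star
    simpa [star_mul] using this
  have ccx' : Commute (star x) (y * star y) := by
    have := cyx'.star_star
    simpa [star_mul] using this
  have t1 : x * star x * x = x := by rw [e1, sub_mul, mul_assoc, hx, mul_zero, sub_zero, one_mul]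
  have t2 : y * star y * y = y := by rw [e2, sub_mul, mul_assoc, hy, mul_zero, sub_zero, one_mul]
  have f1 : star (y * x) * (y * x) = (star x * x) * (star y * y) := by
    rw [star_mul, mul_assoc, ← mul_assoc (star y), ← cyx.eq, mul_assoc]
  have f2 : (y * x) * star (y * x) = (x * star x) * (y * star y) := by
    have : y * (x * star x) = (x * star x) * y := by
      refine (commute_mul_of_anticommute hxy ?_)
      exact hxy'
    rw [star_mul, mul_assoc, ← mul_assoc x, ← mul_assoc, this, mul_assoc]
  refine ⟨⟨?_, ?_⟩, ?_⟩
  · rw [e3, neg_mul_neg, mul_assoc, ← mul_assoc y, e3]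
    simp only [neg_mul, mul_assoc, hy, mul_zero, neg_zero]
  · rw [f2, e3, mul_neg, mul_assoc, ← mul_assoc (y * star y), ← cyx'.eq, ← mul_assoc, ← mul_assoc,
      t1, mul_assoc, t2]
  · rw [f1, f2, e1, e2]
    noncomm_ring

/-- A pair of orthonormal one-particle states is a hard-core boson. -/
theorem CAR.pairAnn_hardCore (hc : CAR c) {u w : ι → ℂ} (hu : star u ⬝ᵥ u = 1)
    (hw : star w ⬝ᵥ w = 1) (huw : star u ⬝ᵥ w = 0) (hwu : star w ⬝ᵥ u = 0) :
    HardCore (pairAnn c u w) ∧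
      star (pairAnn c u w) * pairAnn c u w - pairAnn c u w * star (pairAnn c u w) =
        star (ann c u) * ann c u + star (ann c w) * ann c w - 1 := by
  refine pairAnn_hardCore_aux (hc.ann_sq u) (hc.ann_sq w) ?_ ?_ (hc.ann_anti w u) ?_ ?_ <;>
  simp [hc.ann_anti_star, hu, hw, huw, hwu]

theorem commute_mul_mul_of_anticommute {R : Type*} [Ring R] {a b x y : R}
    (hax : a * x + x * a = 0) (hay : a * y + y * a = 0) (hbx : b * x + x * b = 0)
    (hby : b * y + y * b = 0) : Commute (a * b) (x * y) :=
  (commute_mul_of_anticommute hax hay).mul_left (commute_mul_of_anticommute hbx hby)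

omit [StarModule ℂ R] in
theorem CAR.commute_pairAnn (hc : CAR c) (u w u' w' : ι → ℂ) :
    Commute (pairAnn c u w) (pairAnn c u' w') :=
  commute_mul_mul_of_anticommute (hc.ann_anti _ _) (hc.ann_anti _ _) (hc.ann_anti _ _)
    (hc.ann_anti _ _)

theorem CAR.ann_star_eq_zero (hc : CAR c) {u v : ι → ℂ} (h : star u ⬝ᵥ v = 0) :
    ann c u * star (ann c v) + star (ann c v) * ann c u = 0 := by
  rw [hc.ann_anti_star, h, zero_smul]

theorem CAR.commute_pairAnn_star (hc : CAR c) {u w u' w' : ι → ℂ} (h1 : star u ⬝ᵥ u' = 0)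
    (h2 : star u ⬝ᵥ w' = 0) (h3 : star w ⬝ᵥ u' = 0) (h4 : star w ⬝ᵥ w' = 0) :
    Commute (pairAnn c u w) (star (pairAnn c u' w')) := by
  rw [pairAnn, pairAnn, star_mul]
  exact commute_mul_mul_of_anticommute (hc.ann_star_eq_zero h3) (hc.ann_star_eq_zero h4)
    (hc.ann_star_eq_zero h1) (hc.ann_star_eq_zero h2)

/-- The occupation number `a†(v) a(v)`. -/
def num (c : ι → R) (v : ι → ℂ) : R := star (ann c v) * ann c v

omit [DecidableEq ι] [StarModule ℂ R] in
theorem star_num (v : ι → ℂ) : star (num c v) = num c v := by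
  simp [num, star_mul]

theorem CAR.commute_num_pairAnn (hc : CAR c) {v u w : ι → ℂ} (h1 : star u ⬝ᵥ v = 0)
    (h2 : star w ⬝ᵥ v = 0) : Commute (num c v) (pairAnn c u w) := by
  refine commute_mul_mul_of_anticommute ?_ ?_ (hc.ann_anti _ _) (hc.ann_anti _ _) <;>
  rw [add_comm]
  exacts [hc.ann_star_eq_zero h2, hc.ann_star_eq_zero h1]

theorem CAR.commute_num_star_pairAnn (hc : CAR c) {v u w : ι → ℂ} (h1 : star u ⬝ᵥ v = 0)
    (h2 : star w ⬝ᵥ v = 0) : Commute (num c v) (star (pairAnn c u w)) := by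
  have := (hc.commute_num_pairAnn h1 h2).star_star
  rwa [star_num] at this

theorem CAR.commute_num_num (hc : CAR c) {v w : ι → ℂ} (h1 : star v ⬝ᵥ w = 0)
    (h2 : star w ⬝ᵥ v = 0) : Commute (num c v) (num c w) := by
  refine commute_mul_mul_of_anticommute ?_ ?_ (hc.ann_star_eq_zero h1) (hc.ann_anti _ _)
  · have := congrArg star (hc.ann_anti w v)
    simpa [star_add, star_mul] using this
  · rw [add_comm]
    exact hc.ann_star_eq_zero h2

theorem CAR.num_sq (hc : CAR c) {v : ι → ℂ} (hv : star v ⬝ᵥ v = 1) :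
    num c v * num c v = num c v := by
  have h := hc.ann_anti_star v v
  rw [hv, one_smul] at h
  rw [num, mul_assoc, ← mul_assoc (ann c v), eq_sub_of_add_eq h, sub_mul, mul_assoc, hc.ann_sq,
    mul_zero, sub_zero, one_mul]

/-- An unpaired mode satisfies a cubic relation of the same kind as a pair. -/
theorem CAR.num_half_cube (hc : CAR c) {v : ι → ℂ} (hv : star v ⬝ᵥ v = 1) (a : ℂ) :
    (a • (num c v - (1 / 2 : ℂ) • (1 : R))) * (a • (num c v - (1 / 2 : ℂ) • (1 : R))) *
      (a • (num c v - (1 / 2 : ℂ) • (1 : R))) =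
      (a / 2) ^ 2 • (a • (num c v - (1 / 2 : ℂ) • (1 : R))) := by
  simp only [smul_mul_assoc, mul_smul_comm, mul_sub, sub_mul, hc.num_sq hv, mul_one, one_mul,
    smul_sub]
  module

end CAR

/-! ### Spectra of sums of commuting operators -/

section Spectrum

variable {V : Type*} [NormedAddCommGroup V] [NormedSpace ℂ V]

theorem apply_apply_of_commute {X T : V →L[ℂ] V} (h : Commute X T) (v : V) :
    T (X v) = X (T v) :=
  (DFunLike.congr_fun h.eq v).symm

/-- The roots of `x³ = a² x` are `0, a, -a`; a vector of a `T`-eigenspace that is not an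
eigenvector of `X` to `-a` has a component on one of the other two roots. -/
theorem exists_nonneg_eigenvector_of_cube {X T : V →L[ℂ] V} {a : ℝ} (ha : 0 ≤ a)
    (hX : X * X * X = ((a : ℂ) ^ 2) • X) (hXT : Commute X T) {μ : ℂ} {v : V}
    (hTv : T v = μ • v) (hXv : X v ≠ (-a : ℂ) • v) :
    ∃ w : V, w ≠ 0 ∧ T w = μ • w ∧ ∃ l : ℝ, 0 ≤ l ∧ X w = (l : ℂ) • w := by
  have hX' : ∀ x, X (X (X x)) = ((a : ℂ) ^ 2) • X x := fun x => DFunLike.congr_fun hX x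
  set w := X v + (a : ℂ) • v with hw
  have hw0 : w ≠ 0 := fun h => hXv (by rw [neg_smul]; exact eq_neg_of_add_eq_zero_left h)
  have hTX : ∀ x, T x = μ • x → T (X x) = μ • X x := fun x hx => by
    rw [apply_apply_of_commute hXT, hx, map_smul]
  have hTw : T w = μ • w := by
    rw [hw, map_add, hTX v hTv, map_smul, hTv, smul_add, smul_comm]
  by_cases h0 : X w = 0
  · exact ⟨w, hw0, hTw, 0, le_rfl, by simpa using h0⟩
  · refine ⟨X w, h0, hTX w hTw, a, ha, ?_⟩
    rw [hw]
    simp only [map_add, map_smul, hX']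
    module

/-- An eigenvector of `T` can be traded for a joint eigenvector of `T` and `X`. -/
theorem exists_eigenvector_of_cube {X T : V →L[ℂ] V} {a : ℝ} (ha : 0 ≤ a)
    (hX : X * X * X = ((a : ℂ) ^ 2) • X) (hXT : Commute X T) {μ : ℂ} {v : V} (hv : v ≠ 0)
    (hTv : T v = μ • v) :
    ∃ w : V, w ≠ 0 ∧ T w = μ • w ∧ ∃ l : ℝ, -a ≤ l ∧ X w = (l : ℂ) • w := by
  by_cases h : X v = (-a : ℂ) • v
  · exact ⟨v, hv, hTv, -a, le_rfl, by simpa using h⟩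
  · obtain ⟨w, h1, h2, l, h3, h4⟩ := exists_nonneg_eigenvector_of_cube ha hX hXT hTv h
    exact ⟨w, h1, h2, l, by linarith, h4⟩

variable {ι : Type*} [DecidableEq ι] {X : ι → V →L[ℂ] V} {a : ι → ℝ}

/-- The lower bound needs no diagonalizability: joint eigenvectors are split off one operator at a
time. -/
theorem neg_sum_le_re_of_cube {s : Finset ι} (ha : ∀ i ∈ s, 0 ≤ a i)
    (hX : ∀ i ∈ s, X i * X i * X i = ((a i : ℂ) ^ 2) • X i)
    (hc : ∀ i ∈ s, ∀ j ∈ s, i ≠ j → Commute (X i) (X j)) {μ : ℂ} {v : V} (hv : v ≠ 0)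
    (h : (∑ i ∈ s, X i) v = μ • v) : -∑ i ∈ s, a i ≤ μ.re := by
  induction s using Finset.induction_on generalizing μ v with
  | empty =>
    have h0 : μ • v = 0 := by simpa using h.symm
    rcases smul_eq_zero.1 h0 with h0 | h0
    · simp [h0]
    · exact absurd h0 hv
  | insert i s hi ih =>
    have hcs : Commute (X i) (∑ j ∈ insert i s, X j) := by
      refine Commute.sum_right _ _ _ fun j hj => ?_
      by_cases hij : i = j
      · exact hij ▸ Commute.refl _
      · exact hc i (Finset.mem_insert_self _ _) j hj hij
    obtain ⟨w, hw, hTw, l, hl, hXw⟩ := exists_eigenvector_of_cube (ha i (Finset.mem_insert_self _ _))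
      (hX i (Finset.mem_insert_self _ _)) hcs hv h
    rw [Finset.sum_insert hi, add_apply, hXw] at hTw
    have := ih (fun j hj => ha j (Finset.mem_insert_of_mem hj))
      (fun j hj => hX j (Finset.mem_insert_of_mem hj))
      (fun j hj k hk => hc j (Finset.mem_insert_of_mem hj) k (Finset.mem_insert_of_mem hk))
      (μ := μ - l) hw (by rw [sub_smul, ← hTw, add_sub_cancel_left])
    rw [Finset.sum_insert hi]
    simp at this
    linarith

/-- An eigenvector to the lowest conceivable eigenvalue `-∑ a i` is a joint eigenvector. -/
theorem eigenvector_of_sum_eq_neg_sum {s : Finset ι} (ha : ∀ i ∈ s, 0 ≤ a i)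
    (hX : ∀ i ∈ s, X i * X i * X i = ((a i : ℂ) ^ 2) • X i)
    (hc : ∀ i ∈ s, ∀ j ∈ s, i ≠ j → Commute (X i) (X j)) {v : V}
    (h : (∑ i ∈ s, X i) v = ((-∑ i ∈ s, a i : ℝ) : ℂ) • v) {i : ι} (hi : i ∈ s) (hai : 0 < a i) :
    X i v = (-a i : ℂ) • v := by
  by_contra hne
  have hcs : Commute (X i) (∑ j ∈ s, X j) := by
    refine Commute.sum_right _ _ _ fun j hj => ?_
    by_cases hij : i = j
    · exact hij ▸ Commute.refl _
    · exact hc i hi j hj hij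
  obtain ⟨w, hw, hTw, l, hl, hXw⟩ := exists_nonneg_eigenvector_of_cube (ha i hi) (hX i hi) hcs h hne
  rw [← Finset.add_sum_erase s X hi, add_apply, hXw] at hTw
  have := neg_sum_le_re_of_cube (s := s.erase i) (fun j hj => ha j (Finset.mem_of_mem_erase hj))
      (fun j hj => hX j (Finset.mem_of_mem_erase hj))
      (fun j hj k hk => hc j (Finset.mem_of_mem_erase hj) k (Finset.mem_of_mem_erase hk))
      (μ := ((-∑ i ∈ s, a i : ℝ) : ℂ) - l) hw (by rw [sub_smul, ← hTw, add_sub_cancel_left])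
  rw [← Finset.add_sum_erase s a hi] at this
  simp only [Complex.sub_re, Complex.ofReal_re] at this
  linarith

end Spectrum

/-! ### Product states of pairs -/

section Pairs

variable {V : Type*} [NormedAddCommGroup V] [InnerProductSpace ℂ V] [CompleteSpace V]

/-- Mutually commuting hard-core pair annihilators `b 0, …, b (m - 1)` with an empty normalized
state `Ω`, which is up to a factor the only state in which all pairs are empty. -/
structure PairModes (m : ℕ) (b : ℕ → V →L[ℂ] V) (Ω : V) : Prop where
  hardCore : ∀ p < m, HardCore (b p)
  comm : ∀ p < m, ∀ q < m, p ≠ q → Commute (b p) (b q)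
  comm_star : ∀ p < m, ∀ q < m, p ≠ q → Commute (b p) (star (b q))
  norm_vac : ‖Ω‖ = 1
  vac : ∀ p < m, b p (star (b p) Ω) = Ω
  vac_unique : ∀ w, (∀ p < m, b p (star (b p) w) = w) → ∃ z : ℂ, w = z • Ω

/-- The product state `∏ (cos θ p + sin θ p · b p†) Ω` of the first `n` pairs. -/
def pairState (b : ℕ → V →L[ℂ] V) (Ω : V) (θ : ℕ → ℝ) : ℕ → V
  | 0 => Ω
  | n + 1 => (Real.cos (θ n) : ℂ) • pairState b Ω θ n +
      (Real.sin (θ n) : ℂ) • star (b n) (pairState b Ω θ n)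

variable {m : ℕ} {b : ℕ → V →L[ℂ] V} {Ω : V}

/-- Rotating an empty pair acts on inner products as on two-component vectors. -/
theorem HardCore.inner_rotate {B : V →L[ℂ] V} (hB : HardCore B) {x y : V}
    (hx : B (star B x) = x) (hy : B (star B y) = y) (a c a' c' : ℝ) :
    inner ℂ ((a : ℂ) • x + (c : ℂ) • star B x) ((a' : ℂ) • y + (c' : ℂ) • star B y) =
      ((a * a' + c * c' : ℝ) : ℂ) * inner ℂ x y := by
  have h0 : ∀ z, B (star B z) = z → B z = 0 := fun z hz => by
    rw [← hz]; exact DFunLike.congr_fun hB.sq _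
  have h1 : inner ℂ x (star B y) = 0 := by
    rw [ContinuousLinearMap.star_eq_adjoint, ContinuousLinearMap.adjoint_inner_right, h0 x hx,
      inner_zero_left]
  have h2 : inner ℂ (star B x) y = 0 := by
    rw [ContinuousLinearMap.star_eq_adjoint, ContinuousLinearMap.adjoint_inner_left, h0 y hy,
      inner_zero_right]
  have h3 : inner ℂ (star B x) (star B y) = inner ℂ x y := by
    rw [ContinuousLinearMap.star_eq_adjoint, ContinuousLinearMap.adjoint_inner_left,
      ← ContinuousLinearMap.star_eq_adjoint, hy]
  simp only [inner_add_left, inner_add_right, inner_smul_left, inner_smul_right, h1, h2, h3,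
    Complex.conj_ofReal]
  push_cast
  ring

theorem PairModes.empty_rotate (hb : PairModes m b Ω) {n q : ℕ} (hn : n < q) (hq : q < m) {x : V}
    (hx : b q (star (b q) x) = x) (a c : ℂ) :
    b q (star (b q) (a • x + c • star (b n) x)) = a • x + c • star (b n) x := by
  have h1 := hb.comm_star q hq n (hn.trans hq) hn.ne'
  have h2 := (hb.comm q hq n (hn.trans hq) hn.ne').star_star
  rw [map_add, map_add, map_smul, map_smul, map_smul, map_smul, hx,
    ← apply_apply_of_commute h2, ← apply_apply_of_commute h1, hx]

theorem PairModes.empty_pairState (hb : PairModes m b Ω) (θ : ℕ → ℝ) {n q : ℕ} (hn : n ≤ q)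
    (hq : q < m) : b q (star (b q) (pairState b Ω θ n)) = pairState b Ω θ n := by
  induction n with
  | zero => exact hb.vac q hq
  | succ n ih => exact hb.empty_rotate hn hq (ih (by omega)) _ _

theorem PairModes.inner_pairState (hb : PairModes m b Ω) (θ : ℕ → ℝ) {n : ℕ} (hn : n ≤ m) :
    inner ℂ (pairState b Ω θ n) (pairState b Ω θ n) = 1 := by
  induction n with
  | zero => simp [pairState, hb.norm_vac]
  | succ n ih =>
    have he := hb.empty_pairState θ le_rfl hn
    rw [pairState, (hb.hardCore n hn).inner_rotate he he, ih (by omega), ← sq, ← sq,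
      Real.cos_sq_add_sin_sq]
    simp

theorem PairModes.norm_pairState (hb : PairModes m b Ω) (θ : ℕ → ℝ) {n : ℕ} (hn : n ≤ m) :
    ‖pairState b Ω θ n‖ = 1 := by
  have := hb.inner_pairState θ hn
  rw [norm_eq_sqrt_re_inner (𝕜 := ℂ), this]
  simp

/-- The product states form a flat family: the derivative is orthogonal to the state, and its
squared norm is the sum of the squared angular velocities. -/
theorem PairModes.exists_hasDerivAt_pairState (hb : PairModes m b Ω) {θ : ℕ → ℝ → ℝ} {θ' : ℕ → ℝ}
    {h₀ : ℝ} {n : ℕ} (hn : n ≤ m) (hθ : ∀ p < n, HasDerivAt (θ p) (θ' p) h₀) :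
    ∃ D : V, HasDerivAt (fun h => pairState b Ω (fun p => θ p h) n) D h₀ ∧
      (∀ q, n ≤ q → q < m → b q (star (b q) D) = D) ∧
      inner ℂ D (pairState b Ω (fun p => θ p h₀) n) = 0 ∧
      inner ℂ D D = ((∑ p ∈ Finset.range n, θ' p ^ 2 : ℝ) : ℂ) := by
  induction n with
  | zero => exact ⟨0, hasDerivAt_const _ _, by simp, by simp, by simp⟩
  | succ n ih =>
    obtain ⟨D, hD, hqD, hDψ, hDD⟩ := ih (by omega) fun p hp => hθ p (by omega)
    set ψ := pairState b Ω (fun p => θ p h₀) n with hψ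
    have hq : ∀ q, n ≤ q → q < m → b q (star (b q) ψ) = ψ := fun q h1 h2 =>
      hb.empty_pairState _ h1 h2
    have hψψ : inner ℂ ψ ψ = 1 := hb.inner_pairState _ (by omega)
    have hψD : inner ℂ ψ D = 0 := by rw [← inner_conj_symm, hDψ, map_zero]
    have hB := hb.hardCore n hn
    have hc : HasDerivAt (fun h => (Real.cos (θ n h) : ℂ))
        (((-Real.sin (θ n h₀) * θ' n : ℝ)) : ℂ) h₀ :=
      ((hθ n (by omega)).cos).ofReal_comp
    have hs : HasDerivAt (fun h => (Real.sin (θ n h) : ℂ))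
        (((Real.cos (θ n h₀) * θ' n : ℝ)) : ℂ) h₀ :=
      ((hθ n (by omega)).sin).ofReal_comp
    have hBD : HasDerivAt (fun h => star (b n) (pairState b Ω (fun p => θ p h) n))
        (star (b n) D) h₀ :=
      (((star (b n)).restrictScalars ℝ).hasFDerivAt.comp_hasDerivAt h₀ hD)
    have key := (hc.smul hD).add (hs.smul hBD)
    set C := Real.cos (θ n h₀) with hC
    set S := Real.sin (θ n h₀) with hS
    have hCS : C ^ 2 + S ^ 2 = 1 := Real.cos_sq_add_sin_sq _
    have e1 := hq n le_rfl hn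
    have e2 := hqD n le_rfl hn
    refine ⟨_, key, ?_, ?_, ?_⟩
    all_goals
      rw [show (C : ℂ) • D + ((-S * θ' n : ℝ) : ℂ) • ψ + ((S : ℂ) • star (b n) D +
          ((C * θ' n : ℝ) : ℂ) • star (b n) ψ) = ((C : ℂ) • D + (S : ℂ) • star (b n) D) +
          (((-S * θ' n : ℝ) : ℂ) • ψ + ((C * θ' n : ℝ) : ℂ) • star (b n) ψ) by abel]
    · intro q h1 h2
      rw [map_add, map_add, hb.empty_rotate h1 h2 (hqD q (by omega) h2),
        hb.empty_rotate h1 h2 (hq q (by omega) h2)]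
    · rw [pairState, inner_add_left, hB.inner_rotate e2 e1, hB.inner_rotate e1 e1, hDψ, hψψ]
      simp only [mul_zero, zero_add, mul_one]
      norm_cast
      ring
    · rw [inner_add_add_self]
      rw [hB.inner_rotate e2 e2, hB.inner_rotate e1 e1, hB.inner_rotate e2 e1,
        hB.inner_rotate e1 e2, hDψ, hψψ, hψD, hDD, Finset.sum_range_succ]
      simp only [mul_zero, mul_one, add_zero]
      norm_cast
      linear_combination (∑ p ∈ Finset.range n, θ' p ^ 2 + θ' n ^ 2) * hCS

/-- The data of one two-level system `pairHam b A C D` in which `(c, s)` is an eigenvector of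
`!![-A, D; C, A]` to the eigenvalue `-E ≠ 0`, with both components nonzero. -/
structure PairParam (A C D E c s : ℝ) : Prop where
  sq : E ^ 2 = A ^ 2 + C * D
  fst : D * s = (A - E) * c
  snd : C * c = -(A + E) * s
  s_ne : s ≠ 0
  C_ne : C ≠ 0
  E_ne : E ≠ 0

theorem pairHam_apply (B : V →L[ℂ] V) (A C D : ℂ) (x : V) :
    pairHam B A C D x = A • (star B (B x) - B (star B x)) + C • star B x + D • B x := rfl

theorem HardCore.pairHam_rotate {B : V →L[ℂ] V} (hB : HardCore B) {A C D E c s : ℝ}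
    (hp : PairParam A C D E c s) {x : V} (hx : B (star B x) = x) :
    pairHam B (A : ℂ) C D ((c : ℂ) • x + (s : ℂ) • star B x) =
      (-E : ℂ) • ((c : ℂ) • x + (s : ℂ) • star B x) := by
  have h0 : B x = 0 := by rw [← hx]; exact DFunLike.congr_fun hB.sq _
  have h1 : star B (star B x) = 0 := DFunLike.congr_fun hB.star_sq _
  have h2 : (D : ℂ) * s = (A - E) * c := by exact_mod_cast hp.fst
  have h3 : (C : ℂ) * c = -(A + E) * s := by exact_mod_cast hp.snd
  simp only [pairHam_apply, map_add, map_smul, h0, h1, hx, map_zero, smul_zero, add_zero,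
    zero_sub, sub_zero]
  match_scalars
  · linear_combination h2
  · linear_combination h3

/-- An eigenvector to the lower eigenvalue is the rotation of an empty state, namely of a multiple
of `B v`. -/
theorem HardCore.eq_rotate_of_pairHam {B : V →L[ℂ] V} (hB : HardCore B) {A C D E c s : ℝ}
    (hp : PairParam A C D E c s) {v : V} (hv : pairHam B (A : ℂ) C D v = (-E : ℂ) • v) :
    v = ((s : ℂ)⁻¹) • ((c : ℂ) • B v + (s : ℂ) • star B (B v)) := by
  have hs : (s : ℂ) ≠ 0 := by exact_mod_cast hp.s_ne
  have hC : (C : ℂ) ≠ 0 := by exact_mod_cast hp.C_ne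
  have hE : (E : ℂ) ≠ 0 := by exact_mod_cast hp.E_ne
  have h3 : (C : ℂ) * c = -(A + E) * s := by exact_mod_cast hp.snd
  have hsq : (E : ℂ) ^ 2 = A ^ 2 + C * D := by exact_mod_cast hp.sq
  have t1 : ∀ x, B (B x) = 0 := fun x => DFunLike.congr_fun hB.sq x
  have t2 : ∀ x, star B (star B x) = 0 := fun x => DFunLike.congr_fun hB.star_sq x
  have t3 : ∀ x, B (star B (B x)) = B x := fun x => DFunLike.congr_fun hB.triple x
  have t4 : ∀ x, star B (B (star B x)) = star B x := fun x => DFunLike.congr_fun hB.star_triple x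
  have hv2 : star B (B v) + B (star B v) = v := by
    have h := DFunLike.congr_fun (hB.pairHam_sq (A : ℂ) C D) v
    change pairHam B (A : ℂ) C D (pairHam B (A : ℂ) C D v) = _ at h
    rw [hv, map_smul, hv, smul_smul, smul_apply, ← hsq] at h
    have h' : ((E : ℂ) ^ 2) • v = (E : ℂ) ^ 2 • (star B (B v) + B (star B v)) := by
      rw [show (-E : ℂ) * -E = (E : ℂ) ^ 2 by ring] at h
      exact h
    exact (smul_right_injective V (pow_ne_zero 2 hE) h').symm
  have hv3 : star B v = ((c : ℂ) / s) • star B (B v) := by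
    have h := congrArg (fun x => star B (B x)) hv
    simp only [pairHam_apply, map_add, map_smul, map_sub, t1, t3, t4, smul_zero,
      sub_zero, add_zero] at h
    have h4 : (C : ℂ) • star B v = (-(A + E) : ℂ) • star B (B v) := by
      rw [← sub_eq_zero] at h ⊢
      rw [← h]
      module
    have h5 : star B v = (C : ℂ)⁻¹ • (-(A + E) : ℂ) • star B (B v) := by
      rw [← h4, smul_smul, inv_mul_cancel₀ hC, one_smul]
    rw [h5, smul_smul]
    congr 1
    field_simp
    linear_combination -h3
  conv_lhs => rw [← hv2, hv3]
  rw [map_smul, t3, smul_add, smul_smul, smul_smul, inv_mul_cancel₀ hs, one_smul, add_comm,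
    div_eq_inv_mul]

variable {A C D E θ : ℕ → ℝ}

theorem PairModes.commute_star_pairHam (hb : PairModes m b Ω) {p q : ℕ} (hp : p < m) (hq : q < m)
    (hpq : p ≠ q) (A C D : ℂ) : Commute (star (b p)) (pairHam (b q) A C D) :=
  commute_pairHam (hb.comm_star q hq p hp hpq.symm).symm (hb.comm p hp q hq hpq).star_star A C D

theorem PairModes.commute_ann_pairHam (hb : PairModes m b Ω) {p q : ℕ} (hp : p < m) (hq : q < m)
    (hpq : p ≠ q) (A C D : ℂ) : Commute (b p) (pairHam (b q) A C D) :=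
  commute_pairHam (hb.comm p hp q hq hpq) (hb.comm_star p hp q hq hpq) A C D

theorem PairModes.commute_pairHam_pairHam (hb : PairModes m b Ω) {p q : ℕ} (hp : p < m)
    (hq : q < m) (hpq : p ≠ q) (A C D A' C' D' : ℂ) :
    Commute (pairHam (b p) A C D) (pairHam (b q) A' C' D') :=
  commute_pairHam (hb.commute_ann_pairHam hq hp hpq.symm A C D).symm
    (hb.commute_star_pairHam hq hp hpq.symm A C D).symm A' C' D'

theorem PairModes.pairHam_pairState (hb : PairModes m b Ω) {n : ℕ} (hn : n ≤ m) {p : ℕ}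
    (hpn : p < n) (hp : PairParam (A p) (C p) (D p) (E p) (Real.cos (θ p)) (Real.sin (θ p))) :
    pairHam (b p) (A p : ℂ) (C p) (D p) (pairState b Ω θ n) =
      (-E p : ℂ) • pairState b Ω θ n := by
  induction n with
  | zero => omega
  | succ n ih =>
    rcases Nat.lt_succ_iff_lt_or_eq.1 hpn with h | rfl
    · have hc := hb.commute_star_pairHam (p := n) (q := p) (by omega) (by omega) h.ne' (A p) (C p)
        (D p)
      rw [pairState, map_add, map_smul, map_smul, apply_apply_of_commute hc, ih (by omega) h]
      simp only [map_smul]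
      module
    · exact (hb.hardCore p hn).pairHam_rotate hp (hb.empty_pairState θ le_rfl hn)

/-- The joint ground state is unique: applying `b n` strips the `n`-th pair off a joint
eigenvector and empties it. -/
theorem PairModes.eq_smul_pairState (hb : PairModes m b Ω) {n : ℕ} (hn : n ≤ m)
    (hp : ∀ p < n, PairParam (A p) (C p) (D p) (E p) (Real.cos (θ p)) (Real.sin (θ p))) {v : V}
    (hv : ∀ p < n, pairHam (b p) (A p : ℂ) (C p) (D p) v = (-E p : ℂ) • v)
    (hv' : ∀ p, n ≤ p → p < m → b p (star (b p) v) = v) :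
    ∃ z : ℂ, v = z • pairState b Ω θ n := by
  induction n generalizing v with
  | zero => exact hb.vac_unique v fun p h => hv' p (Nat.zero_le p) h
  | succ n ih =>
    have hB := hb.hardCore n hn
    obtain ⟨z, hz⟩ := ih (v := b n v) (by omega) (fun p h => hp p (by omega))
      (fun p h => by
        rw [apply_apply_of_commute (hb.commute_ann_pairHam (p := n) (q := p) hn (by omega) h.ne' _ _ _),
          hv p (by omega), map_smul])
      (fun p h1 h2 => by
        rcases h1.eq_or_lt with rfl | h
        · exact DFunLike.congr_fun hB.triple v
        · rw [apply_apply_of_commute (hb.comm_star n hn p h2 h.ne),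
            apply_apply_of_commute (hb.comm n hn p h2 h.ne), hv' p (by omega) h2])
    refine ⟨(Real.sin (θ n) : ℂ)⁻¹ * z, ?_⟩
    conv_lhs => rw [hB.eq_rotate_of_pairHam (hp n (by omega)) (hv n (by omega)), hz]
    rw [pairState, map_smul, mul_smul]
    module

end Pairs

/-! ### Quantum Fisher information of a family determined up to a phase -/

section QFI

variable {n : Type*} [Fintype n] [DecidableEq n]

theorem HasGroundQFI.groundQFI_eq {H : ℝ → Matrix n n ℂ} {h₀ F : ℝ} (hF : HasGroundQFI H h₀ F) :
    groundQFI H h₀ = F := by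
  have hex : ∃ F, HasGroundQFI H h₀ F := ⟨F, hF⟩
  rw [groundQFI, dif_pos hex]
  obtain ⟨ψ, hψ⟩ := hF.1
  rw [← hF.2 ψ hψ, hex.choose_spec.2 ψ hψ]

theorem HasGroundQFI.hasGroundQFI_groundQFI {H : ℝ → Matrix n n ℂ} {h₀ F : ℝ}
    (hF : HasGroundQFI H h₀ F) : HasGroundQFI H h₀ (groundQFI H h₀) := by
  rwa [hF.groundQFI_eq]

/-- If the ground state is unique up to a phase near `h₀`, a differentiable choice `ψ` with
`⟨dψ|ψ⟩ = 0` has the quantum Fisher information `4 ⟨dψ|dψ⟩`, and so have all others. -/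
theorem hasGroundQFI_of_unique {H : ℝ → Matrix n n ℂ} {h₀ F : ℝ} {ψ : ℝ → EuclideanSpace ℂ n}
    {D : EuclideanSpace ℂ n} (hD : HasDerivAt ψ D h₀) (hDψ : inner ℂ D (ψ h₀) = 0)
    (hDD : inner ℂ D D = (F : ℂ)) (hψ : ∀ᶠ h in 𝓝 h₀, IsGroundState (H h) (ψ h))
    (huniq : ∀ᶠ h in 𝓝 h₀, ∀ v, IsGroundState (H h) v → ∃ z : ℂ, v = z • ψ h) :
    HasGroundQFI H h₀ (4 * F) := by
  refine ⟨⟨ψ, hψ, hD.differentiableAt⟩, fun χ hχ => ?_⟩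
  have hn : ∀ {h v}, IsGroundState (H h) v → inner ℂ v v = 1 := fun hv => by
    rw [inner_self_eq_norm_sq_to_K, hv.1]; simp
  set z : ℝ → ℂ := fun h => inner ℂ (ψ h) (χ h) with hz
  have hzd : DifferentiableAt ℝ z h₀ := hD.differentiableAt.inner ℂ hχ.2
  have hχz : χ =ᶠ[𝓝 h₀] fun h => z h • ψ h := by
    filter_upwards [hψ, huniq, hχ.1] with h h1 h2 h3
    obtain ⟨w, hw⟩ := h2 _ h3
    simp only [hz]
    rw [hw, inner_smul_right, hn h1, mul_one]
  have hχ0 : χ h₀ = z h₀ • ψ h₀ := hχz.self_of_nhds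
  have hψ1 : inner ℂ (ψ h₀) (ψ h₀) = 1 := hn hψ.self_of_nhds
  have hz1 : (starRingEnd ℂ) (z h₀) * z h₀ = 1 := by
    have := hn hχ.1.self_of_nhds
    rw [hχ0, inner_smul_left, inner_smul_right, hψ1, mul_one] at this
    exact this
  have hd : deriv χ h₀ = z h₀ • D + deriv z h₀ • ψ h₀ := by
    rw [hχz.deriv_eq]
    exact (hzd.hasDerivAt.smul hD).deriv
  have hψD : inner ℂ (ψ h₀) D = 0 := by rw [← inner_conj_symm, hDψ, map_zero]
  set z' := deriv z h₀ with hz'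
  have h1 : inner ℂ (deriv χ h₀) (deriv χ h₀) = (F : ℂ) + (starRingEnd ℂ) z' * z' := by
    rw [hd]
    simp only [inner_add_left, inner_add_right, inner_smul_left, inner_smul_right, hψD, hDψ, hDD,
      hψ1]
    linear_combination (F : ℂ) * hz1
  have h2 : ‖inner ℂ (deriv χ h₀) (χ h₀)‖ ^ 2 = ‖z'‖ ^ 2 := by
    rw [hd, hχ0]
    simp only [inner_add_left, inner_smul_left, inner_smul_right, hDψ, hψ1]
    have : ‖z h₀‖ ^ 2 = 1 := by
      rw [Complex.conj_mul'] at hz1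
      exact_mod_cast hz1
    simp only [mul_zero, zero_add, mul_one, norm_mul, RCLike.norm_conj, mul_pow, this, one_mul]
  rw [qfi, h1, h2, Complex.conj_mul']
  norm_cast
  ring

end QFI

/-! ### Ground states of a sum of pair Hamiltonians -/

section Ground

variable {n : Type*} [Fintype n] [DecidableEq n] {m : ℕ}
  {b : ℕ → EuclideanSpace ℂ n →L[ℂ] EuclideanSpace ℂ n} {Ω : EuclideanSpace ℂ n}

/-- If the ground states of `H h` are exactly the joint eigenvectors of pair Hamiltonians to the
lowest eigenvalues `-E p h`, the quantum Fisher information is the sum over the pairs of `4 θ'²`,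
with `θ p h` the angle of the two-component ground state of the pair `p`. -/
theorem PairModes.hasGroundQFI (hb : PairModes m b Ω) {H : ℝ → Matrix n n ℂ} {h₀ : ℝ}
    {A C D E θ : ℕ → ℝ → ℝ} {θ' : ℕ → ℝ}
    (hθ : ∀ p < m, HasDerivAt (θ p) (θ' p) h₀)
    (hp : ∀ᶠ h in 𝓝 h₀, ∀ p < m,
      PairParam (A p h) (C p h) (D p h) (E p h) (Real.cos (θ p h)) (Real.sin (θ p h)))
    (heig : ∀ᶠ h in 𝓝 h₀, (H h).toEuclideanLin (pairState b Ω (fun p => θ p h) m) =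
      ((-∑ p ∈ Finset.range m, E p h : ℝ) : ℂ) • pairState b Ω (fun p => θ p h) m)
    (hlow : ∀ᶠ h in 𝓝 h₀, ∀ v, v ≠ 0 → ∀ μ : ℂ, (H h).toEuclideanLin v = μ • v →
      -∑ p ∈ Finset.range m, E p h ≤ μ.re)
    (hground : ∀ᶠ h in 𝓝 h₀, ∀ v, (H h).toEuclideanLin v =
      ((-∑ p ∈ Finset.range m, E p h : ℝ) : ℂ) • v →
      ∀ p < m, pairHam (b p) (A p h : ℂ) (C p h) (D p h) v = (-E p h : ℂ) • v) :
    HasGroundQFI H h₀ (4 * ∑ p ∈ Finset.range m, θ' p ^ 2) := by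
  obtain ⟨d, hd, -, hdψ, hdd⟩ := hb.exists_hasDerivAt_pairState le_rfl hθ
  refine hasGroundQFI_of_unique hd hdψ hdd ?_ ?_
  · filter_upwards [heig, hlow] with h h1 h2
    refine ⟨hb.norm_pairState _ le_rfl, _, h1, fun μ hμ => ?_⟩
    obtain ⟨v, hv⟩ := hμ.exists_hasEigenvector
    exact h2 v hv.2 μ hv.apply_eq_smul
  · filter_upwards [heig, hlow, hground, hp] with h h1 h2 h3 h4 v hv
    obtain ⟨e, he, hle⟩ := hv.2
    have hv0 : v ≠ 0 := by
      rintro rfl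
      simpa using hv.1
    have hψ0 : pairState b Ω (fun p => θ p h) m ≠ 0 := by
      intro h0
      have := hb.norm_pairState (fun p => θ p h) le_rfl
      rw [h0] at this
      simp at this
    have ha := h2 v hv0 e he
    have hb' := hle _ (Module.End.hasEigenvalue_of_hasEigenvector
      ⟨Module.End.mem_eigenspace_iff.2 h1, hψ0⟩)
    rw [Complex.ofReal_re] at ha hb'
    rw [le_antisymm hb' ha] at he
    exact hb.eq_smul_pairState (A := fun p => A p h) (C := fun p => C p h) (D := fun p => D p h)
      (E := fun p => E p h) (θ := fun p => θ p h) le_rfl h4 (h3 v he)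
      (fun p h5 h6 => absurd h6 (by omega))

end Ground

/-! ### The Jordan–Wigner transformation -/

section JordanWigner

open Matrix

variable {N : ℕ}

theorem siteOp_mulVec (A : Matrix (Fin 2) (Fin 2) ℂ) (j : Fin N) (f : Config N → ℂ)
    (s : Config N) :
    (siteOp A j *ᵥ f) s = ∑ x, A (s j) x * f (Function.update s j x) := by
  have key : ∀ t : Config N, (siteOp A j) s t * f t =
      ∑ x, if t = Function.update s j x then A (s j) x * f t else 0 := by
    intro t
    by_cases h : ∀ i, i ≠ j → s i = t i
    · have : ∀ x, (t = Function.update s j x) ↔ t j = x := fun x => by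
        constructor
        · intro h'
          rw [h', Function.update_self]
        · rintro rfl
          funext i
          by_cases hi : i = j
          · subst hi; simp
          · rw [Function.update_of_ne hi, h i hi]
      simp [siteOp, this, if_pos h]
    · have : ∀ x, t ≠ Function.update s j x := fun x h' => h fun i hi => by
        rw [h', Function.update_of_ne hi]
      simp only [siteOp, Matrix.of_apply, if_neg h, zero_mul, this, if_false,
        Finset.sum_const_zero]
  simp only [Matrix.mulVec, dotProduct]
  rw [Finset.sum_congr rfl fun t _ => key t, Finset.sum_comm]
  simp

theorem siteOp_mul (A B : Matrix (Fin 2) (Fin 2) ℂ) (j : Fin N) :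
    siteOp A j * siteOp B j = siteOp (A * B) j := by
  refine Matrix.mulVec_injective (funext fun f => funext fun s => ?_)
  rw [← Matrix.mulVec_mulVec, siteOp_mulVec, siteOp_mulVec]
  simp only [siteOp_mulVec, Function.update_self, Function.update_idem, Matrix.mul_apply,
    Fin.sum_univ_two]
  ring

theorem siteOp_commute (A B : Matrix (Fin 2) (Fin 2) ℂ) {i j : Fin N} (hij : i ≠ j) :
    Commute (siteOp A i) (siteOp B j) := by
  refine Matrix.mulVec_injective (funext fun f => funext fun s => ?_)
  rw [← Matrix.mulVec_mulVec, ← Matrix.mulVec_mulVec, siteOp_mulVec, siteOp_mulVec]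
  simp only [siteOp_mulVec, Function.update_of_ne hij, Function.update_of_ne hij.symm,
    Fin.sum_univ_two, Function.update_comm hij]
  ring

theorem siteOp_add (A B : Matrix (Fin 2) (Fin 2) ℂ) (j : Fin N) :
    siteOp (A + B) j = siteOp A j + siteOp B j := by
  ext s t
  simp only [siteOp, Matrix.of_apply, Matrix.add_apply]
  split_ifs <;> simp

theorem siteOp_smul (z : ℂ) (A : Matrix (Fin 2) (Fin 2) ℂ) (j : Fin N) :
    siteOp (z • A) j = z • siteOp A j := by
  ext s t
  simp [siteOp, Matrix.of_apply, Matrix.smul_apply]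

theorem siteOp_one (j : Fin N) : siteOp 1 j = 1 := by
  refine Matrix.mulVec_injective (funext fun f => funext fun s => ?_)
  rw [siteOp_mulVec]
  simp [Matrix.one_apply]

theorem siteOp_neg (A : Matrix (Fin 2) (Fin 2) ℂ) (j : Fin N) : siteOp (-A) j = -siteOp A j := by
  rw [← neg_one_smul ℂ, siteOp_smul, neg_one_smul]

theorem siteOp_zero (j : Fin N) : siteOp 0 j = 0 := by
  simpa using siteOp_smul 0 0 j

theorem star_siteOp (A : Matrix (Fin 2) (Fin 2) ℂ) (j : Fin N) :
    star (siteOp A j) = siteOp (star A) j := by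
  ext s t
  simp only [siteOp, Matrix.star_apply, Matrix.of_apply, eq_comm (a := s _)]
  split_ifs <;> simp

/-- The occupation parity of a spin: an up spin (index `0`) counts as an occupied site. -/
def occSign (x : Fin 2) : ℂ := if x = 0 then -1 else 1

/-- The diagonal operator `(-1) ^ (number of up spins in S)`. -/
def signOp (S : Finset (Fin N)) : Matrix (Config N) (Config N) ℂ :=
  Matrix.diagonal fun s => ∏ i ∈ S, occSign (s i)

theorem occSign_mul_self (x : Fin 2) : occSign x * occSign x = 1 := by
  unfold occSign; split_ifs <;> norm_num

theorem signOp_mulVec (S : Finset (Fin N)) (f : Config N → ℂ) (s : Config N) :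
    (signOp S *ᵥ f) s = (∏ i ∈ S, occSign (s i)) * f s := by
  rw [signOp, Matrix.mulVec_diagonal]

theorem signOp_sq (S : Finset (Fin N)) : signOp S * signOp S = 1 := by
  rw [signOp, Matrix.diagonal_mul_diagonal]
  simp [← Finset.prod_mul_distrib, occSign_mul_self]

theorem signOp_comm (S T : Finset (Fin N)) : signOp S * signOp T = signOp T * signOp S := by
  rw [signOp, signOp, Matrix.diagonal_mul_diagonal, Matrix.diagonal_mul_diagonal]
  simp only [mul_comm]

theorem star_signOp (S : Finset (Fin N)) : star (signOp S) = signOp S := by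
  rw [signOp, Matrix.star_eq_conjTranspose, Matrix.diagonal_conjTranspose]
  congr 1
  funext s
  simp only [Pi.star_apply, star_prod]
  refine Finset.prod_congr rfl fun i _ => ?_
  unfold occSign; split_ifs <;> simp

theorem signOp_insert {S : Finset (Fin N)} {k : Fin N} (hk : k ∉ S) :
    signOp (insert k S) = signOp S * siteOp (Matrix.diagonal occSign) k := by
  refine Matrix.mulVec_injective (funext fun f => funext fun s => ?_)
  rw [← Matrix.mulVec_mulVec, signOp_mulVec, signOp_mulVec, siteOp_mulVec, Finset.prod_insert hk]
  rw [Finset.sum_eq_single (s k)]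
  · rw [Function.update_eq_self, Matrix.diagonal_apply_eq]
    ring
  · intro x _ hx
    rw [Matrix.diagonal_apply_ne _ hx.symm, zero_mul]
  · simp

theorem signOp_empty : signOp (∅ : Finset (Fin N)) = 1 := by
  simp [signOp]

theorem signOp_mul_siteOp_of_notMem {S : Finset (Fin N)} {k : Fin N} (hk : k ∉ S)
    (A : Matrix (Fin 2) (Fin 2) ℂ) : signOp S * siteOp A k = siteOp A k * signOp S := by
  refine Matrix.mulVec_injective (funext fun f => funext fun s => ?_)
  rw [← Matrix.mulVec_mulVec, ← Matrix.mulVec_mulVec, signOp_mulVec, siteOp_mulVec, siteOp_mulVec,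
    Finset.mul_sum]
  refine Finset.sum_congr rfl fun x _ => ?_
  have h : ∏ i ∈ S, occSign (Function.update s k x i) = ∏ i ∈ S, occSign (s i) :=
    Finset.prod_congr rfl fun i hi => by
      rw [Function.update_of_ne (show i ≠ k from fun h => hk (h ▸ hi))]
  rw [signOp_mulVec, h]
  ring

theorem signOp_mul_siteOp_of_mem {S : Finset (Fin N)} {k : Fin N} (hk : k ∈ S)
    {A : Matrix (Fin 2) (Fin 2) ℂ} (hA : ∀ x, A x x = 0) :
    signOp S * siteOp A k = -(siteOp A k * signOp S) := by
  have hA' : Matrix.diagonal occSign * A = -(A * Matrix.diagonal occSign) := by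
    ext x y
    rw [Matrix.diagonal_mul, Matrix.neg_apply, Matrix.mul_diagonal]
    have h0 := hA 0
    have h1 := hA 1
    fin_cases x <;> fin_cases y <;> simp [occSign, h0, h1]
  have hk' := Finset.notMem_erase k S
  rw [← Finset.insert_erase hk, signOp_insert hk', mul_assoc, siteOp_mul, hA', siteOp_neg, mul_neg,
    signOp_mul_siteOp_of_notMem hk', ← siteOp_mul, mul_assoc, signOp_mul_siteOp_of_notMem hk']

/-- The operator `A` at the site `j`, with the Jordan–Wigner string to its left. -/
def fer (A : Matrix (Fin 2) (Fin 2) ℂ) (j : Fin N) : Matrix (Config N) (Config N) ℂ :=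
  signOp (Finset.Iio j) * siteOp A j

/-- The spin lowering matrix. -/
def lower : Matrix (Fin 2) (Fin 2) ℂ := !![0, 0; 1, 0]

/-- The spin raising matrix. -/
def raise : Matrix (Fin 2) (Fin 2) ℂ := !![0, 1; 0, 0]

theorem lower_diag (x : Fin 2) : lower x x = 0 := by fin_cases x <;> simp [lower]

theorem raise_diag (x : Fin 2) : raise x x = 0 := by fin_cases x <;> simp [raise]

theorem fer_mul_fer_self (A B : Matrix (Fin 2) (Fin 2) ℂ) (j : Fin N) :
    fer A j * fer B j = siteOp (A * B) j := by
  have h : j ∉ Finset.Iio j := by simp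
  rw [fer, fer, signOp_mul_siteOp_of_notMem h, mul_assoc, ← mul_assoc (signOp _) (signOp _),
    signOp_sq, one_mul, siteOp_mul]

theorem fer_anti {A B : Matrix (Fin 2) (Fin 2) ℂ} (hA : ∀ x, A x x = 0) {i j : Fin N}
    (hij : i < j) : fer A i * fer B j + fer B j * fer A i = 0 := by
  have h1 : i ∈ Finset.Iio j := by simpa
  have h2 : j ∉ Finset.Iio i := by simpa using hij.le
  have e1 : siteOp A i * signOp (Finset.Iio j) = -(signOp (Finset.Iio j) * siteOp A i) := by
    rw [signOp_mul_siteOp_of_mem h1 hA, neg_neg]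
  have e2 : fer A i * fer B j =
      -(signOp (Finset.Iio i) * signOp (Finset.Iio j) * (siteOp A i * siteOp B j)) := by
    rw [fer, fer, mul_assoc, ← mul_assoc (siteOp A i), e1]
    simp only [neg_mul, mul_neg, mul_assoc]
  have e3 : fer B j * fer A i =
      signOp (Finset.Iio i) * signOp (Finset.Iio j) * (siteOp A i * siteOp B j) := by
    rw [fer, fer, mul_assoc, ← mul_assoc (siteOp B j), ← signOp_mul_siteOp_of_notMem h2,
      mul_assoc, (siteOp_commute B A hij.ne').eq, ← mul_assoc, signOp_comm]
  rw [e2, e3, neg_add_cancel]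

theorem star_fer (A : Matrix (Fin 2) (Fin 2) ℂ) (j : Fin N) : star (fer A j) = fer (star A) j := by
  rw [fer, star_mul, star_siteOp, star_signOp, ← signOp_mul_siteOp_of_notMem (by simp), fer]

theorem star_lower : star lower = raise := by
  ext x y
  fin_cases x <;> fin_cases y <;> simp [lower, raise, Matrix.star_apply]

/-- The Jordan–Wigner annihilator at the site `j`. -/
def jw (j : Fin N) : Matrix (Config N) (Config N) ℂ := fer lower j

theorem star_jw (j : Fin N) : star (jw j) = fer raise j := by rw [jw, star_fer, star_lower]

theorem raise_mul_lower : raise * lower = !![1, 0; 0, 0] := by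
  ext x y; fin_cases x <;> fin_cases y <;> simp [lower, raise]

theorem car_jw : CAR (jw : Fin N → Matrix (Config N) (Config N) ℂ) := by
  constructor
  · intro i j
    rcases lt_trichotomy i j with h | rfl | h
    · exact fer_anti lower_diag h
    · have : lower * lower = 0 := by
        ext x y; fin_cases x <;> fin_cases y <;> simp [lower]
      rw [jw, fer_mul_fer_self, this, siteOp_zero, add_zero]
    · rw [add_comm]
      exact fer_anti lower_diag h
  · intro i j
    rw [star_jw]
    rcases lt_trichotomy i j with h | rfl | h
    · rw [if_neg h.ne]
      exact fer_anti lower_diag h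
    · have : lower * raise + raise * lower = 1 := by
        ext x y; fin_cases x <;> fin_cases y <;> simp [lower, raise]
      rw [jw, fer_mul_fer_self, fer_mul_fer_self, ← siteOp_add, this, siteOp_one, if_pos rfl]
    · rw [if_neg h.ne', add_comm]
      exact fer_anti raise_diag h

/-- The fermion parity. -/
def parity : Matrix (Config N) (Config N) ℂ := signOp Finset.univ

theorem parity_mul_fer {A : Matrix (Fin 2) (Fin 2) ℂ} (hA : ∀ x, A x x = 0) (j : Fin N) :
    parity * fer A j = -(fer A j * parity) := by
  rw [parity, fer, ← mul_assoc, signOp_comm, mul_assoc,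
    signOp_mul_siteOp_of_mem (Finset.mem_univ j) hA, mul_neg, mul_assoc]

theorem parity_commute_fer_mul_fer {A B : Matrix (Fin 2) (Fin 2) ℂ} (hA : ∀ x, A x x = 0)
    (hB : ∀ x, B x x = 0) (i j : Fin N) : Commute parity (fer A i * fer B j) := by
  change _ * (_ * _) = _ * _ * _
  rw [← mul_assoc, parity_mul_fer hA, neg_mul, mul_assoc, parity_mul_fer hB, mul_neg, neg_neg,
    mul_assoc]

/-- The vacuum: all spins down. -/
def vacuum : EuclideanSpace ℂ (Config N) := EuclideanSpace.single (fun _ => 1) 1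

theorem jw_mulVec_vacuum (j : Fin N) : jw j *ᵥ (vacuum : EuclideanSpace ℂ (Config N)).ofLp = 0 := by
  suffices h : siteOp lower j *ᵥ (vacuum : EuclideanSpace ℂ (Config N)).ofLp = 0 by
    rw [jw, fer, ← Matrix.mulVec_mulVec, h, Matrix.mulVec_zero]
  funext s
  rw [siteOp_mulVec]
  simp only [Fin.sum_univ_two, Pi.zero_apply]
  have h1 : lower (s j) 1 = 0 := by
    generalize s j = x
    fin_cases x <;> simp [lower]
  have h0 : (vacuum : EuclideanSpace ℂ (Config N)).ofLp (Function.update s j 0) = 0 := by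
    have : Function.update s j 0 ≠ fun _ => 1 := fun h => by
      have := congrFun h j
      simp at this
    simp [vacuum, this]
  rw [h1, h0]
  simp

theorem eq_smul_vacuum {v : EuclideanSpace ℂ (Config N)} (hv : ∀ j, jw j *ᵥ v.ofLp = 0) :
    ∃ z : ℂ, v = z • vacuum := by
  refine ⟨v (fun _ => 1), ?_⟩
  have h : ∀ j s, s j = 0 → v s = 0 := by
    intro j s hs
    have h1 : siteOp lower j *ᵥ v.ofLp = 0 := by
      have := congrArg (fun f => signOp (Finset.Iio j) *ᵥ f) (hv j)
      simpa [jw, fer, Matrix.mulVec_mulVec, ← mul_assoc, signOp_sq] using this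
    have h2 := congrFun h1 (Function.update s j 1)
    rw [siteOp_mulVec] at h2
    have h3 : Function.update s j 0 = s := by rw [← hs, Function.update_eq_self]
    simpa [Fin.sum_univ_two, lower, h3] using h2
  ext s
  by_cases hs : s = fun _ => 1
  · subst hs; simp [vacuum]
  · obtain ⟨j, hj⟩ : ∃ j, s j ≠ 1 := by
      by_contra hcon
      push Not at hcon
      exact hs (funext hcon)
    rw [h j s (by omega)]
    simp [vacuum, hs]

theorem parity_mulVec_vacuum :
    parity *ᵥ (vacuum : EuclideanSpace ℂ (Config N)).ofLp = vacuum.ofLp := by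
  funext s
  rw [parity, signOp_mulVec]
  by_cases hs : s = fun _ => 1
  · subst hs; simp [occSign]
  · simp [vacuum, hs]

end JordanWigner

/-! ### The chain as a free fermion Hamiltonian in each parity sector -/

section Sectors

open Matrix

variable {N : ℕ}

theorem finRotate_val (i : Fin N) :
    ((finRotate N i : Fin N) : ℕ) = if (i : ℕ) + 1 = N then 0 else (i : ℕ) + 1 := by
  obtain ⟨n, rfl⟩ : ∃ n, N = n + 1 := ⟨N - 1, by have := i.pos; omega⟩
  rw [coe_finRotate]
  have : i = Fin.last n ↔ (i : ℕ) + 1 = n + 1 := by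
    rw [Fin.ext_iff, Fin.val_last]; omega
  simp only [this]

/-- The spin operators on a bond are fermion bilinears, up to the parity on the bond that closes
the ring. -/
theorem siteOp_mul_siteOp_bond {A : Matrix (Fin 2) (Fin 2) ℂ} (hA : ∀ x, A x x = 0)
    (B : Matrix (Fin 2) (Fin 2) ℂ) (i : Fin N) :
    siteOp (A * Matrix.diagonal occSign) i * siteOp B (finRotate N i) =
      if (i : ℕ) + 1 = N then -(parity * (fer A i * fer B (finRotate N i)))
      else fer A i * fer B (finRotate N i) := by
  have hi' := finRotate_val i
  have hni : i ∉ Finset.Iio i := by simp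
  have hA' : Matrix.diagonal occSign * A = -(A * Matrix.diagonal occSign) := by
    ext x y
    rw [Matrix.diagonal_mul, Matrix.neg_apply, Matrix.mul_diagonal]
    have h0 := hA 0
    have h1 := hA 1
    fin_cases x <;> fin_cases y <;> simp [occSign, h0, h1]
  split_ifs with h
  · rw [if_pos h] at hi'
    have e0 : Finset.Iio (finRotate N i) = ∅ := by
      ext k
      simp only [Finset.mem_Iio, Finset.notMem_empty, iff_false, Fin.lt_def, hi']
      omega
    have e1 : (Finset.univ : Finset (Fin N)) = insert i (Finset.Iio i) := by
      ext k
      simp only [Finset.mem_univ, Finset.mem_insert, Finset.mem_Iio, true_iff, Fin.ext_iff,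
        Fin.lt_def]
      omega
    rw [parity, e1, signOp_insert hni, fer, fer, e0, signOp_empty, one_mul]
    rw [show ∀ a b c d : Matrix (Config N) (Config N) ℂ, a * b * (a * c * d) = a * (b * a) * c * d
      from fun a b c d => by simp only [mul_assoc], ← signOp_mul_siteOp_of_notMem hni,
      ← mul_assoc, signOp_sq, one_mul, siteOp_mul, hA', siteOp_neg, neg_mul, neg_neg]
  · rw [if_neg h] at hi'
    have e1 : Finset.Iio (finRotate N i) = insert i (Finset.Iio i) := by
      ext k
      simp only [Finset.mem_insert, Finset.mem_Iio, Fin.ext_iff, Fin.lt_def, hi']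
      omega
    rw [fer, fer, e1, signOp_insert hni, signOp_mul_siteOp_of_notMem hni]
    rw [show ∀ a b c d : Matrix (Config N) (Config N) ℂ, a * b * (b * c * d) = a * (b * b) * c * d
      from fun a b c d => by simp only [mul_assoc], signOp_sq, mul_one, siteOp_mul]

theorem pauliX_eq : pauliX = raise + lower := by
  ext x y; fin_cases x <;> fin_cases y <;> simp [pauliX, raise, lower]

theorem pauliY_eq : pauliY = (-Complex.I) • raise + Complex.I • lower := by
  ext x y; fin_cases x <;> fin_cases y <;> simp [pauliY, raise, lower]

theorem pauliZ_eq : pauliZ = (2 : ℂ) • (raise * lower) - (1 : ℂ) • 1 := by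
  rw [raise_mul_lower]
  ext x y; fin_cases x <;> fin_cases y <;> norm_num [pauliZ]

theorem raise_mul_occSign : raise * Matrix.diagonal occSign = raise := by
  ext x y; fin_cases x <;> fin_cases y <;> simp [raise, occSign]

theorem lower_mul_occSign : lower * Matrix.diagonal occSign = -lower := by
  ext x y; fin_cases x <;> fin_cases y <;> simp [lower, occSign]

theorem bond_eq (γ K : ℝ) (i j : Fin N) :
    ((1 + Complex.I * (γ : ℂ)) / 4) • (siteOp pauliX i * siteOp pauliX j)
      + ((1 - Complex.I * (γ : ℂ)) / 4) • (siteOp pauliY i * siteOp pauliY j)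
      + ((K : ℂ) / 4) • (siteOp pauliX i * siteOp pauliY j + siteOp pauliY i * siteOp pauliX j) =
    (1 / 2 : ℂ) • (siteOp raise i * siteOp lower j + siteOp lower i * siteOp raise j) +
      (Complex.I * (γ - K) / 2) • (siteOp raise i * siteOp raise j) +
      (Complex.I * (γ + K) / 2) • (siteOp lower i * siteOp lower j) := by
  simp only [pauliX_eq, pauliY_eq, siteOp_add, siteOp_smul, add_mul, mul_add, smul_mul_assoc,
    mul_smul_comm]
  match_scalars <;> ring_nf <;> simp only [Complex.I_sq, Complex.I_pow_three] <;> ring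

/-- The bond term `½ (c†ᵢ cⱼ - cᵢ c†ⱼ) + i (γ - K) / 2 c†ᵢ c†ⱼ - i (γ + K) / 2 cᵢ cⱼ`. -/
def fermiBond (γ K : ℝ) (i j : Fin N) : Matrix (Config N) (Config N) ℂ :=
  (1 / 2 : ℂ) • (star (jw i) * jw j - jw i * star (jw j)) +
    (Complex.I * (γ - K) / 2) • (star (jw i) * star (jw j)) -
    (Complex.I * (γ + K) / 2) • (jw i * jw j)

/-- The free fermion Hamiltonian on a ring, with the factor `s` on the bond that closes it. -/
def fermiHam (N : ℕ) (s : ℂ) (h γ K : ℝ) : Matrix (Config N) (Config N) ℂ :=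
  ∑ i : Fin N, ((if (i : ℕ) + 1 = N then s else 1) • fermiBond γ K i (finRotate N i) +
    (h : ℂ) • (star (jw i) * jw i - (1 / 2 : ℂ) • 1))

theorem chainHamiltonian_eq (h γ K : ℝ) :
    chainHamiltonian N h γ K =
      ∑ i : Fin N, ((if (i : ℕ) + 1 = N then -(parity * fermiBond γ K i (finRotate N i))
        else fermiBond γ K i (finRotate N i)) +
        (h : ℂ) • (star (jw i) * jw i - (1 / 2 : ℂ) • 1)) := by
  rw [chainHamiltonian]
  refine Finset.sum_congr rfl fun i _ => ?_
  rw [bond_eq]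
  have hz : ((h : ℂ) / 2) • siteOp pauliZ i = (h : ℂ) • (star (jw i) * jw i - (1 / 2 : ℂ) • 1) := by
    rw [star_jw, jw, fer_mul_fer_self, pauliZ_eq, sub_eq_add_neg, siteOp_add, siteOp_neg,
      siteOp_smul, siteOp_smul, siteOp_one]
    module
  rw [hz]
  congr 1
  have hr := siteOp_mul_siteOp_bond (N := N) raise_diag
  have hl := siteOp_mul_siteOp_bond (N := N) lower_diag
  simp only [raise_mul_occSign] at hr
  have hl' : ∀ B i, siteOp lower i * siteOp B (finRotate N i) =
      -(if (i : ℕ) + 1 = N then -(parity * (fer lower i * fer B (finRotate N i)))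
        else fer lower i * fer B (finRotate N i)) := fun B i => by
    rw [← hl, lower_mul_occSign, siteOp_neg, neg_mul, neg_neg]
  rw [hr, hr, hl', hl', fermiBond, star_jw, star_jw, jw, jw]
  split_ifs
  · simp only [mul_add, mul_sub, mul_smul_comm, smul_add, smul_sub, smul_neg]
    module
  · module

theorem parity_commute_fermiBond (γ K : ℝ) (i j : Fin N) :
    Commute parity (fermiBond γ K i j) := by
  unfold fermiBond
  rw [star_jw, star_jw, jw, jw]
  have := @parity_commute_fer_mul_fer N
  exact ((((this raise_diag lower_diag i j).sub_right (this lower_diag raise_diag i j)).smul_right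
    _).add_right ((this raise_diag raise_diag i j).smul_right _)).sub_right
    ((this lower_diag lower_diag i j).smul_right _)

theorem parity_commute_chainHamiltonian (h γ K : ℝ) :
    Commute parity (chainHamiltonian N h γ K) := by
  rw [chainHamiltonian_eq]
  refine Commute.sum_right _ _ _ fun i _ => Commute.add_right ?_ ?_
  · split_ifs
    · exact ((Commute.refl _).mul_right (parity_commute_fermiBond _ _ _ _)).neg_right
    · exact parity_commute_fermiBond _ _ _ _
  · rw [star_jw, jw]
    exact ((parity_commute_fer_mul_fer raise_diag lower_diag i i).sub_right
      ((Commute.one_right _).smul_right _)).smul_right _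

/-- On states of fermion parity `p`, the chain is the free fermion ring with closing factor
`-p`: antiperiodic for even and periodic for odd states. -/
theorem chainHamiltonian_mulVec (h γ K : ℝ) {p : ℂ} {f : Config N → ℂ}
    (hf : parity *ᵥ f = p • f) :
    chainHamiltonian N h γ K *ᵥ f = fermiHam N (-p) h γ K *ᵥ f := by
  rw [chainHamiltonian_eq, fermiHam, Matrix.sum_mulVec, Matrix.sum_mulVec]
  refine Finset.sum_congr rfl fun i _ => ?_
  rw [Matrix.add_mulVec, Matrix.add_mulVec]
  congr 1
  split_ifs
  · rw [(parity_commute_fermiBond _ _ _ _).eq, Matrix.neg_mulVec, ← Matrix.mulVec_mulVec, hf,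
      Matrix.mulVec_smul, Matrix.smul_mulVec, neg_smul]
  · rw [one_smul]

end Sectors

/-! ### Plane waves -/

section Waves

open Matrix

variable {N : ℕ}

/-- The phase `exp (iπ r / N)`. -/
def phase (N : ℕ) (r : ℤ) : ℂ := Complex.exp (Complex.I * Real.pi * r / N)

theorem phase_add (r r' : ℤ) : phase N (r + r') = phase N r * phase N r' := by
  rw [phase, phase, phase, ← Complex.exp_add]
  congr 1
  push_cast
  ring

theorem phase_zero : phase N 0 = 1 := by simp [phase]

theorem star_phase (r : ℤ) : star (phase N r) = phase N (-r) := by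
  rw [phase, phase, Complex.star_def, ← Complex.exp_conj]
  congr 1
  simp [map_div₀]

theorem phase_self (hN : N ≠ 0) : phase N N = -1 := by
  have : (N : ℂ) ≠ 0 := by exact_mod_cast hN
  rw [phase, show Complex.I * Real.pi * ((N : ℤ) : ℂ) / N = Real.pi * Complex.I by
    push_cast; field_simp, Complex.exp_pi_mul_I]

theorem phase_two_mul (hN : N ≠ 0) : phase N (2 * N) = 1 := by
  rw [two_mul, phase_add, phase_self hN]; norm_num

theorem phase_mul_nat (r : ℤ) (m : ℕ) : phase N (r * m) = phase N r ^ m := by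
  rw [phase, phase, ← Complex.exp_nat_mul]
  congr 1
  push_cast
  ring

theorem phase_eq_one_iff (hN : N ≠ 0) (l : ℤ) : phase N (2 * l) = 1 ↔ (N : ℤ) ∣ l := by
  rw [← (Complex.isPrimitiveRoot_exp N hN).zpow_eq_one_iff_dvd, phase, ← Complex.exp_int_mul]
  apply Eq.congr_left
  congr 1
  push_cast
  ring

theorem sum_phase (hN : N ≠ 0) (l : ℤ) :
    ∑ m ∈ Finset.range N, phase N (2 * l * m) = if (N : ℤ) ∣ l then (N : ℂ) else 0 := by
  simp only [phase_mul_nat]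
  split_ifs with h
  · simp [(phase_eq_one_iff hN l).2 h]
  · have h1 : phase N (2 * l) ≠ 1 := fun h' => h ((phase_eq_one_iff hN l).1 h')
    have h2 : phase N (2 * l) ^ N = 1 := by
      rw [← phase_mul_nat, mul_assoc, phase_eq_one_iff hN]
      exact dvd_mul_left _ _
    rw [geom_sum_eq h1, h2, sub_self, zero_div]

theorem phase_eq (r : ℤ) : phase N r =
    Real.cos (Real.pi * r / N) + Real.sin (Real.pi * r / N) * Complex.I := by
  rw [phase, Complex.ofReal_cos, Complex.ofReal_sin, ← Complex.exp_mul_I]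
  congr 1
  push_cast
  ring

theorem sum_phase_momenta (hN : N ≠ 0) (d l : ℤ) :
    ∑ m ∈ Finset.range N, phase N ((2 * m + d) * l) =
      if (N : ℤ) ∣ l then (N : ℂ) * phase N (d * l) else 0 := by
  have : ∀ m : ℕ, phase N ((2 * m + d) * l) = phase N (2 * l * m) * phase N (d * l) := fun m => by
    rw [← phase_add]; congr 1; ring
  simp only [this]
  rw [← Finset.sum_mul, sum_phase hN]
  split_ifs <;> simp

/-- The normalized plane wave with momentum `πr/N`. -/
def mode (N : ℕ) (r : ℤ) : Fin N → ℂ := fun j => phase N (r * (j : ℕ)) / (Real.sqrt N : ℂ)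

theorem star_mode (r : ℤ) : star (mode N r) = mode N (-r) := by
  funext j
  simp only [mode, Pi.star_apply, star_div₀, star_phase, Complex.star_def, Complex.conj_ofReal]
  rw [neg_mul]

theorem mode_add (r : ℤ) : mode N (r + 2 * N) = mode N r := by
  funext j
  have hN : N ≠ 0 := by have := j.pos; omega
  rw [mode, mode, add_mul, phase_add, phase_mul_nat (2 * (N : ℤ)), phase_two_mul hN, one_pow,
    mul_one]

theorem sqrt_mul_sqrt (N : ℕ) : (Real.sqrt N : ℂ) * (Real.sqrt N : ℂ) = N := by
  rw [← Complex.ofReal_mul, Real.mul_self_sqrt (Nat.cast_nonneg N), Complex.ofReal_natCast]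

theorem mode_mul_mode (r r' : ℤ) (i j : Fin N) :
    mode N r i * mode N r' j = phase N (r * (i : ℕ) + r' * (j : ℕ)) / N := by
  rw [mode, mode, div_mul_div_comm, sqrt_mul_sqrt, ← phase_add]

theorem dotProduct_mode (hN : N ≠ 0) {r r' l : ℤ} (h : r' - r = 2 * l) :
    star (mode N r) ⬝ᵥ mode N r' = if (N : ℤ) ∣ l then 1 else 0 := by
  have hN' : (N : ℂ) ≠ 0 := by exact_mod_cast hN
  rw [star_mode, dotProduct]
  have : ∀ j : Fin N, mode N (-r) j * mode N r' j = phase N (2 * l * (j : ℕ)) / N := fun j => by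
    rw [mode_mul_mode, ← h]; congr 2; ring
  simp only [this]
  rw [← Finset.sum_div, Fin.sum_univ_eq_sum_range (fun m => phase N (2 * l * (m : ℕ))) N,
    sum_phase hN]
  split_ifs <;> simp [hN']

/-- Fourier inversion with a shift `e` by `0` or by one site. -/
theorem sum_momenta_smul {R : Type*} [AddCommGroup R] [Module ℂ R] (hN : N ≠ 0) (d e η : ℤ)
    (T : Fin N → Fin N → R) :
    ∑ m ∈ Finset.range N, ∑ i : Fin N, ∑ j : Fin N,
      (phase N ((2 * m + d) * (η * (e + (i : ℕ) - (j : ℕ)))) / N) • T i j =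
    ∑ i : Fin N, ∑ j : Fin N, (if (N : ℤ) ∣ η * (e + (i : ℕ) - (j : ℕ)) then
      phase N (d * (η * (e + (i : ℕ) - (j : ℕ)))) else 0) • T i j := by
  have hN' : (N : ℂ) ≠ 0 := by exact_mod_cast hN
  rw [Finset.sum_comm]
  refine Finset.sum_congr rfl fun i _ => ?_
  rw [Finset.sum_comm]
  refine Finset.sum_congr rfl fun j _ => ?_
  rw [← Finset.sum_smul, ← Finset.sum_div, sum_phase_momenta hN]
  split_ifs
  · rw [mul_div_cancel_left₀ _ hN']
  · rw [zero_div]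

theorem sum_momenta_smul_diag {R : Type*} [AddCommGroup R] [Module ℂ R] (hN : N ≠ 0) (d : ℤ)
    (T : Fin N → Fin N → R) :
    ∑ m ∈ Finset.range N, ∑ i : Fin N, ∑ j : Fin N,
      (phase N ((2 * m + d) * ((i : ℕ) - (j : ℕ))) / N) • T i j = ∑ i : Fin N, T i i := by
  have := sum_momenta_smul hN d 0 1 T
  simp only [one_mul, zero_add] at this
  rw [this]
  refine Finset.sum_congr rfl fun i _ => ?_
  rw [Finset.sum_eq_single i]
  · simp [phase_zero]
  · intro j _ hj
    rw [if_neg, zero_smul]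
    intro hd
    have h0 := Int.eq_zero_of_abs_lt_dvd hd (by rw [abs_lt]; omega)
    exact hj (Fin.ext (by omega))
  · simp

theorem sum_momenta_smul_bond {R : Type*} [AddCommGroup R] [Module ℂ R] (hN : 2 ≤ N) {d η : ℤ}
    (hη : η = 1 ∨ η = -1) {s : ℂ} (hs : phase N (d * N) = s) (hs' : phase N (-(d * N)) = s)
    (T : Fin N → Fin N → R) :
    ∑ m ∈ Finset.range N, ∑ i : Fin N, ∑ j : Fin N,
      (phase N ((2 * m + d) * (η * (1 + (i : ℕ) - (j : ℕ)))) / N) • T i j =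
    ∑ i : Fin N, (if (i : ℕ) + 1 = N then s else 1) • T i (finRotate N i) := by
  rw [sum_momenta_smul (by omega)]
  refine Finset.sum_congr rfl fun i _ => ?_
  have hi := finRotate_val i
  rw [Finset.sum_eq_single (finRotate N i)]
  · rw [hi]
    split_ifs with h1 h2 h2
    · congr 1
      have e : (1 + ((i : ℕ) : ℤ) - ((0 : ℕ) : ℤ)) = N := by omega
      rw [e]
      rcases hη with rfl | rfl
      · rw [one_mul, hs]
      · rw [neg_one_mul, mul_neg, hs']
    · exfalso
      apply h2
      have e : (1 + ((i : ℕ) : ℤ) - ((0 : ℕ) : ℤ)) = N := by omega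
      rw [e]
      exact dvd_mul_left _ _
    · have e : (1 + ((i : ℕ) : ℤ) - (((i : ℕ) + 1 : ℕ) : ℤ)) = 0 := by omega
      rw [e, mul_zero, mul_zero, phase_zero]
    · exfalso
      apply h2
      have e : (1 + ((i : ℕ) : ℤ) - (((i : ℕ) + 1 : ℕ) : ℤ)) = 0 := by omega
      rw [e, mul_zero]
      exact dvd_zero _
  · intro j _ hj
    rw [if_neg, zero_smul]
    intro hd
    have hd' : (N : ℤ) ∣ 1 + (i : ℕ) - (j : ℕ) := by
      rcases hη with rfl | rfl
      · rwa [one_mul] at hd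
      · rwa [neg_one_mul, dvd_neg] at hd
    apply hj
    apply Fin.ext
    rw [hi]
    have := j.2
    have := i.2
    split_ifs with h
    · obtain ⟨q, hq⟩ := hd'
      have h1 : q = 1 := by
        have : (N : ℤ) * q ≤ N * 1 := by omega
        have : (0 : ℤ) < N * q := by omega
        have : (0 : ℤ) < q := by
          by_contra hc
          nlinarith
        nlinarith
      subst h1
      omega
    · have h0 := Int.eq_zero_of_abs_lt_dvd hd' (by rw [abs_lt]; omega)
      omega
  · simp

end Waves

/-! ### The momentum blocks of the free fermion ring -/

section Blocks

open Matrix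

variable {N : ℕ}

theorem bilinear_sum {R ι : Type*} [Ring R] [Algebra ℂ R] [Fintype ι] (α β : ι → ℂ) (x y : ι → R) :
    (∑ i, α i • x i) * (∑ j, β j • y j) = ∑ i, ∑ j, (α i * β j) • (x i * y j) := by
  simp only [Finset.sum_mul_sum, smul_mul_smul_comm]

theorem ann_mode (r : ℤ) : ann (jw : Fin N → Matrix (Config N) (Config N) ℂ) (mode N r) =
    ∑ j, mode N (-r) j • jw j := by
  rw [ann]
  refine Finset.sum_congr rfl fun j _ => ?_
  rw [← star_mode, Pi.star_apply]

/-- The contribution of the momentum `πr/N` to the free fermion Hamiltonian. -/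
def modeTerm (N : ℕ) (h γ K : ℝ) (r : ℤ) : Matrix (Config N) (Config N) ℂ :=
  ((h + Real.cos (Real.pi * r / N) : ℝ) : ℂ) • (num jw (mode N r) - (1 / 2 : ℂ) • 1) +
    (Complex.I * (γ - K) / 2 * phase N r) •
      (star (ann jw (mode N r)) * star (ann jw (mode N (-r)))) -
    (Complex.I * (γ + K) / 2 * phase N r) • (ann jw (mode N (-r)) * ann jw (mode N r))

theorem phase_smul_bilinear (r₁ r₂ e : ℤ) (x y : Fin N → Matrix (Config N) (Config N) ℂ) :
    phase N e • ((∑ i, mode N r₁ i • x i) * (∑ j, mode N r₂ j • y j)) =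
      ∑ i : Fin N, ∑ j : Fin N, (phase N (e + r₁ * (i : ℕ) + r₂ * (j : ℕ)) / N) • (x i * y j) := by
  rw [bilinear_sum, Finset.smul_sum]
  refine Finset.sum_congr rfl fun i _ => ?_
  rw [Finset.smul_sum]
  refine Finset.sum_congr rfl fun j _ => ?_
  rw [smul_smul, mode_mul_mode, mul_div_assoc', ← phase_add, add_assoc]

/-- Fourier transform of the ring. The antiperiodic ring `s = -1` has the momenta with odd `d`, the
periodic ring `s = 1` those with even `d`. -/
theorem fermiHam_eq_sum_modeTerm (hN : 2 ≤ N) (h γ K : ℝ) {d : ℤ} {s : ℂ}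
    (hs : phase N (d * N) = s) (hs' : phase N (-(d * N)) = s) :
    fermiHam N s h γ K = ∑ m ∈ Finset.range N, modeTerm N h γ K (2 * m + d) := by
  have hN0 : N ≠ 0 := by omega
  have hcar := car_jw (N := N)
  set c : Fin N → Matrix (Config N) (Config N) ℂ := jw with hc
  have b1 := sum_momenta_smul_bond hN (η := 1) (Or.inl rfl) hs hs' fun i j => star (c i) * c j
  have b2 := sum_momenta_smul_bond hN (η := -1) (Or.inr rfl) hs hs' fun i j => c i * star (c j)
  have b3 := sum_momenta_smul_bond hN (η := 1) (Or.inl rfl) hs hs' fun i j =>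
    star (c i) * star (c j)
  have b4 := sum_momenta_smul_bond hN (η := 1) (Or.inl rfl) hs hs' fun i j => c i * c j
  have b5 := sum_momenta_smul_diag hN0 d fun i j => star (c i) * c j
  have hS : ∀ η : ℤ, (η = 1 ∨ η = -1) →
      ∑ m ∈ Finset.range N, phase N ((2 * m + d) * η) = 0 := fun η hη => by
    rw [sum_phase_momenta hN0, if_neg]
    intro hd
    have h0 := Int.eq_zero_of_abs_lt_dvd hd (by
      rcases hη with rfl | rfl <;> rw [abs_lt] <;> omega)
    rcases hη with rfl | rfl <;> omega
  have hleft : fermiHam N s h γ K =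
      (1 / 2 : ℂ) • (∑ i : Fin N, (if (i : ℕ) + 1 = N then s else 1) •
          (star (c i) * c (finRotate N i))) -
      (1 / 2 : ℂ) • (∑ i : Fin N, (if (i : ℕ) + 1 = N then s else 1) •
          (c i * star (c (finRotate N i)))) +
      (Complex.I * (γ - K) / 2) • (∑ i : Fin N, (if (i : ℕ) + 1 = N then s else 1) •
          (star (c i) * star (c (finRotate N i)))) -
      (Complex.I * (γ + K) / 2) • (∑ i : Fin N, (if (i : ℕ) + 1 = N then s else 1) •
          (c i * c (finRotate N i))) +
      ((h : ℂ) • (∑ i : Fin N, star (c i) * c i) - ((h : ℂ) / 2 * N) • 1) := by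
    have hone : ((h : ℂ) / 2 * N) • (1 : Matrix (Config N) (Config N) ℂ) =
        ∑ i : Fin N, ((h : ℂ) / 2) • 1 := by
      rw [Finset.sum_const, Finset.card_univ, Fintype.card_fin, ← Nat.cast_smul_eq_nsmul ℂ]
      module
    rw [hone]
    simp only [Finset.smul_sum]
    rw [← Finset.sum_sub_distrib, ← Finset.sum_sub_distrib, ← Finset.sum_add_distrib,
      ← Finset.sum_sub_distrib, ← Finset.sum_add_distrib]
    refine Finset.sum_congr rfl fun i _ => ?_
    rw [fermiBond]
    module
  -- The cosines of the momenta sum to zero, so that the constant `-N h / 2` may be distributed over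
  -- the modes as `-(h + cos) / 2`; `hconst2` plays the same part for the reordering of `c c†`.
  have hconst : ((h : ℂ) / 2 * N) • (1 : Matrix (Config N) (Config N) ℂ) =
      ∑ m ∈ Finset.range N, ((h : ℂ) / 2 + phase N ((2 * m + d) * 1) / 4 +
        phase N ((2 * m + d) * (-1)) / 4) • 1 := by
    rw [← Finset.sum_smul, Finset.sum_add_distrib, Finset.sum_add_distrib, ← Finset.sum_div _ _ 4,
      ← Finset.sum_div _ _ 4, hS 1 (Or.inl rfl), hS (-1) (Or.inr rfl)]
    simp [mul_comm]
  have hconst2 : (0 : Matrix (Config N) (Config N) ℂ) =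
      ∑ m ∈ Finset.range N, (phase N ((2 * m + d) * (-1)) / (-2)) • 1 := by
    rw [← Finset.sum_smul, ← Finset.sum_div, hS (-1) (Or.inr rfl)]
    simp
  rw [hleft, ← b1, ← b2, ← b3, ← b4, ← b5, hconst, ← sub_zero (_ + (_ - _)), hconst2]
  simp only [Finset.smul_sum (s := Finset.range N)]
  rw [← Finset.sum_sub_distrib, ← Finset.sum_sub_distrib, ← Finset.sum_add_distrib,
    ← Finset.sum_sub_distrib, ← Finset.sum_add_distrib, ← Finset.sum_sub_distrib]
  refine Finset.sum_congr rfl fun m _ => ?_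
  generalize (2 * (m : ℤ) + d) = r
  have e1 := phase_smul_bilinear r (-r) r (fun i => star (c i)) c
  have e2 := phase_smul_bilinear (-r) r (-r) c (fun i => star (c i))
  have e3 := phase_smul_bilinear r (-r) r (fun i => star (c i)) (fun i => star (c i))
  have e4 := phase_smul_bilinear r (-r) r c c
  have e5 := phase_smul_bilinear r (-r) 0 (fun i => star (c i)) c
  have a1 := ann_mode (N := N) r
  have a2 := ann_mode (N := N) (-r)
  have a3 := star_ann (c := c) (mode N r)
  have a4 := star_ann (c := c) (mode N (-r))
  rw [neg_neg] at a2
  rw [← hc] at a1 a2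
  rw [← a3, ← a1] at e1 e5
  rw [← a3, ← a1] at e2
  rw [← a3, ← a4] at e3
  rw [← a1, ← a2] at e4
  have hex1 : ∀ i j : Fin N, r * (1 * (1 + ((i : ℕ) : ℤ) - ((j : ℕ) : ℤ))) =
      r + r * (i : ℕ) + -r * (j : ℕ) := fun i j => by ring
  have hex2 : ∀ i j : Fin N, r * (-1 * (1 + ((i : ℕ) : ℤ) - ((j : ℕ) : ℤ))) =
      -r + -r * (i : ℕ) + r * (j : ℕ) := fun i j => by ring
  have hex3 : ∀ i j : Fin N, r * (((i : ℕ) : ℤ) - ((j : ℕ) : ℤ)) =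
      0 + r * (i : ℕ) + -r * (j : ℕ) := fun i j => by ring
  simp only [hex1, hex2, hex3]
  rw [← e1, ← e2, ← e3, ← e4, ← e5, phase_zero, one_smul]
  have hdot : star (mode N r) ⬝ᵥ mode N r = 1 := by
    rw [dotProduct_mode hN0 (l := 0) (by ring), if_pos (dvd_zero _)]
  have hanti := hcar.ann_anti_star (mode N r) (mode N r)
  rw [hdot, one_smul] at hanti
  rw [eq_sub_of_add_eq hanti, modeTerm, num, ← hc]
  have hcos : phase N r + phase N (-r) = 2 * (Real.cos (Real.pi * r / N) : ℂ) := by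
    rw [phase_eq, phase_eq]
    push_cast
    rw [mul_neg, neg_div, Complex.cos_neg, Complex.sin_neg]
    ring
  have hcos' : phase N r = 2 * (Real.cos (Real.pi * r / N) : ℂ) - phase N (-r) :=
    eq_sub_of_add_eq hcos
  rw [mul_one, mul_neg_one]
  match_scalars
  · rw [hcos']
    push_cast
    ring
  · rw [hcos']
    push_cast
    ring
  · ring
  · ring

end Blocks

/-! ### Pairs of opposite momenta -/

section MomentumPairs

open Matrix

variable {N : ℕ}

theorem mode_eq_of_dvd {r r' q : ℤ} (h : r' = r + 2 * N * q) : mode N r' = mode N r := by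
  subst h
  induction q using Int.induction_on with
  | zero => simp
  | succ q ih => rw [mul_add, mul_one, ← add_assoc, mode_add, ih]
  | pred q ih => rw [← ih, ← mode_add]; congr 1; ring

theorem modeTerm_add (hN : N ≠ 0) (h γ K : ℝ) (r : ℤ) :
    modeTerm N h γ K (r + 2 * N) = modeTerm N h γ K r := by
  have h1 : mode N (-(r + 2 * N)) = mode N (-r) := mode_eq_of_dvd (q := -1) (by ring)
  have hN' : (N : ℝ) ≠ 0 := by exact_mod_cast hN
  have h2 : Real.cos (Real.pi * ((r + 2 * N : ℤ) : ℝ) / N) = Real.cos (Real.pi * r / N) := by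
    rw [← Real.cos_add_two_pi (Real.pi * r / N)]
    congr 1
    push_cast
    field_simp
  rw [modeTerm, modeTerm, h1, h2, mode_add, phase_add, phase_two_mul hN, mul_one]

/-- The annihilator of a pair with momenta `±πr/N`. -/
def pairOp (N : ℕ) (r : ℤ) : Matrix (Config N) (Config N) ℂ :=
  pairAnn jw (mode N (-r)) (mode N r)

theorem dot_mode_self (hN : N ≠ 0) (r : ℤ) : star (mode N r) ⬝ᵥ mode N r = 1 := by
  rw [dotProduct_mode hN (l := 0) (by ring), if_pos (dvd_zero _)]

theorem dot_mode_of_not_dvd (hN : N ≠ 0) {r r' l : ℤ} (h : r' - r = 2 * l) (hl : ¬(N : ℤ) ∣ l) :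
    star (mode N r) ⬝ᵥ mode N r' = 0 := by
  rw [dotProduct_mode hN h, if_neg hl]

theorem pairOp_hardCore (hN : N ≠ 0) {r : ℤ} (hr : ¬(N : ℤ) ∣ r) :
    HardCore (pairOp N r) ∧ star (pairOp N r) * pairOp N r - pairOp N r * star (pairOp N r) =
      num jw (mode N (-r)) + num jw (mode N r) - 1 :=
  car_jw.pairAnn_hardCore (dot_mode_self hN _) (dot_mode_self hN _)
    (dot_mode_of_not_dvd hN (l := r) (by ring) hr)
    (dot_mode_of_not_dvd hN (l := -r) (by ring) (by rwa [dvd_neg]))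

/-- Opposite momenta combine to a pair Hamiltonian, with the matrix entries of the momentum block. -/
theorem modeTerm_add_modeTerm_neg (hN : N ≠ 0) (h γ K : ℝ) {r : ℤ} (hr : ¬(N : ℤ) ∣ r) :
    modeTerm N h γ K r + modeTerm N h γ K (-r) =
      pairHam (pairOp N r) ((h + Real.cos (Real.pi * r / N) : ℝ) : ℂ)
        (((γ - K) * Real.sin (Real.pi * r / N) : ℝ) : ℂ)
        ((-((γ + K) * Real.sin (Real.pi * r / N)) : ℝ) : ℂ) := by
  have hcos : Real.cos (Real.pi * ((-r : ℤ) : ℝ) / N) = Real.cos (Real.pi * r / N) := by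
    rw [← Real.cos_neg]; congr 1; push_cast; ring
  have hsin : Real.sin (Real.pi * ((-r : ℤ) : ℝ) / N) = -Real.sin (Real.pi * r / N) := by
    rw [← Real.sin_neg]; congr 1; push_cast; ring
  have e1 : ann jw (mode N (-r)) * ann jw (mode N r) =
      -(ann jw (mode N r) * ann (jw : Fin N → _) (mode N (-r))) :=
    eq_neg_of_add_eq_zero_left (car_jw.ann_anti _ _)
  have e2 : star (ann jw (mode N r)) * star (ann jw (mode N (-r))) =
      -(star (ann jw (mode N (-r))) * star (ann (jw : Fin N → _) (mode N r))) := by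
    rw [← star_mul, e1, star_neg, star_mul]
  rw [modeTerm, modeTerm, neg_neg, hcos, phase_eq, phase_eq, hcos, hsin, pairHam,
    (pairOp_hardCore hN hr).2, pairOp, pairAnn, star_mul, e1, e2]
  match_scalars <;> ring_nf <;> simp only [Complex.I_sq] <;> ring

/-- At a self-conjugate momentum the pairing terms vanish. -/
theorem modeTerm_of_real (h γ K : ℝ) {r : ℤ} (hr : mode N (-r) = mode N r) :
    modeTerm N h γ K r = ((h + Real.cos (Real.pi * r / N) : ℝ) : ℂ) •
      (num jw (mode N r) - (1 / 2 : ℂ) • 1) := by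
  have h1 := car_jw.ann_sq (mode N r)
  rw [modeTerm, hr, h1, ← star_mul, h1, star_zero, smul_zero, smul_zero, add_zero, sub_zero]

/-- The pairing `p ↔ 2 M - 1 - p` of opposite antiperiodic momenta. -/
theorem sum_range_two_mul {R : Type*} [AddCommMonoid R] (M : ℕ) (f : ℕ → R) :
    ∑ m ∈ Finset.range (2 * M), f m =
      ∑ p ∈ Finset.range M, (f p + f (2 * M - 1 - p)) := by
  rw [two_mul, Finset.sum_range_add, Finset.sum_add_distrib]
  congr 1
  rw [← Finset.sum_range_reflect]
  refine Finset.sum_congr rfl fun p hp => ?_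
  rw [Finset.mem_range] at hp
  congr 1
  omega

/-- The pairing `p ↔ 2 M - p` of opposite periodic momenta, of which `0` and `M` are alone. -/
theorem sum_range_two_mul' {R : Type*} [AddCommMonoid R] {M : ℕ} (hM : 1 ≤ M) (f : ℕ → R) :
    ∑ m ∈ Finset.range (2 * M), f m =
      f 0 + f M + ∑ p ∈ Finset.Ico 1 M, (f p + f (2 * M - p)) := by
  obtain ⟨L, rfl⟩ : ∃ L, M = L + 1 := ⟨M - 1, by omega⟩
  rw [show 2 * (L + 1) = (2 * L + 1) + 1 by ring, Finset.sum_range_succ',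
    show (2 * L + 1) = (L + 1) + L by ring, Finset.sum_range_add, Finset.sum_range_succ,
    Finset.sum_Ico_eq_sum_range, Finset.sum_add_distrib,
    show L + 1 - 1 = L by omega,
    ← Finset.sum_range_reflect (fun p => f (L + 1 + L + 1 - (1 + p))) L]
  have h1 : ∀ p, f (1 + p) = f (p + 1) := fun p => by rw [add_comm]
  have h2 : ∑ p ∈ Finset.range L, f (L + 1 + L + 1 - (1 + (L - 1 - p))) =
      ∑ p ∈ Finset.range L, f (L + 1 + p + 1) := Finset.sum_congr rfl fun p hp => by
    rw [Finset.mem_range] at hp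
    congr 1
    omega
  simp only [h1, h2]
  abel

theorem fermiHam_antiperiodic {M : ℕ} (hM : 1 ≤ M) (h γ K : ℝ) :
    fermiHam (2 * M) (-1) h γ K = ∑ p ∈ Finset.range M,
      pairHam (pairOp (2 * M) (2 * p + 1))
        ((h + Real.cos (Real.pi * ((2 * p + 1 : ℤ) : ℝ) / (2 * M : ℕ)) : ℝ) : ℂ)
        (((γ - K) * Real.sin (Real.pi * ((2 * p + 1 : ℤ) : ℝ) / (2 * M : ℕ)) : ℝ) : ℂ)
        ((-((γ + K) * Real.sin (Real.pi * ((2 * p + 1 : ℤ) : ℝ) / (2 * M : ℕ))) : ℝ) : ℂ) := by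
  have hN : 2 * M ≠ 0 := by omega
  have h1 : phase (2 * M) (1 * ((2 * M : ℕ) : ℤ)) = -1 := by rw [one_mul, phase_self hN]
  have h2 : phase (2 * M) (-(1 * ((2 * M : ℕ) : ℤ))) = -1 := by
    rw [← star_phase, h1]; simp
  rw [fermiHam_eq_sum_modeTerm (by omega) h γ K h1 h2, sum_range_two_mul]
  refine Finset.sum_congr rfl fun p hp => ?_
  rw [Finset.mem_range] at hp
  rw [← modeTerm_add_modeTerm_neg hN]
  · congr 1
    rw [← modeTerm_add hN _ _ _ (-(2 * (p : ℤ) + 1))]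
    congr 1
    push_cast [Nat.cast_sub (show p ≤ 2 * M - 1 by omega), Nat.cast_sub (show 1 ≤ 2 * M by omega)]
    ring
  · intro hd
    have := Int.eq_zero_of_abs_lt_dvd hd (by rw [abs_lt]; push_cast; omega)
    omega

theorem fermiHam_periodic {M : ℕ} (hM : 1 ≤ M) (h γ K : ℝ) :
    fermiHam (2 * M) 1 h γ K =
      ((h + Real.cos (Real.pi * ((0 : ℤ) : ℝ) / (2 * M : ℕ)) : ℝ) : ℂ) •
        (num jw (mode (2 * M) 0) - (1 / 2 : ℂ) • 1) +
      ((h + Real.cos (Real.pi * ((2 * M : ℤ) : ℝ) / (2 * M : ℕ)) : ℝ) : ℂ) •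
        (num jw (mode (2 * M) (2 * M)) - (1 / 2 : ℂ) • 1) +
      ∑ p ∈ Finset.Ico 1 M,
      pairHam (pairOp (2 * M) (2 * p))
        ((h + Real.cos (Real.pi * ((2 * p : ℤ) : ℝ) / (2 * M : ℕ)) : ℝ) : ℂ)
        (((γ - K) * Real.sin (Real.pi * ((2 * p : ℤ) : ℝ) / (2 * M : ℕ)) : ℝ) : ℂ)
        ((-((γ + K) * Real.sin (Real.pi * ((2 * p : ℤ) : ℝ) / (2 * M : ℕ))) : ℝ) : ℂ) := by
  have hN : 2 * M ≠ 0 := by omega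
  have h1 : phase (2 * M) (0 * ((2 * M : ℕ) : ℤ)) = 1 := by rw [zero_mul, phase_zero]
  have h2 : phase (2 * M) (-(0 * ((2 * M : ℕ) : ℤ))) = 1 := by rw [zero_mul, neg_zero, phase_zero]
  rw [fermiHam_eq_sum_modeTerm (by omega) h γ K h1 h2, sum_range_two_mul' hM]
  congr 1
  · rw [← modeTerm_of_real (N := 2 * M) h γ K (r := 0) (by simp),
      ← modeTerm_of_real (N := 2 * M) h γ K (r := 2 * M)
        (mode_eq_of_dvd (q := -1) (by push_cast; ring))]
    simp
  · refine Finset.sum_congr rfl fun p hp => ?_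
    rw [Finset.mem_Ico] at hp
    rw [← modeTerm_add_modeTerm_neg hN]
    · rw [add_zero, add_zero, ← modeTerm_add hN _ _ _ (-(2 * (p : ℤ)))]
      congr 2
      push_cast [Nat.cast_sub (show p ≤ 2 * M by omega)]
      ring
    · intro hd
      have := Int.eq_zero_of_abs_lt_dvd hd (by rw [abs_lt]; push_cast; omega)
      omega

/-- Two distinct momentum pairs of the same parity sector commute. -/
theorem commute_star_pairOp (hN : N ≠ 0) {r r' a b : ℤ} (ha : r' - r = 2 * a) (hb : r' + r = 2 * b)
    (ha' : ¬(N : ℤ) ∣ a) (hb' : ¬(N : ℤ) ∣ b) : Commute (pairOp N r) (star (pairOp N r')) := by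
  refine car_jw.commute_pairAnn_star ?_ ?_ ?_ ?_
  · exact dot_mode_of_not_dvd hN (l := -a) (by omega) (by rwa [dvd_neg])
  · exact dot_mode_of_not_dvd hN (l := b) (by omega) hb'
  · exact dot_mode_of_not_dvd hN (l := -b) (by omega) (by rwa [dvd_neg])
  · exact dot_mode_of_not_dvd hN (l := a) (by omega) ha'

end MomentumPairs

/-! ### The two-component ground state of a pair -/

section Angle

/-- The quasiparticle energy at field `h` and momentum `φ`. -/
def disp (g h φ : ℝ) : ℝ := Real.sqrt ((h + Real.cos φ) ^ 2 + g * Real.sin φ ^ 2)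

theorem disp_sq {g : ℝ} (hg : 0 ≤ g) (h φ : ℝ) :
    disp g h φ ^ 2 = (h + Real.cos φ) ^ 2 + g * Real.sin φ ^ 2 :=
  Real.sq_sqrt (by positivity)

theorem disp_nonneg (g h φ : ℝ) : 0 ≤ disp g h φ := Real.sqrt_nonneg _

theorem abs_lt_disp {g φ : ℝ} (hg : 0 < g) (hφ : Real.sin φ ≠ 0) (h : ℝ) :
    |h + Real.cos φ| < disp g h φ := by
  rw [disp]
  refine Real.lt_sqrt_of_sq_lt ?_
  rw [sq_abs]
  have : 0 < g * Real.sin φ ^ 2 := by positivity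
  linarith

theorem disp_pos {g φ : ℝ} (hg : 0 < g) (hφ : Real.sin φ ≠ 0) (h : ℝ) : 0 < disp g h φ :=
  (abs_nonneg _).trans_lt (abs_lt_disp hg hφ h)

theorem add_disp_pos {g φ : ℝ} (hg : 0 < g) (hφ : Real.sin φ ≠ 0) (h : ℝ) :
    0 < h + Real.cos φ + disp g h φ := by
  linarith [abs_lt_disp hg hφ h, neg_abs_le (h + Real.cos φ)]

/-- The angle of the normalized ground state `(cos θ, sin θ)` of a momentum block. -/
def groundAngle (γ κ φ h : ℝ) : ℝ :=
  Real.arctan (κ * Real.sin φ / (h + Real.cos φ + disp (κ * (2 * γ + κ)) h φ))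

/-- `tan θ = κ sin φ / (h + cos φ + E)` solves both eigenvalue equations since
`E² - (h + cos φ)² = κ (2γ + κ) sin² φ`. -/
theorem pairParam_groundAngle {γ κ φ : ℝ} (hγ : 0 < γ) (hκ : 0 < κ) (hφ : 0 < Real.sin φ) (h : ℝ) :
    PairParam (h + Real.cos φ) ((γ - (γ + κ)) * Real.sin φ) (-((γ + (γ + κ)) * Real.sin φ))
      (disp (κ * (2 * γ + κ)) h φ) (Real.cos (groundAngle γ κ φ h))
      (Real.sin (groundAngle γ κ φ h)) := by
  have hg : 0 < κ * (2 * γ + κ) := by positivity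
  have hsq := disp_sq hg.le h φ
  have hE := disp_pos hg hφ.ne' h
  have hAE := add_disp_pos hg hφ.ne' h
  have hcos : 0 < Real.cos (groundAngle γ κ φ h) := Real.cos_arctan_pos _
  have htan := Real.tan_arctan (κ * Real.sin φ / (h + Real.cos φ + disp (κ * (2 * γ + κ)) h φ))
  rw [← groundAngle, Real.tan_eq_sin_div_cos, div_eq_div_iff hcos.ne' hAE.ne'] at htan
  set c := Real.cos (groundAngle γ κ φ h)
  set s := Real.sin (groundAngle γ κ φ h)
  set E := disp (κ * (2 * γ + κ)) h φ
  refine ⟨?_, ?_, ?_, ?_, ?_, hE.ne'⟩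
  · rw [hsq]; ring
  · rw [← mul_right_inj' hAE.ne']
    linear_combination (-(2 * γ + κ) * Real.sin φ) * htan + c * hsq
  · linear_combination htan
  · intro hs
    rw [hs, zero_mul] at htan
    exact (mul_pos (mul_pos hκ hφ) hcos).ne htan
  · have : 0 < κ * Real.sin φ := by positivity
    intro h0
    nlinarith

/-- The quantum Fisher information of the momentum block `φ` at the critical field: `4 θ'²` for the
derivative `θ'` of the ground state angle at `h = 1`. -/
def blockValue (γ κ φ : ℝ) : ℝ :=
  4 * (-(κ * Real.sin φ * (1 + Real.cos φ + disp (κ * (2 * γ + κ)) 1 φ)) /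
    (disp (κ * (2 * γ + κ)) 1 φ * ((1 + Real.cos φ + disp (κ * (2 * γ + κ)) 1 φ) ^ 2 +
      κ ^ 2 * Real.sin φ ^ 2))) ^ 2

theorem hasDerivAt_groundAngle {γ κ φ : ℝ} (hγ : 0 < γ) (hκ : 0 < κ) (hφ : 0 < Real.sin φ) :
    HasDerivAt (groundAngle γ κ φ)
      (-(κ * Real.sin φ * (1 + Real.cos φ + disp (κ * (2 * γ + κ)) 1 φ)) /
        (disp (κ * (2 * γ + κ)) 1 φ * ((1 + Real.cos φ + disp (κ * (2 * γ + κ)) 1 φ) ^ 2 +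
          κ ^ 2 * Real.sin φ ^ 2))) 1 := by
  have hg : 0 < κ * (2 * γ + κ) := by positivity
  set g := κ * (2 * γ + κ)
  have hE := disp_pos hg hφ.ne' 1
  have hAE := add_disp_pos hg hφ.ne' 1
  have hpos : (1 + Real.cos φ) ^ 2 + g * Real.sin φ ^ 2 ≠ 0 := by positivity
  have h1 : HasDerivAt (fun h : ℝ => h + Real.cos φ) 1 1 := (hasDerivAt_id 1).add_const _
  have h2 := ((h1.pow 2).add_const (g * Real.sin φ ^ 2)).sqrt hpos
  have h3 := (((hasDerivAt_const (1 : ℝ) (κ * Real.sin φ)).div (h1.add h2) hAE.ne')).arctan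
  refine h3.congr_deriv ?_
  simp only [Pi.add_apply, Pi.pow_apply, Pi.div_apply]
  change _ / (1 + (κ * Real.sin φ / (1 + Real.cos φ + disp g 1 φ)) ^ 2) * _ = _
  have e : √((1 + Real.cos φ) ^ 2 + g * Real.sin φ ^ 2) = disp g 1 φ := rfl
  simp only [e]
  set E := disp g 1 φ
  have h4 : 1 + Real.cos φ + E ≠ 0 := hAE.ne'
  have h5 : (1 + Real.cos φ + E) ^ 2 + κ ^ 2 * Real.sin φ ^ 2 ≠ 0 := by positivity
  have h6 : 1 + (κ * Real.sin φ / (1 + Real.cos φ + E)) ^ 2 ≠ 0 := by positivity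
  field_simp
  ring

end Angle

/-! ### The momentum blocks -/

section Block

open Matrix

/-- The pair annihilator of a single momentum block. -/
def blockOp : Matrix (Fin 2) (Fin 2) ℂ := !![0, 1; 0, 0]

theorem star_blockOp : star blockOp = !![0, 0; 1, 0] := by
  ext i j; fin_cases i <;> fin_cases j <;> simp [blockOp, Matrix.star_apply]

theorem toEuclideanCLM_pairHam {n : Type*} [Fintype n] [DecidableEq n] (b : Matrix n n ℂ)
    (A C D : ℂ) : toEuclideanCLM (n := n) (𝕜 := ℂ) (pairHam b A C D) =
      pairHam (toEuclideanCLM (n := n) (𝕜 := ℂ) b) A C D := by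
  simp only [pairHam, map_add, map_smul, map_sub, map_mul, map_star]

theorem HardCore.toEuclideanCLM {n : Type*} [Fintype n] [DecidableEq n] {b : Matrix n n ℂ}
    (hb : HardCore b) : HardCore (toEuclideanCLM (n := n) (𝕜 := ℂ) b) :=
  ⟨by rw [← map_mul, hb.sq, map_zero], by rw [← map_star, ← map_mul, ← map_mul, hb.triple]⟩

theorem blockHamiltonian_eq (φ h γ K : ℝ) : blockHamiltonian φ h γ K =
    pairHam blockOp ((h + Real.cos φ : ℝ) : ℂ) (((γ - K) * Real.sin φ : ℝ) : ℂ)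
      ((-((γ + K) * Real.sin φ) : ℝ) : ℂ) := by
  ext i j
  rw [pairHam, star_blockOp, blockHamiltonian, blockOp]
  fin_cases i <;> fin_cases j <;> simp

theorem hardCore_blockOp : HardCore blockOp := by
  constructor <;> rw [blockOp] <;>
  [skip; rw [show star !![(0 : ℂ), 1; 0, 0] = !![0, 0; 1, 0] from star_blockOp]] <;>
  ext i j <;> fin_cases i <;> fin_cases j <;> simp

theorem pairModes_block : PairModes 1
    (fun _ => toEuclideanCLM (n := Fin 2) (𝕜 := ℂ) blockOp) (EuclideanSpace.single 0 1) where
  hardCore _ _ := hardCore_blockOp.toEuclideanCLM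
  comm p hp q hq hpq := absurd rfl (hpq.trans_eq (by omega) : p ≠ p)
  comm_star p hp q hq hpq := absurd rfl (hpq.trans_eq (by omega) : p ≠ p)
  norm_vac := by simp
  vac p _ := by
    rw [← map_star, star_blockOp]
    ext i
    fin_cases i <;> simp [blockOp, ofLp_toEuclideanCLM, Matrix.mulVec, dotProduct]
  vac_unique w hw := by
    have h := hw 0 one_pos
    rw [← map_star, star_blockOp] at h
    refine ⟨w 0, ?_⟩
    rw [← h]
    ext i
    fin_cases i <;> simp [blockOp, ofLp_toEuclideanCLM, Matrix.mulVec, dotProduct]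

theorem pairHam_disp_cube {R : Type*} [Ring R] [StarRing R] [Algebra ℂ R] {b : R}
    (hb : HardCore b) {γ κ : ℝ} (hγ : 0 < γ) (hκ : 0 < κ) (h φ : ℝ) :
    pairHam b ((h + Real.cos φ : ℝ) : ℂ) (((γ - (γ + κ)) * Real.sin φ : ℝ) : ℂ)
        ((-((γ + (γ + κ)) * Real.sin φ) : ℝ) : ℂ) *
      pairHam b ((h + Real.cos φ : ℝ) : ℂ) (((γ - (γ + κ)) * Real.sin φ : ℝ) : ℂ)
        ((-((γ + (γ + κ)) * Real.sin φ) : ℝ) : ℂ) *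
      pairHam b ((h + Real.cos φ : ℝ) : ℂ) (((γ - (γ + κ)) * Real.sin φ : ℝ) : ℂ)
        ((-((γ + (γ + κ)) * Real.sin φ) : ℝ) : ℂ) =
    ((disp (κ * (2 * γ + κ)) h φ : ℂ) ^ 2) •
      pairHam b ((h + Real.cos φ : ℝ) : ℂ) (((γ - (γ + κ)) * Real.sin φ : ℝ) : ℂ)
        ((-((γ + (γ + κ)) * Real.sin φ) : ℝ) : ℂ) := by
  rw [hb.pairHam_cube]
  congr 1
  rw [← Complex.ofReal_pow (disp _ _ _), disp_sq (by positivity)]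
  push_cast
  ring

/-- A block is a pair Hamiltonian with a single pair. -/
theorem hasGroundQFI_block {γ κ φ : ℝ} (hγ : 0 < γ) (hκ : 0 < κ) (hφ : 0 < Real.sin φ) :
    HasGroundQFI (fun h => blockHamiltonian φ h γ (γ + κ)) 1 (blockValue γ κ φ) := by
  have hb := pairModes_block
  set B := toEuclideanCLM (n := Fin 2) (𝕜 := ℂ) blockOp
  have hH : ∀ h v, (blockHamiltonian φ h γ (γ + κ)).toEuclideanLin v =
      pairHam B ((h + Real.cos φ : ℝ) : ℂ) (((γ - (γ + κ)) * Real.sin φ : ℝ) : ℂ)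
        ((-((γ + (γ + κ)) * Real.sin φ) : ℝ) : ℂ) v := fun h v => by
    rw [← toEuclideanCLM_pairHam, ← blockHamiltonian_eq]
    rfl
  have key := hb.hasGroundQFI (H := fun h => blockHamiltonian φ h γ (γ + κ)) (h₀ := 1)
    (A := fun _ h => h + Real.cos φ) (C := fun _ _ => (γ - (γ + κ)) * Real.sin φ)
    (D := fun _ _ => -((γ + (γ + κ)) * Real.sin φ))
    (E := fun _ h => disp (κ * (2 * γ + κ)) h φ) (θ := fun _ => groundAngle γ κ φ)
    (θ' := fun _ => _) (fun _ _ => hasDerivAt_groundAngle hγ hκ hφ)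
    (Eventually.of_forall fun h _ _ => pairParam_groundAngle hγ hκ hφ h)
    (Eventually.of_forall fun h => ?_) (Eventually.of_forall fun h v hv μ hμ => ?_)
    (Eventually.of_forall fun h v hv p _ => ?_)
  · simpa [blockValue] using key
  · rw [hH, Finset.sum_range_one]
    have := hb.pairHam_pairState (A := fun _ => h + Real.cos φ)
      (C := fun _ => (γ - (γ + κ)) * Real.sin φ) (D := fun _ => -((γ + (γ + κ)) * Real.sin φ))
      (E := fun _ => disp (κ * (2 * γ + κ)) h φ) (θ := fun _ => groundAngle γ κ φ h) le_rfl
      one_pos (pairParam_groundAngle hγ hκ hφ h)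
    rw [Complex.ofReal_neg (disp _ _ _)]
    exact this
  · rw [hH] at hμ
    refine neg_sum_le_re_of_cube (s := Finset.range 1) (X := fun _ : ℕ =>
      pairHam B ((h + Real.cos φ : ℝ) : ℂ) (((γ - (γ + κ)) * Real.sin φ : ℝ) : ℂ)
        ((-((γ + (γ + κ)) * Real.sin φ) : ℝ) : ℂ)) (fun _ _ => disp_nonneg _ _ _)
      (fun _ _ => pairHam_disp_cube (hb.hardCore 0 one_pos) hγ hκ h φ)
      (fun _ _ _ _ _ => Commute.refl _) hv ?_
    rw [Finset.sum_range_one, hμ]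
  · rw [hH, Finset.sum_range_one, Complex.ofReal_neg (disp _ _ _)] at hv
    exact hv

end Block

/-! ### The ground state of the chain lies in the even sector -/

section Chain

open Matrix

variable {M : ℕ}

theorem ann_mode_mul_pairOp {N : ℕ} (r : ℤ) :
    ann jw (mode N r) * pairOp N r = 0 ∧ ann jw (mode N (-r)) * pairOp N r = 0 := by
  have h1 := car_jw.ann_sq (mode N r)
  have h2 := car_jw.ann_sq (mode N (-r))
  have h3 := car_jw.ann_anti (mode N (-r)) (mode N r)
  rw [pairOp, pairAnn]
  constructor
  · rw [← mul_assoc, h1, zero_mul]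
  · rw [← mul_assoc, eq_neg_of_add_eq_zero_left h3, neg_mul, mul_assoc, h2, mul_zero, neg_zero]

theorem jw_eq_sum_ann_mode {N : ℕ} (hN : N ≠ 0) (d : ℤ) (j : Fin N) :
    (jw j : Matrix (Config N) (Config N) ℂ) =
      ∑ m ∈ Finset.range N, mode N (2 * m + d) j • ann jw (mode N (2 * m + d)) := by
  have hN' : (N : ℂ) ≠ 0 := by exact_mod_cast hN
  have h : ∀ m : ℕ, mode N (2 * m + d) j • ann jw (mode N (2 * m + d)) =
      ∑ i : Fin N, (phase N ((2 * m + d) * (((j : ℕ) : ℤ) - ((i : ℕ) : ℤ))) / N) • jw i :=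
    fun m => by
      rw [ann_mode, Finset.smul_sum]
      refine Finset.sum_congr rfl fun i _ => ?_
      rw [smul_smul, mode_mul_mode]
      congr 3
      ring
  simp only [h]
  rw [Finset.sum_comm, Finset.sum_eq_single j]
  · rw [← Finset.sum_smul, ← Finset.sum_div, sum_phase_momenta hN]
    simp [phase_zero, hN']
  · intro i _ hi
    rw [← Finset.sum_smul, ← Finset.sum_div, sum_phase_momenta hN, if_neg, zero_div, zero_smul]
    intro hd
    have h0 := Int.eq_zero_of_abs_lt_dvd hd (by rw [abs_lt]; omega)
    exact hi (Fin.ext (by omega))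
  · simp

theorem sum_range_succ_ends {R : Type*} [AddCommMonoid R] (hM : 1 ≤ M) (f : ℕ → R) :
    ∑ p ∈ Finset.range (M + 1), f p = f 0 + f M + ∑ p ∈ Finset.Ico 1 M, f p := by
  rw [Finset.sum_range_succ, Finset.range_eq_Ico, Finset.sum_eq_sum_Ico_succ_bot (by omega),
    add_right_comm, zero_add]

/-- The pair annihilators of the antiperiodic momenta, as operators on the spin chain. -/
def chainPair (M p : ℕ) :
    EuclideanSpace ℂ (Config (2 * M)) →L[ℂ] EuclideanSpace ℂ (Config (2 * M)) :=
  toEuclideanCLM (n := Config (2 * M)) (𝕜 := ℂ) (pairOp (2 * M) (2 * p + 1))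

theorem ann_mulVec_vacuum {N : ℕ} (u : Fin N → ℂ) :
    ann jw u *ᵥ (vacuum : EuclideanSpace ℂ (Config N)).ofLp = 0 := by
  rw [ann, Matrix.sum_mulVec]
  refine Finset.sum_eq_zero fun j _ => ?_
  rw [Matrix.smul_mulVec, jw_mulVec_vacuum, smul_zero]

theorem num_mulVec_vacuum {N : ℕ} (u : Fin N → ℂ) :
    num jw u *ᵥ (vacuum : EuclideanSpace ℂ (Config N)).ofLp = 0 := by
  rw [num, ← Matrix.mulVec_mulVec, ann_mulVec_vacuum, Matrix.mulVec_zero]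

/-- The antiperiodic momenta come in `M` pairs. A state empty of all pairs is annihilated by every
mode, and thus by every site, which leaves the vacuum. -/
theorem pairModes_chain (M : ℕ) : PairModes M (chainPair M) vacuum := by
  have hdvd : ∀ p < M, ¬((2 * M : ℕ) : ℤ) ∣ 2 * (p : ℤ) + 1 := fun p hp hd => by
    have := Int.eq_zero_of_abs_lt_dvd hd (by rw [abs_lt]; push_cast; omega)
    omega
  refine ⟨fun p hp => ?_, fun p hp q hq hpq => ?_, fun p hp q hq hpq => ?_, ?_, fun p hp => ?_,
    fun w hw => ?_⟩
  · exact (pairOp_hardCore (by omega) (hdvd p hp)).1.toEuclideanCLM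
  · exact (car_jw.commute_pairAnn _ _ _ _).map (toEuclideanCLM (n := Config (2 * M)) (𝕜 := ℂ))
  · rw [chainPair, chainPair, ← map_star]
    refine Commute.map (commute_star_pairOp (a := q - p) (b := p + q + 1) (by omega) (by ring)
      (by ring) (fun hd => ?_) (fun hd => ?_)) _
    · have := Int.eq_zero_of_abs_lt_dvd hd (by rw [abs_lt]; push_cast; omega)
      omega
    · have := Int.eq_zero_of_abs_lt_dvd hd (by rw [abs_lt]; push_cast; omega)
      omega
  · simp [vacuum]
  · have h := (pairOp_hardCore (N := 2 * M) (by omega) (hdvd p hp)).2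
    have h' : pairOp (2 * M) (2 * p + 1) * star (pairOp (2 * M) (2 * p + 1)) =
        star (pairOp (2 * M) (2 * p + 1)) * pairOp (2 * M) (2 * p + 1) -
          (num jw (mode (2 * M) (-(2 * p + 1))) + num jw (mode (2 * M) (2 * p + 1)) - 1) := by
      rw [← h]; abel
    rw [chainPair, ← map_star]
    apply WithLp.ofLp_injective
    rw [ofLp_toEuclideanCLM, ofLp_toEuclideanCLM, Matrix.mulVec_mulVec, h']
    simp only [Matrix.sub_mulVec, Matrix.add_mulVec, ← Matrix.mulVec_mulVec, num_mulVec_vacuum,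
      Matrix.one_mulVec, pairOp, pairAnn, ann_mulVec_vacuum, Matrix.mulVec_zero]
    simp
  · refine eq_smul_vacuum fun j => ?_
    have hN : 2 * M ≠ 0 := by have := j.pos; omega
    have hw' : ∀ p < M, w.ofLp = pairOp (2 * M) (2 * p + 1) *ᵥ
        (star (pairOp (2 * M) (2 * p + 1)) *ᵥ w.ofLp) := fun p hp => by
      have h := congrArg (fun v => v.ofLp) (hw p hp)
      rw [chainPair, ← map_star] at h
      exact h.symm
    rw [jw_eq_sum_ann_mode hN 1 j, Matrix.sum_mulVec]
    refine Finset.sum_eq_zero fun m hm => ?_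
    rw [Finset.mem_range] at hm
    rw [Matrix.smul_mulVec]
    suffices h : ann jw (mode (2 * M) (2 * m + 1)) *ᵥ w.ofLp = 0 by rw [h, smul_zero]
    by_cases hmM : m < M
    · rw [hw' m hmM, Matrix.mulVec_mulVec, (ann_mode_mul_pairOp _).1, Matrix.zero_mulVec]
    · have hp : 2 * M - 1 - m < M := by omega
      have he : mode (2 * M) (2 * m + 1) =
          mode (2 * M) (-(2 * ((2 * M - 1 - m : ℕ) : ℤ) + 1)) :=
        mode_eq_of_dvd (q := 1) (by omega)
      rw [hw' _ hp, he, Matrix.mulVec_mulVec, (ann_mode_mul_pairOp _).2, Matrix.zero_mulVec]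

/-- The energy `∑ E / 2` of the periodic momenta bounds the spectrum of the odd sector. The bound
is that of the whole periodic ring, whatever the parity of the state of this energy. -/
theorem periodic_lower_bound (hM : 1 ≤ M) {γ κ : ℝ} (hγ : 0 < γ) (hκ : 0 < κ) (h : ℝ)
    {v : EuclideanSpace ℂ (Config (2 * M))} (hv : v ≠ 0) {μ : ℂ}
    (hμ : toEuclideanCLM (n := Config (2 * M)) (𝕜 := ℂ) (fermiHam (2 * M) 1 h γ (γ + κ)) v =
      μ • v) :
    -((∑ m ∈ Finset.range (2 * M), disp (κ * (2 * γ + κ)) h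
      (Real.pi * ((2 * m : ℤ) : ℝ) / (2 * M : ℕ))) / 2) ≤ μ.re := by
  have hN : 2 * M ≠ 0 := by omega
  have hcar := car_jw (N := 2 * M)
  set T := toEuclideanCLM (n := Config (2 * M)) (𝕜 := ℂ) with hT
  set φ : ℕ → ℝ := fun p => Real.pi * ((2 * p : ℤ) : ℝ) / (2 * M : ℕ) with hφ
  set g := κ * (2 * γ + κ) with hg
  -- The self-conjugate momenta `0` and `π` carry a single mode, all others a pair.
  set X : ℕ → Matrix (Config (2 * M)) (Config (2 * M)) ℂ := fun p => if p = 0 ∨ p = M then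
      ((h + Real.cos (φ p) : ℝ) : ℂ) • (num jw (mode (2 * M) (2 * p)) - (1 / 2 : ℂ) • 1) else
    pairHam (pairOp (2 * M) (2 * p)) ((h + Real.cos (φ p) : ℝ) : ℂ)
      (((γ - (γ + κ)) * Real.sin (φ p) : ℝ) : ℂ)
      ((-((γ + (γ + κ)) * Real.sin (φ p)) : ℝ) : ℂ) with hX
  set a : ℕ → ℝ := fun p => if p = 0 ∨ p = M then |h + Real.cos (φ p)| / 2 else
    disp g h (φ p) with ha
  have hdiff : ∀ p q : ℕ, p ≤ M → q ≤ M → p ≠ q → ¬((2 * M : ℕ) : ℤ) ∣ (q : ℤ) - p :=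
    fun p q hp hq hpq hd => by
      have := Int.eq_zero_of_abs_lt_dvd hd (by rw [abs_lt]; push_cast; omega)
      omega
  have hadd : ∀ p q : ℕ, p ≤ M → q ≤ M → p ≠ q → ¬((2 * M : ℕ) : ℤ) ∣ (q : ℤ) + p :=
    fun p q hp hq hpq hd => by
      have := Int.eq_zero_of_abs_lt_dvd hd (by rw [abs_lt]; push_cast; omega)
      omega
  have hsumX : fermiHam (2 * M) 1 h γ (γ + κ) = ∑ p ∈ Finset.range (M + 1), X p := by
    rw [fermiHam_periodic hM, sum_range_succ_ends hM]
    congr 1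
    · simp [hX, hφ]
    · refine Finset.sum_congr rfl fun p hp => ?_
      rw [Finset.mem_Ico] at hp
      rw [hX]
      simp only
      rw [if_neg (by omega)]
  have hsuma : ∑ p ∈ Finset.range (M + 1), a p =
      (∑ m ∈ Finset.range (2 * M), disp g h (φ m)) / 2 := by
    have hreal : ∀ p, Real.sin (φ p) = 0 → disp g h (φ p) = |h + Real.cos (φ p)| := fun p hp => by
      rw [disp, hp]
      simp [Real.sqrt_sq_eq_abs]
    have hM0 : (M : ℝ) ≠ 0 := by exact_mod_cast (by omega : M ≠ 0)
    have hs0 : Real.sin (φ 0) = 0 := by simp [hφ]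
    have hsM : Real.sin (φ M) = 0 := by
      have : φ M = Real.pi := by rw [hφ]; push_cast; field_simp
      rw [this, Real.sin_pi]
    have hsym : ∀ p ∈ Finset.Ico 1 M, disp g h (φ p) + disp g h (φ (2 * M - p)) =
        2 * disp g h (φ p) := fun p hp => by
      rw [Finset.mem_Ico] at hp
      have : φ (2 * M - p) = 2 * Real.pi - φ p := by
        rw [hφ]
        push_cast [Nat.cast_sub (show p ≤ 2 * M by omega)]
        field_simp
      rw [disp, disp, this, Real.cos_two_pi_sub, Real.sin_two_pi_sub, neg_sq, two_mul]
    rw [sum_range_two_mul' hM, Finset.sum_congr rfl hsym, sum_range_succ_ends hM, hreal 0 hs0,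
      hreal M hsM, ← Finset.mul_sum]
    have : ∑ p ∈ Finset.Ico 1 M, a p = ∑ p ∈ Finset.Ico 1 M, disp g h (φ p) :=
      Finset.sum_congr rfl fun p hp => by
        rw [Finset.mem_Ico] at hp
        rw [ha]
        simp only
        rw [if_neg (by omega)]
    rw [this, ha]
    simp only [true_or, or_true, if_true]
    ring
  have hnp : ∀ p q : ℕ, p ≤ M → q ≤ M → p ≠ q →
      Commute (num jw (mode (2 * M) (2 * p))) (pairOp (2 * M) (2 * q)) ∧
      Commute (num jw (mode (2 * M) (2 * p))) (star (pairOp (2 * M) (2 * q))) :=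
    fun p q hp hq hpq => by
      have h1 := dot_mode_of_not_dvd hN (r := 2 * q) (r' := 2 * p) (l := p - q) (by ring)
        (hdiff q p hq hp hpq.symm)
      have h2 := dot_mode_of_not_dvd hN (r := -(2 * q)) (r' := 2 * p) (l := p + q) (by ring)
        (hadd q p hq hp hpq.symm)
      exact ⟨hcar.commute_num_pairAnn h2 h1, hcar.commute_num_star_pairAnn h2 h1⟩
  have hone : ∀ x : Matrix (Config (2 * M)) (Config (2 * M)) ℂ,
      Commute ((1 / 2 : ℂ) • (1 : Matrix (Config (2 * M)) (Config (2 * M)) ℂ)) x :=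
    fun x => (Commute.one_left x).smul_left _
  have hpairnum : ∀ p q : ℕ, p ≤ M → q ≤ M → p ≠ q → ∀ z A C D : ℂ,
      Commute (z • (num jw (mode (2 * M) (2 * p)) - (1 / 2 : ℂ) • 1))
        (pairHam (pairOp (2 * M) (2 * q)) A C D) := fun p q hp hq hpq z A C D =>
    ((commute_pairHam (hnp p q hp hq hpq).1 (hnp p q hp hq hpq).2 A C D).sub_left
      (hone _)).smul_left z
  have hcomm : ∀ p ≤ M, ∀ q ≤ M, p ≠ q → Commute (X p) (X q) := fun p hp q hq hpq => by
    simp only [hX]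
    split_ifs with h1 h2 h2
    · refine (((hcar.commute_num_num ?_ ?_).sub_right (hone _).symm).sub_left
        (hone _)).smul_left _ |>.smul_right _
      · exact dot_mode_of_not_dvd hN (l := q - p) (by ring) (hdiff p q hp hq hpq)
      · exact dot_mode_of_not_dvd hN (l := p - q) (by ring) (hdiff q p hq hp hpq.symm)
    · exact hpairnum p q hp hq hpq _ _ _ _
    · exact (hpairnum q p hq hp hpq.symm _ _ _ _).symm
    · have c1 : Commute (pairOp (2 * M) (2 * p)) (pairOp (2 * M) (2 * q)) :=
        hcar.commute_pairAnn _ _ _ _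
      have c2 : Commute (pairOp (2 * M) (2 * p)) (star (pairOp (2 * M) (2 * q))) :=
        commute_star_pairOp hN (a := q - p) (b := q + p) (by ring) (by ring)
          (hdiff p q hp hq hpq) (hadd p q hp hq hpq)
      have c3 : Commute (star (pairOp (2 * M) (2 * p))) (pairOp (2 * M) (2 * q)) := by
        simpa using c2.star_star
      exact (commute_pairHam (commute_pairHam c1 c2 _ _ _).symm
        (commute_pairHam c3 c1.star_star _ _ _).symm _ _ _).symm
  have hcube : ∀ p ≤ M, X p * X p * X p = ((a p : ℂ) ^ 2) • X p := fun p hp => by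
    simp only [hX, ha]
    split_ifs with h1
    · rw [hcar.num_half_cube (dot_mode_self hN _)]
      congr 1
      norm_cast
      rw [div_pow, div_pow, sq_abs]
    · refine pairHam_disp_cube (pairOp_hardCore hN ?_).1 hγ hκ h (φ p)
      intro hd
      have := Int.eq_zero_of_abs_lt_dvd hd (by rw [abs_lt]; push_cast; omega)
      omega
  rw [hsumX, map_sum] at hμ
  rw [← hsuma]
  refine neg_sum_le_re_of_cube (X := fun p => T (X p)) (fun p _ => ?_) (fun p hp => ?_)
    (fun p hp q hq hpq => ?_) hv hμ
  · simp only [ha]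
    split_ifs
    · positivity
    · exact disp_nonneg _ _ _
  · rw [Finset.mem_range] at hp
    rw [← map_mul, ← map_mul, hcube p (by omega), map_smul]
  · rw [Finset.mem_range] at hp hq
    exact (hcomm p (by omega) q (by omega) hpq).map T

end Chain

/-! ### Periodic against antiperiodic energies -/

section Energy

open MeasureTheory Set

/-- The momenta `π(2m + d)/N`. -/
def mom (N : ℕ) (d : ℤ) (m : ℕ) : ℝ := Real.pi * ((2 * m + d : ℤ) : ℝ) / N

variable {N : ℕ}

theorem sum_cos_mom (hN : 2 ≤ N) (d : ℤ) :
    ∑ m ∈ Finset.range N, Real.cos (mom N d m) = 0 := by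
  have h := sum_phase_momenta (N := N) (by omega) d 1
  rw [if_neg (fun hd => by
    have := Int.eq_zero_of_abs_lt_dvd hd (by rw [abs_lt]; omega)
    omega)] at h
  have h2 := congrArg Complex.re h
  rw [Complex.re_sum] at h2
  rw [← Complex.zero_re, ← h2]
  refine Finset.sum_congr rfl fun m _ => ?_
  rw [mul_one, phase_eq, mom]
  simp [-Complex.ofReal_cos, -Complex.ofReal_sin]

/-- As `(q e^{iφ})^N` is the same for all momenta `φ`, each term is a finite geometric series, of
which only the constant term survives the summation. -/
theorem sum_inv_one_add_mul_phase (hN : N ≠ 0) (hev : Even N) {d : ℤ} {s : ℝ}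
    (hs : phase N (d * N) = s) {q : ℝ} (hq : s * q ^ N ≠ 1) :
    ∑ m ∈ Finset.range N, (1 + (q : ℂ) * phase N (2 * m + d))⁻¹ = N / (1 - s * q ^ N) := by
  have hq' : (1 : ℂ) - s * q ^ N ≠ 0 := by
    intro h
    apply hq
    have : (s : ℂ) * q ^ N = 1 := (sub_eq_zero.1 h).symm
    exact_mod_cast this
  have hpow : ∀ m : ℕ, (-(q : ℂ) * phase N (2 * m + d)) ^ N = s * q ^ N := fun m => by
    have : phase N (2 * m + d) ^ N = s := by
      rw [← phase_mul_nat, add_mul, phase_add, hs, mul_assoc,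
        (phase_eq_one_iff hN _).2 (dvd_mul_left _ _), one_mul]
    rw [mul_pow, hev.neg_pow, this, mul_comm]
  have hinv : ∀ m : ℕ, (1 + (q : ℂ) * phase N (2 * m + d))⁻¹ =
      (∑ j ∈ Finset.range N, (-(q : ℂ)) ^ j * phase N ((2 * m + d) * j)) / (1 - s * q ^ N) :=
    fun m => by
      have h1 := mul_neg_geom_sum (-(q : ℂ) * phase N (2 * m + d)) N
      rw [hpow] at h1
      have h2 : (1 : ℂ) - -(q : ℂ) * phase N (2 * m + d) ≠ 0 := by
        intro h0
        rw [h0, zero_mul] at h1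
        exact hq' h1.symm
      have h3 : ∑ j ∈ Finset.range N, (-(q : ℂ)) ^ j * phase N ((2 * m + d) * j) =
          ∑ j ∈ Finset.range N, (-(q : ℂ) * phase N (2 * m + d)) ^ j :=
        Finset.sum_congr rfl fun j _ => by rw [mul_pow, phase_mul_nat]
      rw [h3, ← h1, show (1 : ℂ) + q * phase N (2 * m + d) = 1 - -q * phase N (2 * m + d) by ring]
      have h4 : (∑ j ∈ Finset.range N, (-(q : ℂ) * phase N (2 * m + d)) ^ j) ≠ 0 := by
        intro h0
        rw [h0, mul_zero] at h1
        exact hq' h1.symm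
      rw [inv_eq_one_div, div_eq_div_iff h2 (mul_ne_zero h2 h4)]
      ring
  simp only [hinv]
  rw [← Finset.sum_div]
  congr 1
  rw [Finset.sum_comm]
  simp only [← Finset.mul_sum, sum_phase_momenta hN]
  rw [Finset.sum_eq_single 0]
  · simp [phase_zero]
  · intro j hj hj0
    rw [Finset.mem_range] at hj
    rw [if_neg, mul_zero]
    intro hd
    have := Int.eq_zero_of_abs_lt_dvd hd (by rw [abs_lt]; omega)
    omega
  · intro h
    exact absurd (Finset.mem_range.2 (Nat.pos_of_ne_zero hN)) h

/-- A Poisson kernel summed over equidistant points. -/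
theorem sum_poisson (hN : N ≠ 0) (hev : Even N) {d : ℤ} {s : ℝ} (hs : phase N (d * N) = s) {q : ℝ}
    (hq : s * q ^ N ≠ 1) (hq2 : q ^ 2 < 1) :
    ∑ m ∈ Finset.range N, (1 + 2 * q * Real.cos (mom N d m) + q ^ 2)⁻¹ =
      N / (1 - q ^ 2) * ((1 + s * q ^ N) / (1 - s * q ^ N)) := by
  have h1 := sum_inv_one_add_mul_phase hN hev hs hq
  have hre : ∀ m : ℕ, (1 + 2 * q * Real.cos (mom N d m) + q ^ 2)⁻¹ =
      (2 * ((1 + (q : ℂ) * phase N (2 * m + d))⁻¹).re - 1) / (1 - q ^ 2) := fun m => by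
    set c := Real.cos (mom N d m) with hc
    set σ := Real.sin (mom N d m) with hσ
    have hcs : c ^ 2 + σ ^ 2 = 1 := Real.cos_sq_add_sin_sq _
    have hz : (1 + (q : ℂ) * phase N (2 * m + d)) = ⟨1 + q * c, q * σ⟩ := by
      rw [phase_eq, hc, hσ, mom]
      apply Complex.ext <;> simp [-Complex.ofReal_cos, -Complex.ofReal_sin]
    have hn : Complex.normSq ⟨1 + q * c, q * σ⟩ = 1 + 2 * q * c + q ^ 2 := by
      rw [Complex.normSq_mk]
      linear_combination q ^ 2 * hcs
    have hp : 0 < 1 + 2 * q * c + q ^ 2 := by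
      have hq1 : |q| < 1 := by rwa [sq_lt_one_iff_abs_lt_one] at hq2
      have hc1 : |c| ≤ 1 := Real.abs_cos_le_one _
      have : |q * c| ≤ |q| := by
        rw [abs_mul]
        exact mul_le_of_le_one_right (abs_nonneg _) hc1
      have h3 := neg_abs_le (q * c)
      have h4 : 0 < (1 - |q|) ^ 2 := by
        have : 0 < 1 - |q| := by linarith
        positivity
      have h5 := sq_abs q
      nlinarith
    rw [hz, Complex.inv_re, hn]
    have : 1 - q ^ 2 ≠ 0 := by linarith
    field_simp
    ring
  have h2 := congrArg Complex.re h1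
  rw [Complex.re_sum] at h2
  have h3 : ((N : ℂ) / (1 - s * q ^ N)).re = N / (1 - s * q ^ N) := by
    rw [← Complex.ofReal_re ((N : ℝ) / (1 - s * q ^ N))]
    congr 1
    push_cast
    rfl
  rw [h3] at h2
  simp only [hre]
  rw [← Finset.sum_div, Finset.sum_sub_distrib, ← Finset.mul_sum, h2]
  have h4 : 1 - q ^ 2 ≠ 0 := by linarith
  have h5 : 1 - s * q ^ N ≠ 0 := fun h => hq (by linarith)
  simp only [Finset.sum_const, Finset.card_range, nsmul_eq_mul, mul_one]
  field_simp
  ring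

/-- The comparison of the two sums for one rational function with a single pole. -/
theorem sum_inv_lt_sum_inv (hN : N ≠ 0) (hev : Even N) {T g : ℝ} (hT : 0 < T) (hg : 0 < g)
    (hTg : T ≠ g) :
    ∑ m ∈ Finset.range N,
        (T * (1 + Real.cos (mom N 1 m)) + g * (1 - Real.cos (mom N 1 m)))⁻¹ <
      ∑ m ∈ Finset.range N,
        (T * (1 + Real.cos (mom N 0 m)) + g * (1 - Real.cos (mom N 0 m)))⁻¹ := by
  set r := Real.sqrt (T / g) with hr
  have hr0 : 0 < r := Real.sqrt_pos.2 (div_pos hT hg)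
  have hrT : g * r ^ 2 = T := by
    rw [hr, Real.sq_sqrt (div_pos hT hg).le]; field_simp
  have hr1 : r - 1 ≠ 0 := by
    intro h
    have : r = 1 := by linarith
    rw [this] at hrT
    exact hTg (by linarith)
  set q := (r - 1) / (r + 1) with hq
  have hq0 : q ≠ 0 := div_ne_zero hr1 (by positivity)
  have hq1 : q ^ 2 < 1 := by
    rw [hq, div_pow, div_lt_one (by positivity)]
    nlinarith
  have hden : ∀ c, (T * (1 + c) + g * (1 - c))⁻¹ =
      2 / (g * (r + 1) ^ 2) * (1 + 2 * q * c + q ^ 2)⁻¹ := fun c => by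
    have : T * (1 + c) + g * (1 - c) = g * (r + 1) ^ 2 / 2 * (1 + 2 * q * c + q ^ 2) := by
      rw [hq, ← hrT]
      field_simp
      ring
    rw [this, mul_inv, inv_div]
  have hqN : 0 < q ^ N := hev.pow_pos hq0
  have hqN1 : q ^ N < 1 := by
    obtain ⟨k, rfl⟩ := hev
    rw [← two_mul, pow_mul]
    exact pow_lt_one₀ (sq_nonneg q) hq1 (by omega)
  have hs1 : phase N (1 * N) = ((-1 : ℝ) : ℂ) := by rw [one_mul, phase_self hN]; simp
  have hs0 : phase N (0 * N) = ((1 : ℝ) : ℂ) := by rw [zero_mul, phase_zero]; simp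
  simp only [hden]
  rw [← Finset.mul_sum, ← Finset.mul_sum, sum_poisson hN hev hs1 (by linarith) hq1,
    sum_poisson hN hev hs0 (by linarith) hq1]
  refine mul_lt_mul_of_pos_left (mul_lt_mul_of_pos_left ?_ ?_) (by positivity)
  · rw [div_lt_div_iff₀ (by linarith) (by linarith)]
    nlinarith
  · have : (0 : ℝ) < N := by exact_mod_cast Nat.pos_of_ne_zero hN
    have : 0 < 1 - q ^ 2 := by linarith
    positivity

/-- The excluded value `T = g`, where the denominator is constant, does not matter to an integral
over `T`. -/
theorem sum_sq_div_lt (hN : 2 ≤ N) (hev : Even N) {T g : ℝ} (hT : 0 < T) (hg : 0 < g)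
    (hTg : T ≠ g) :
    ∑ m ∈ Finset.range N, (1 + Real.cos (mom N 1 m)) ^ 2 *
        (T * (1 + Real.cos (mom N 1 m)) + g * (1 - Real.cos (mom N 1 m)))⁻¹ <
      ∑ m ∈ Finset.range N, (1 + Real.cos (mom N 0 m)) ^ 2 *
        (T * (1 + Real.cos (mom N 0 m)) + g * (1 - Real.cos (mom N 0 m)))⁻¹ := by
  have hQ : T - g ≠ 0 := sub_ne_zero.2 hTg
  -- Polynomial division by the linear denominator; the remainder is positive.
  have hdiv : ∀ φ : ℝ, (1 + Real.cos φ) ^ 2 *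
      (T * (1 + Real.cos φ) + g * (1 - Real.cos φ))⁻¹ =
      (T - g)⁻¹ * Real.cos φ + (T - 3 * g) / (T - g) ^ 2 +
        (4 * g ^ 2 / (T - g) ^ 2) * (T * (1 + Real.cos φ) + g * (1 - Real.cos φ))⁻¹ := fun φ => by
    have h1 := Real.neg_one_le_cos φ
    have h2 := Real.cos_le_one φ
    have : 0 < T * (1 + Real.cos φ) + g * (1 - Real.cos φ) := by
      rcases h1.eq_or_lt with h | h
      · rw [← h]; linarith
      · have := mul_pos hT (by linarith : 0 < 1 + Real.cos φ)
        have := mul_nonneg hg.le (by linarith : 0 ≤ 1 - Real.cos φ)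
        linarith
    have hnum : (1 + Real.cos φ) ^ 2 = ((T - g)⁻¹ * Real.cos φ + (T - 3 * g) / (T - g) ^ 2) *
        (T * (1 + Real.cos φ) + g * (1 - Real.cos φ)) + 4 * g ^ 2 / (T - g) ^ 2 := by
      field_simp
      ring
    rw [hnum, add_mul, mul_assoc, mul_inv_cancel₀ this.ne', mul_one]
  simp only [hdiv]
  simp only [Finset.sum_add_distrib, ← Finset.mul_sum, sum_cos_mom hN]
  have := sum_inv_lt_sum_inv (by omega) hev hT hg hTg
  have hpos : 0 < 4 * g ^ 2 / (T - g) ^ 2 := by positivity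
  have := mul_lt_mul_of_pos_left this hpos
  linarith

/-- At `φ = π` the power has a junk argument, but its prefactor vanishes. -/
theorem disp_one_eq {g : ℝ} (φ : ℝ) :
    disp g 1 φ = (1 + Real.cos φ) *
      (1 + g * (1 - Real.cos φ) / (1 + Real.cos φ)) ^ (1 / 2 : ℝ) := by
  have h1 := Real.neg_one_le_cos φ
  have hs : Real.sin φ ^ 2 = (1 - Real.cos φ) * (1 + Real.cos φ) := by
    rw [Real.sin_sq]; ring
  rw [disp, hs, ← Real.sqrt_eq_rpow]
  rcases h1.eq_or_lt with h | h
  · rw [← h]; simp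
  · have hp : 0 < 1 + Real.cos φ := by linarith
    rw [← Real.sqrt_sq hp.le, ← Real.sqrt_mul (sq_nonneg _), Real.sqrt_sq hp.le]
    congr 1
    field_simp

open Real in
/-- At the critical field the antiperiodic momenta have the larger total energy. The square root
is a superposition of resolvents, for which the two sums are geometric series. -/
theorem sum_disp_lt (hN : 2 ≤ N) (hev : Even N) {g : ℝ} (hg : 0 < g) :
    ∑ m ∈ Finset.range N, disp g 1 (mom N 0 m) < ∑ m ∈ Finset.range N, disp g 1 (mom N 1 m) := by
  have hp : (1 / 2 : ℝ) ∈ Ioo (0 : ℝ) 1 := by constructor <;> norm_num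
  set y : ℝ → ℝ := fun φ => 1 + g * (1 - Real.cos φ) / (1 + Real.cos φ) with hy
  have hy0 : ∀ φ, 0 ≤ y φ := fun φ => by
    have h1 := Real.neg_one_le_cos φ
    have h2 := Real.cos_le_one φ
    have := div_nonneg (mul_nonneg hg.le (by linarith : 0 ≤ 1 - Real.cos φ))
      (by linarith : 0 ≤ 1 + Real.cos φ)
    simp only [hy]
    linarith
  set C := ∫ t in Ioi 0, rpowIntegrand₀₁ (1 / 2) t 1 with hC
  have hC0 : 0 < C := integral_rpowIntegrand₀₁_one_pos hp
  have hint : ∀ φ, IntegrableOn (fun t => (1 + Real.cos φ) * rpowIntegrand₀₁ (1 / 2) t (y φ))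
      (Ioi 0) := fun φ => (integrableOn_rpowIntegrand₀₁_Ioi hp (hy0 φ)).const_mul _
  have hrep : ∀ φ, disp g 1 φ =
      C⁻¹ * ∫ t in Ioi 0, (1 + Real.cos φ) * rpowIntegrand₀₁ (1 / 2) t (y φ) := fun φ => by
    rw [disp_one_eq, rpow_eq_const_mul_integral hp (hy0 φ), integral_const_mul]
    ring
  simp only [hrep]
  rw [← Finset.mul_sum, ← Finset.mul_sum, ← integral_finsetSum _ fun m _ => hint _,
    ← integral_finsetSum _ fun m _ => hint _]
  refine mul_lt_mul_of_pos_left ?_ (inv_pos.2 hC0)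
  -- It remains to compare the integrands, almost everywhere in `t`.
  have hi : ∀ d : ℤ, Integrable (fun t => ∑ m ∈ Finset.range N, (1 + Real.cos (mom N d m)) *
      rpowIntegrand₀₁ (1 / 2) t (y (mom N d m))) (volume.restrict (Ioi 0)) := fun d =>
    integrable_finsetSum _ fun m _ => hint _
  have hval : ∀ t : ℝ, 0 < t → ∀ φ, (1 + Real.cos φ) * rpowIntegrand₀₁ (1 / 2) t (y φ) =
      t ^ (1 / 2 : ℝ) * t⁻¹ * (1 + Real.cos φ) - t ^ (1 / 2 : ℝ) * ((1 + Real.cos φ) ^ 2 *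
        ((t + 1) * (1 + Real.cos φ) + g * (1 - Real.cos φ))⁻¹) := fun t ht φ => by
    have h1 := Real.neg_one_le_cos φ
    rw [rpowIntegrand₀₁]
    rcases h1.eq_or_lt with h | h
    · rw [← h]; simp
    · have hp : 0 < 1 + Real.cos φ := by linarith
      have h2 : (t + y φ)⁻¹ = (1 + Real.cos φ) *
          ((t + 1) * (1 + Real.cos φ) + g * (1 - Real.cos φ))⁻¹ := by
        have : t + y φ = ((t + 1) * (1 + Real.cos φ) + g * (1 - Real.cos φ)) / (1 + Real.cos φ) := by
          simp only [hy]
          field_simp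
          ring
        rw [this, inv_div, div_eq_mul_inv]
      rw [h2]
      ring
  have hlt : ∀ t : ℝ, 0 < t → t ≠ g - 1 →
      0 < ∑ m ∈ Finset.range N, (1 + Real.cos (mom N 1 m)) *
          rpowIntegrand₀₁ (1 / 2) t (y (mom N 1 m)) -
        ∑ m ∈ Finset.range N, (1 + Real.cos (mom N 0 m)) *
          rpowIntegrand₀₁ (1 / 2) t (y (mom N 0 m)) := fun t ht htg => by
    simp only [hval t ht]
    simp only [Finset.sum_sub_distrib, ← Finset.mul_sum, Finset.sum_add_distrib, sum_cos_mom hN]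
    have h1 := sum_sq_div_lt hN hev (T := t + 1) (by linarith) hg
      (fun h => htg (by linarith))
    have h2 := mul_lt_mul_of_pos_left h1 (Real.rpow_pos_of_pos ht (1 / 2))
    linarith
  rw [← sub_pos, ← integral_sub (hi 1) (hi 0)]
  have hae : ∀ᵐ t ∂(volume.restrict (Ioi (0 : ℝ))), 0 < t ∧ t ≠ g - 1 := by
    rw [ae_restrict_iff' measurableSet_Ioi]
    have : ∀ᵐ t : ℝ, t ≠ g - 1 := by
      rw [ae_iff]
      simp
    filter_upwards [this] with t h1 h2
    exact ⟨h2, h1⟩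
  refine (integral_pos_iff_support_of_nonneg_ae ?_ ((hi 1).sub (hi 0))).2 ?_
  rotate_left
  · refine lt_of_lt_of_le ?_ (measure_mono (show Ioi (max 0 (g - 1)) ⊆ _ from fun t ht => ?_))
    · rw [Measure.restrict_apply measurableSet_Ioi, inter_eq_left.2 (Ioi_subset_Ioi (le_max_left _ _)),
        Real.volume_Ioi]
      exact ENNReal.zero_lt_top
    · exact (hlt t ((le_max_left _ _).trans_lt ht) ((le_max_right _ _).trans_lt ht).ne').ne'
  · filter_upwards [hae] with t ht
    exact (hlt t ht.1 ht.2).le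

end Energy

/-! ### Quantum Fisher information of the chain -/

section ChainQFI

open Matrix

variable {M : ℕ}

theorem mom_mem_Ioo {p : ℕ} (hp : p < M) : mom (2 * M) 1 p ∈ Set.Ioo 0 Real.pi := by
  have hM : (0 : ℝ) < M := by exact_mod_cast (by omega : 0 < M)
  have h1 : (p : ℝ) + 1 ≤ M := by exact_mod_cast hp
  have h2 : (0 : ℝ) ≤ p := Nat.cast_nonneg p
  rw [mom]
  push_cast
  refine ⟨by positivity, ?_⟩
  rw [div_lt_iff₀ (by positivity)]
  exact mul_lt_mul_of_pos_left (by linarith) Real.pi_pos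

theorem sin_mom_pos {p : ℕ} (hp : p < M) : 0 < Real.sin (mom (2 * M) 1 p) :=
  Real.sin_pos_of_pos_of_lt_pi (mom_mem_Ioo hp).1 (mom_mem_Ioo hp).2

theorem sum_disp_antiperiodic (hM : 1 ≤ M) (g h : ℝ) :
    ∑ m ∈ Finset.range (2 * M), disp g h (mom (2 * M) 1 m) =
      2 * ∑ p ∈ Finset.range M, disp g h (mom (2 * M) 1 p) := by
  have hM0 : (M : ℝ) ≠ 0 := by exact_mod_cast (by omega : M ≠ 0)
  rw [sum_range_two_mul, Finset.mul_sum]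
  refine Finset.sum_congr rfl fun p hp => ?_
  rw [Finset.mem_range] at hp
  have : mom (2 * M) 1 (2 * M - 1 - p) = 2 * Real.pi - mom (2 * M) 1 p := by
    rw [mom, mom]
    push_cast [Nat.cast_sub (show p ≤ 2 * M - 1 by omega), Nat.cast_sub (show 1 ≤ 2 * M by omega)]
    field_simp
    ring
  rw [disp, disp, this, Real.cos_two_pi_sub, Real.sin_two_pi_sub, neg_sq, ← two_mul]

theorem continuous_disp (g φ : ℝ) : Continuous fun h => disp g h φ := by
  unfold disp
  fun_prop

/-- The strict inequality of the sector energies at the critical field persists near it. -/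
theorem eventually_periodic_lt (hM : 1 ≤ M) {g : ℝ} (hg : 0 < g) :
    ∀ᶠ h in 𝓝 (1 : ℝ), (∑ m ∈ Finset.range (2 * M), disp g h (mom (2 * M) 0 m)) / 2 <
      ∑ p ∈ Finset.range M, disp g h (mom (2 * M) 1 p) := by
  have h1 := sum_disp_lt (N := 2 * M) (by omega) (even_two_mul M) hg
  rw [sum_disp_antiperiodic hM] at h1
  refine ContinuousAt.eventually_lt (Continuous.continuousAt ?_) (Continuous.continuousAt ?_)
    (by linarith)
  · exact (continuous_finsetSum _ fun m _ => continuous_disp g _).div_const 2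
  · exact continuous_finsetSum _ fun m _ => continuous_disp g _

/-- The pair Hamiltonian of the antiperiodic momentum `p`, as an operator on the chain. -/
def chainBlock (M : ℕ) (γ κ h : ℝ) (p : ℕ) :
    EuclideanSpace ℂ (Config (2 * M)) →L[ℂ] EuclideanSpace ℂ (Config (2 * M)) :=
  pairHam (chainPair M p) ((h + Real.cos (mom (2 * M) 1 p) : ℝ) : ℂ)
    (((γ - (γ + κ)) * Real.sin (mom (2 * M) 1 p) : ℝ) : ℂ)
    ((-((γ + (γ + κ)) * Real.sin (mom (2 * M) 1 p)) : ℝ) : ℂ)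

theorem toEuclideanCLM_fermiHam_antiperiodic (hM : 1 ≤ M) (γ κ h : ℝ) :
    toEuclideanCLM (n := Config (2 * M)) (𝕜 := ℂ) (fermiHam (2 * M) (-1) h γ (γ + κ)) =
      ∑ p ∈ Finset.range M, chainBlock M γ κ h p := by
  rw [fermiHam_antiperiodic hM, map_sum]
  refine Finset.sum_congr rfl fun p _ => ?_
  rw [toEuclideanCLM_pairHam]
  rfl

theorem chainBlock_cube {γ κ : ℝ} (hγ : 0 < γ) (hκ : 0 < κ) (h : ℝ) {p : ℕ} (hp : p < M) :
    chainBlock M γ κ h p * chainBlock M γ κ h p * chainBlock M γ κ h p =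
      ((disp (κ * (2 * γ + κ)) h (mom (2 * M) 1 p) : ℂ) ^ 2) • chainBlock M γ κ h p :=
  pairHam_disp_cube ((pairModes_chain M).hardCore p hp) hγ hκ h _

theorem chainBlock_commute {γ κ h : ℝ} {p q : ℕ} (hp : p < M) (hq : q < M) (hpq : p ≠ q) :
    Commute (chainBlock M γ κ h p) (chainBlock M γ κ h q) :=
  (pairModes_chain M).commute_pairHam_pairHam hp hq hpq _ _ _ _ _ _

theorem parity_sq {N : ℕ} : parity * parity = (1 : Matrix (Config N) (Config N) ℂ) :=
  signOp_sq _

theorem parity_commute_chainPair {p : ℕ} :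
    Commute (toEuclideanCLM (n := Config (2 * M)) (𝕜 := ℂ) parity) (star (chainPair M p)) := by
  rw [chainPair, ← map_star]
  refine Commute.map ?_ _
  have h : ∀ u : Fin (2 * M) → ℂ, parity * ann jw u = -(ann jw u * parity) := fun u => by
    simp only [ann, Finset.mul_sum, Finset.sum_mul, ← Finset.sum_neg_distrib]
    refine Finset.sum_congr rfl fun j _ => ?_
    rw [mul_smul_comm, jw, parity_mul_fer lower_diag, smul_mul_assoc, smul_neg]
  have h' : Commute parity (pairOp (2 * M) (2 * p + 1)) := by
    rw [pairOp, pairAnn]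
    change _ * (_ * _) = _ * _ * _
    rw [← mul_assoc, h, neg_mul, mul_assoc, h, mul_neg, neg_neg, mul_assoc]
  have h2 := h'.star_star
  rwa [parity, star_signOp, ← parity] at h2

theorem parity_pairState (θ : ℕ → ℝ) (n : ℕ) :
    toEuclideanCLM (n := Config (2 * M)) (𝕜 := ℂ) parity
      (pairState (chainPair M) vacuum θ n) = pairState (chainPair M) vacuum θ n := by
  induction n with
  | zero =>
    apply WithLp.ofLp_injective
    rw [pairState, ofLp_toEuclideanCLM, parity_mulVec_vacuum]
  | succ n ih =>
    rw [pairState, map_add, map_smul, map_smul,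
      ← apply_apply_of_commute parity_commute_chainPair.symm.symm, ih]

/-- On the even sector the chain is the sum of its antiperiodic momentum blocks. -/
theorem chain_apply_of_even (hM : 1 ≤ M) {γ κ h : ℝ}
    {v : EuclideanSpace ℂ (Config (2 * M))}
    (hv : toEuclideanCLM (n := Config (2 * M)) (𝕜 := ℂ) parity v = v) :
    (chainHamiltonian (2 * M) h γ (γ + κ)).toEuclideanLin v =
      (∑ p ∈ Finset.range M, chainBlock M γ κ h p) v := by
  rw [← toEuclideanCLM_fermiHam_antiperiodic hM]
  apply WithLp.ofLp_injective
  have h1 : parity *ᵥ v.ofLp = (1 : ℂ) • v.ofLp := by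
    rw [one_smul]
    exact congrArg (fun w => w.ofLp) hv
  exact chainHamiltonian_mulVec h γ (γ + κ) h1

theorem chain_apply_of_odd {γ κ h : ℝ}
    {v : EuclideanSpace ℂ (Config (2 * M))}
    (hv : toEuclideanCLM (n := Config (2 * M)) (𝕜 := ℂ) parity v = -v) :
    (chainHamiltonian (2 * M) h γ (γ + κ)).toEuclideanLin v =
      toEuclideanCLM (n := Config (2 * M)) (𝕜 := ℂ) (fermiHam (2 * M) 1 h γ (γ + κ)) v := by
  apply WithLp.ofLp_injective
  have h1 : parity *ᵥ v.ofLp = (-1 : ℂ) • v.ofLp := by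
    rw [neg_one_smul]
    exact congrArg (fun w => w.ofLp) hv
  have h2 := chainHamiltonian_mulVec h γ (γ + κ) h1
  rw [neg_neg] at h2
  exact h2

/-- Both parity components of an eigenvector are eigenvectors. -/
theorem chain_parity_components (hM : 1 ≤ M) {γ κ h : ℝ} {μ : ℂ}
    {v : EuclideanSpace ℂ (Config (2 * M))}
    (hv : (chainHamiltonian (2 * M) h γ (γ + κ)).toEuclideanLin v = μ • v) :
    ∃ e o : EuclideanSpace ℂ (Config (2 * M)), v = e + o ∧
      (∑ p ∈ Finset.range M, chainBlock M γ κ h p) e = μ • e ∧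
      toEuclideanCLM (n := Config (2 * M)) (𝕜 := ℂ) (fermiHam (2 * M) 1 h γ (γ + κ)) o =
        μ • o := by
  set T := toEuclideanCLM (n := Config (2 * M)) (𝕜 := ℂ)
  have hPP : ∀ w, T parity (T parity w) = w := fun w => by
    have := DFunLike.congr_fun (map_mul T parity parity) w
    rw [parity_sq, map_one] at this
    exact this.symm
  have hPH : (chainHamiltonian (2 * M) h γ (γ + κ)).toEuclideanLin (T parity v) =
      μ • T parity v := by
    have hc := (parity_commute_chainHamiltonian (N := 2 * M) h γ (γ + κ)).map T
    have h1 := apply_apply_of_commute hc v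
    have h2 : T (chainHamiltonian (2 * M) h γ (γ + κ)) v = μ • v := hv
    rw [h2, map_smul] at h1
    exact h1
  have he : T parity ((1 / 2 : ℂ) • (v + T parity v)) = (1 / 2 : ℂ) • (v + T parity v) := by
    rw [map_smul, map_add, hPP, add_comm]
  have ho : T parity ((1 / 2 : ℂ) • (v - T parity v)) = -((1 / 2 : ℂ) • (v - T parity v)) := by
    rw [map_smul, map_sub, hPP, ← smul_neg, neg_sub]
  refine ⟨(1 / 2 : ℂ) • (v + T parity v), (1 / 2 : ℂ) • (v - T parity v), by module, ?_, ?_⟩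
  · rw [← chain_apply_of_even hM he, map_smul, map_add, hv, hPH]
    module
  · rw [← chain_apply_of_odd ho, map_smul, map_sub, hv, hPH]
    module

/-- Near the critical field every eigenvalue with an odd eigenvector exceeds the lowest even one, so
the ground states are the joint ground states of the momentum blocks. -/
theorem hasGroundQFI_chain (hM : 1 ≤ M) {γ κ : ℝ} (hγ : 0 < γ) (hκ : 0 < κ) :
    HasGroundQFI (fun h => chainHamiltonian (2 * M) h γ (γ + κ)) 1
      (∑ p ∈ Finset.range M, blockValue γ κ (mom (2 * M) 1 p)) := by
  have hb := pairModes_chain M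
  have hg : 0 < κ * (2 * γ + κ) := by positivity
  set φ : ℕ → ℝ := mom (2 * M) 1 with hφ
  have hsin : ∀ p < M, 0 < Real.sin (φ p) := fun p hp => sin_mom_pos hp
  have heven : ∀ {h : ℝ} {μ : ℂ} {e : EuclideanSpace ℂ (Config (2 * M))}, e ≠ 0 →
      (∑ p ∈ Finset.range M, chainBlock M γ κ h p) e = μ • e →
      -∑ p ∈ Finset.range M, disp (κ * (2 * γ + κ)) h (φ p) ≤ μ.re := fun he hμ =>
    neg_sum_le_re_of_cube (fun p _ => disp_nonneg _ _ _)
      (fun p hp => chainBlock_cube hγ hκ _ (Finset.mem_range.1 hp))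
      (fun p hp q hq hpq => chainBlock_commute (Finset.mem_range.1 hp) (Finset.mem_range.1 hq) hpq)
      he hμ
  have hodd : ∀ᶠ h in 𝓝 (1 : ℝ), ∀ (μ : ℂ) (o : EuclideanSpace ℂ (Config (2 * M))), o ≠ 0 →
      toEuclideanCLM (n := Config (2 * M)) (𝕜 := ℂ) (fermiHam (2 * M) 1 h γ (γ + κ)) o = μ • o →
      -∑ p ∈ Finset.range M, disp (κ * (2 * γ + κ)) h (φ p) < μ.re := by
    filter_upwards [eventually_periodic_lt hM hg] with h hh μ o ho hμ
    have h1 := periodic_lower_bound hM hγ hκ h ho hμ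
    have h2 : ∀ m : ℕ, mom (2 * M) 0 m = Real.pi * ((2 * m : ℤ) : ℝ) / (2 * M : ℕ) := fun m => by
      rw [mom, add_zero]
    simp only [h2] at hh
    linarith
  have key := hb.hasGroundQFI (H := fun h => chainHamiltonian (2 * M) h γ (γ + κ)) (h₀ := 1)
    (A := fun p h => h + Real.cos (φ p)) (C := fun p _ => (γ - (γ + κ)) * Real.sin (φ p))
    (D := fun p _ => -((γ + (γ + κ)) * Real.sin (φ p)))
    (E := fun p h => disp (κ * (2 * γ + κ)) h (φ p)) (θ := fun p => groundAngle γ κ (φ p))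
    (θ' := fun p => _) (fun p hp => hasDerivAt_groundAngle hγ hκ (hsin p hp))
    (Eventually.of_forall fun h p hp => pairParam_groundAngle hγ hκ (hsin p hp) h)
    (Eventually.of_forall fun h => ?_) (hodd.mono fun h hh v hv μ hμ => ?_)
    (hodd.mono fun h hh v hv p hp => ?_)
  · rw [Finset.mul_sum] at key
    exact key
  · rw [chain_apply_of_even hM (parity_pairState _ _), _root_.sum_apply]
    have hp : ∀ p ∈ Finset.range M, chainBlock M γ κ h p
        (pairState (chainPair M) vacuum (fun p => groundAngle γ κ (φ p) h) M) =
        (-disp (κ * (2 * γ + κ)) h (φ p) : ℂ) •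
          pairState (chainPair M) vacuum (fun p => groundAngle γ κ (φ p) h) M := fun p hp =>
      hb.pairHam_pairState (A := fun p => h + Real.cos (φ p))
        (C := fun p => (γ - (γ + κ)) * Real.sin (φ p))
        (D := fun p => -((γ + (γ + κ)) * Real.sin (φ p)))
        (E := fun p => disp (κ * (2 * γ + κ)) h (φ p)) le_rfl (Finset.mem_range.1 hp)
        (pairParam_groundAngle hγ hκ (hsin p (Finset.mem_range.1 hp)) h)
    rw [Finset.sum_congr rfl hp]
    rw [← Finset.sum_smul, Finset.sum_neg_distrib]
    push_cast
    rfl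
  · obtain ⟨e, o, hveo, he, ho⟩ := chain_parity_components hM hμ
    by_cases he0 : e = 0
    · refine (hh μ o ?_ ho).le
      rintro rfl
      exact hv (by rw [hveo, he0, add_zero])
    · exact heven he0 he
  · obtain ⟨e, o, hveo, he, ho⟩ := chain_parity_components hM hv
    have ho0 : o = 0 := by
      by_contra h0
      have := hh _ o h0 ho
      rw [Complex.ofReal_re] at this
      exact lt_irrefl _ this
    rw [ho0, add_zero] at hveo
    subst hveo
    exact eigenvector_of_sum_eq_neg_sum (X := chainBlock M γ κ h)
      (a := fun p => disp (κ * (2 * γ + κ)) h (φ p)) (fun p _ => disp_nonneg _ _ _)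
      (fun p hp => chainBlock_cube hγ hκ _ (Finset.mem_range.1 hp))
      (fun p hp q hq hpq => chainBlock_commute (Finset.mem_range.1 hp) (Finset.mem_range.1 hq) hpq)
      he (Finset.mem_range.2 hp) (disp_pos hg (hsin p hp).ne' h)

end ChainQFI

/-! ### The block information in terms of the distance to the momentum `π` -/

section BlockValue

/-- The relative correction to the leading order, in terms of `G = κ (2γ + κ) tan² (φ/2)` and
`v = κ² tan² (φ/2)`; it is `1` at `G = v = 0`. -/
def correction (G v : ℝ) : ℝ :=
  4 * (1 + Real.sqrt (1 + G)) ^ 2 / ((1 + G) * ((1 + Real.sqrt (1 + G)) ^ 2 + v) ^ 2)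

theorem correction_le_one {G v : ℝ} (hG : 0 ≤ G) (hv : 0 ≤ v) : correction G v ≤ 1 := by
  have hr : 1 ≤ Real.sqrt (1 + G) := Real.one_le_sqrt.2 (by linarith)
  set r := Real.sqrt (1 + G)
  rw [correction, div_le_one (by positivity)]
  have h1 : 4 ≤ (1 + r) ^ 2 := by nlinarith
  have h2 : (1 + r) ^ 2 * (1 + r) ^ 2 ≤ ((1 + r) ^ 2 + v) ^ 2 := by
    rw [← sq]
    exact pow_le_pow_left₀ (by positivity) (by linarith) 2
  have h3 : 4 * (1 + r) ^ 2 ≤ (1 + r) ^ 2 * (1 + r) ^ 2 :=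
    mul_le_mul_of_nonneg_right h1 (by positivity)
  have h4 : 0 ≤ G * ((1 + r) ^ 2 + v) ^ 2 := by positivity
  linarith

/-- The constant `15` is the one in `(1 + η)⁴ ≤ 1 + 15 η` for `η ≤ 1`. -/
theorem le_correction {G v η : ℝ} (hG : 0 ≤ G) (hv : 0 ≤ v) (hGη : G ≤ η) (hvη : v ≤ η)
    (hη : η ≤ 1) : 1 - 15 * η ≤ correction G v := by
  have hη0 : 0 ≤ η := hG.trans hGη
  have hr : 1 ≤ Real.sqrt (1 + G) := Real.one_le_sqrt.2 (by linarith)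
  have hr2 : Real.sqrt (1 + G) ^ 2 = 1 + G := Real.sq_sqrt (by linarith)
  rw [correction]
  set r := Real.sqrt (1 + G)
  set u := (1 + r) ^ 2 with hu
  have h1 : 4 ≤ u := by nlinarith
  have h2 : u ≤ 4 * (1 + η) := by nlinarith
  have h3 : u + v ≤ u * (1 + η) := by nlinarith
  have h4 : (1 + G) * (u + v) ^ 2 ≤ 4 * u * (1 + η) ^ 4 := by
    calc (1 + G) * (u + v) ^ 2 ≤ (1 + η) * (u * (1 + η)) ^ 2 := by
          gcongr
      _ = u * (u * (1 + η) ^ 3) := by ring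
      _ ≤ u * (4 * (1 + η) * (1 + η) ^ 3) := by gcongr
      _ = 4 * u * (1 + η) ^ 4 := by ring
  have h5 : (1 + η) ^ 4 ≤ 1 + 15 * η := by
    nlinarith [mul_nonneg hη0 (sub_nonneg.2 hη), mul_nonneg (sq_nonneg η) (sub_nonneg.2 hη),
      mul_nonneg (pow_nonneg hη0 3) (sub_nonneg.2 hη)]
  rw [le_div_iff₀ (by positivity)]
  have hZ : 0 < (1 + η) ^ 4 := by positivity
  rcases le_or_gt (1 - 15 * η) 0 with h | h
  · have : 0 ≤ (1 + G) * (u + v) ^ 2 := by positivity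
    nlinarith
  · calc (1 - 15 * η) * ((1 + G) * (u + v) ^ 2) ≤ (1 - 15 * η) * (4 * u * (1 + 15 * η)) := by
          refine mul_le_mul_of_nonneg_left (h4.trans ?_) h.le
          gcongr
      _ = 4 * u * (1 - (15 * η) ^ 2) := by ring
      _ ≤ 4 * u * 1 := by
          gcongr
          nlinarith
      _ = 4 * u := mul_one _

variable {x : ℝ}

theorem sin_cos_pos (hx0 : 0 < x) (hx : x < Real.pi / 2) : 0 < Real.sin x ∧ 0 < Real.cos x :=
  ⟨Real.sin_pos_of_pos_of_lt_pi hx0 (by linarith [Real.pi_pos]),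
    Real.cos_pos_of_mem_Ioo ⟨by linarith, hx⟩⟩

theorem sin_pi_sub_two_mul (x : ℝ) : Real.sin (Real.pi - 2 * x) = 2 * Real.sin x * Real.cos x := by
  rw [Real.sin_pi_sub, Real.sin_two_mul]

theorem one_add_cos_pi_sub_two_mul (x : ℝ) :
    1 + Real.cos (Real.pi - 2 * x) = 2 * Real.sin x ^ 2 := by
  rw [Real.cos_pi_sub, Real.cos_two_mul, Real.sin_sq]
  ring

theorem leadingCoeff_eq (hx0 : 0 < x) (hx : x < Real.pi / 2) :
    leadingCoeff (Real.pi - 2 * x) = Real.cos x ^ 2 / (4 * Real.sin x ^ 6) := by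
  have hs := (sin_cos_pos hx0 hx).1
  rw [leadingCoeff, sin_pi_sub_two_mul, one_add_cos_pi_sub_two_mul]
  field_simp
  ring

theorem leadingCoeff_nonneg (φ : ℝ) : 0 ≤ leadingCoeff φ := by
  rw [leadingCoeff]; positivity

theorem disp_eq (hx0 : 0 < x) (hx : x < Real.pi / 2) (g : ℝ) :
    disp g 1 (Real.pi - 2 * x) =
      2 * Real.sin x ^ 2 * Real.sqrt (1 + g * (Real.cos x / Real.sin x) ^ 2) := by
  have hs := (sin_cos_pos hx0 hx).1
  have hp : 0 ≤ 2 * Real.sin x ^ 2 := by positivity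
  rw [disp, one_add_cos_pi_sub_two_mul, sin_pi_sub_two_mul]
  conv_rhs => rw [← Real.sqrt_sq hp, ← Real.sqrt_mul (sq_nonneg _)]
  congr 1
  field_simp

theorem blockValue_eq {γ κ : ℝ} (hγ : 0 < γ) (hκ : 0 < κ) (hx0 : 0 < x) (hx : x < Real.pi / 2) :
    blockValue γ κ (Real.pi - 2 * x) = leadingCoeff (Real.pi - 2 * x) * κ ^ 2 *
      correction (κ * (2 * γ + κ) * (Real.cos x / Real.sin x) ^ 2)
        (κ ^ 2 * (Real.cos x / Real.sin x) ^ 2) := by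
  obtain ⟨hs, hc⟩ := sin_cos_pos hx0 hx
  rw [blockValue, disp_eq hx0 hx, one_add_cos_pi_sub_two_mul, sin_pi_sub_two_mul,
    leadingCoeff_eq hx0 hx, correction]
  have hG : 0 ≤ κ * (2 * γ + κ) * (Real.cos x / Real.sin x) ^ 2 := by positivity
  have hr2 := Real.sq_sqrt (show 0 ≤ 1 + κ * (2 * γ + κ) * (Real.cos x / Real.sin x) ^ 2 by
    linarith)
  have hr : 0 < Real.sqrt (1 + κ * (2 * γ + κ) * (Real.cos x / Real.sin x) ^ 2) :=
    Real.sqrt_pos.2 (by linarith)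
  rw [← hr2, Real.sqrt_sq hr.le]
  generalize Real.sqrt (1 + κ * (2 * γ + κ) * (Real.cos x / Real.sin x) ^ 2) = r at hr
  have h1 : (1 + r) ^ 2 + κ ^ 2 * (Real.cos x / Real.sin x) ^ 2 ≠ 0 := by positivity
  have h2 : (2 * Real.sin x ^ 2 + 2 * Real.sin x ^ 2 * r) ^ 2 +
      κ ^ 2 * (2 * Real.sin x * Real.cos x) ^ 2 =
      4 * Real.sin x ^ 4 * ((1 + r) ^ 2 + κ ^ 2 * (Real.cos x / Real.sin x) ^ 2) := by
    field_simp
    norm_num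
  rw [h2]
  generalize (1 + r) ^ 2 + κ ^ 2 * (Real.cos x / Real.sin x) ^ 2 = Q at h1
  field_simp
  ring

/-- Here `cot x = tan (φ/2)` at `φ = π - 2 x`. -/
theorem cot_le (hx0 : 0 < x) (hx : x < Real.pi / 2) : Real.cos x / Real.sin x ≤ 1 / x := by
  obtain ⟨hs, hc⟩ := sin_cos_pos hx0 hx
  have h := Real.lt_tan hx0 hx
  rw [Real.tan_eq_sin_div_cos, lt_div_iff₀ hc] at h
  rw [div_le_div_iff₀ hs hx0]
  linarith

theorem inv_sin_sq_le (hx0 : 0 < x) (hx : x < Real.pi / 2) :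
    1 / Real.sin x ^ 2 ≤ (Real.pi / (2 * x)) ^ 2 := by
  have h := Real.mul_le_sin hx0.le hx.le
  have hs := (sin_cos_pos hx0 hx).1
  rw [div_pow, div_le_div_iff₀ (by positivity) (by positivity), one_mul, ← mul_pow]
  refine pow_le_pow_left₀ (by positivity) ?_ 2
  have h2 := mul_le_mul_of_nonneg_left h Real.pi_pos.le
  have h3 : Real.pi * (2 / Real.pi * x) = 2 * x := by field_simp
  linarith

theorem leadingCoeff_le (hx0 : 0 < x) (hx : x < Real.pi / 2) :
    leadingCoeff (Real.pi - 2 * x) ≤ (Real.pi / (2 * x)) ^ 6 / 4 := by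
  have hs := (sin_cos_pos hx0 hx).1
  rw [leadingCoeff_eq hx0 hx]
  have h1 := pow_le_pow_left₀ (by positivity) (inv_sin_sq_le hx0 hx) 3
  have h2 : Real.cos x ^ 2 ≤ 1 := Real.cos_sq_le_one x
  calc Real.cos x ^ 2 / (4 * Real.sin x ^ 6) ≤ 1 / (4 * Real.sin x ^ 6) := by gcongr
    _ = (1 / Real.sin x ^ 2) ^ 3 / 4 := by field_simp
    _ ≤ ((Real.pi / (2 * x)) ^ 2) ^ 3 / 4 := by gcongr
    _ = (Real.pi / (2 * x)) ^ 6 / 4 := by rw [← pow_mul]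

theorem le_leadingCoeff (hx0 : 0 < x) (hx : x ≤ Real.pi / 4) :
    2 * (1 / (2 * x)) ^ 6 ≤ leadingCoeff (Real.pi - 2 * x) := by
  have hx' : x < Real.pi / 2 := by linarith [Real.pi_pos]
  have hs := (sin_cos_pos hx0 hx').1
  rw [leadingCoeff_eq hx0 hx']
  have h1 : Real.cos (Real.pi / 4) ≤ Real.cos x :=
    Real.cos_le_cos_of_nonneg_of_le_pi hx0.le (by linarith [Real.pi_pos]) hx
  rw [Real.cos_pi_div_four] at h1
  have h2 : 1 / 2 ≤ Real.cos x ^ 2 := by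
    have := pow_le_pow_left₀ (by positivity) h1 2
    rw [div_pow, Real.sq_sqrt (by norm_num)] at this
    linarith
  have h3 : Real.sin x ^ 6 ≤ x ^ 6 := pow_le_pow_left₀ hs.le (Real.sin_lt hx0).le 6
  calc 2 * (1 / (2 * x)) ^ 6 = (1 / 8) / (4 * x ^ 6) := by field_simp; norm_num
    _ ≤ Real.cos x ^ 2 / (4 * Real.sin x ^ 6) := by
        gcongr
        linarith

theorem blockValue_nonneg (γ κ φ : ℝ) : 0 ≤ blockValue γ κ φ := by
  rw [blockValue]; positivity

theorem blockValue_le {γ κ : ℝ} (hγ : 0 < γ) (hκ : 0 < κ) (hx0 : 0 < x) (hx : x < Real.pi / 2) :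
    blockValue γ κ (Real.pi - 2 * x) ≤ κ ^ 2 * leadingCoeff (Real.pi - 2 * x) := by
  rw [blockValue_eq hγ hκ hx0 hx]
  have h := correction_le_one
    (G := κ * (2 * γ + κ) * (Real.cos x / Real.sin x) ^ 2)
    (v := κ ^ 2 * (Real.cos x / Real.sin x) ^ 2) (by positivity) (by positivity)
  have h2 : 0 ≤ leadingCoeff (Real.pi - 2 * x) * κ ^ 2 :=
    mul_nonneg (leadingCoeff_nonneg _) (sq_nonneg κ)
  calc _ ≤ leadingCoeff (Real.pi - 2 * x) * κ ^ 2 * 1 := mul_le_mul_of_nonneg_left h h2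
    _ = _ := by ring

/-- At fixed `κ` the block information grows at most like `tan² (φ/2)`. -/
theorem blockValue_le' {γ κ : ℝ} (hγ : 0 < γ) (hκ : 0 < κ) (hx0 : 0 < x) (hx : x < Real.pi / 2) :
    blockValue γ κ (Real.pi - 2 * x) ≤
      4 * κ ^ 2 / min 1 (κ ^ 2) ^ 2 * (Real.pi / (2 * x)) ^ 2 := by
  obtain ⟨hs, hc⟩ := sin_cos_pos hx0 hx
  have hcs := Real.cos_sq_add_sin_sq x
  rw [blockValue_eq hγ hκ hx0 hx, leadingCoeff_eq hx0 hx, correction]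
  have hG : 0 ≤ κ * (2 * γ + κ) * (Real.cos x / Real.sin x) ^ 2 := by positivity
  have hr2 := Real.sq_sqrt (show 0 ≤ 1 + κ * (2 * γ + κ) * (Real.cos x / Real.sin x) ^ 2 by
    linarith)
  have hr : 1 ≤ Real.sqrt (1 + κ * (2 * γ + κ) * (Real.cos x / Real.sin x) ^ 2) :=
    Real.one_le_sqrt.2 (by linarith)
  rw [← hr2, Real.sqrt_sq (by linarith)]
  generalize Real.sqrt (1 + κ * (2 * γ + κ) * (Real.cos x / Real.sin x) ^ 2) = r at hr
  set μ := min 1 (κ ^ 2) with hμ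
  have hμ0 : 0 < μ := lt_min one_pos (by positivity)
  have h1 : μ / Real.sin x ^ 2 ≤ (1 + r) ^ 2 + κ ^ 2 * (Real.cos x / Real.sin x) ^ 2 := by
    have e : 1 / Real.sin x ^ 2 = 1 + (Real.cos x / Real.sin x) ^ 2 := by
      rw [div_pow]; field_simp; linarith
    have h2 : μ ≤ 1 := min_le_left _ _
    have h3 : μ ≤ κ ^ 2 := min_le_right _ _
    have h4 : (1 : ℝ) ≤ (1 + r) ^ 2 := by nlinarith
    have h5 := mul_le_mul_of_nonneg_right h3 (sq_nonneg (Real.cos x / Real.sin x))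
    calc μ / Real.sin x ^ 2 = μ + μ * (Real.cos x / Real.sin x) ^ 2 := by
          rw [div_eq_mul_one_div, e]; ring
      _ ≤ _ := by linarith
  have h2 : (1 + r) ^ 2 ≤ 4 * r ^ 2 := by nlinarith
  set Q := (1 + r) ^ 2 + κ ^ 2 * (Real.cos x / Real.sin x) ^ 2
  have hQ : (μ / Real.sin x ^ 2) ^ 2 ≤ Q ^ 2 := pow_le_pow_left₀ (by positivity) h1 2
  have hc1 : Real.cos x ^ 2 ≤ 1 := Real.cos_sq_le_one x
  have hr0 : 0 < r := by linarith
  calc Real.cos x ^ 2 / (4 * Real.sin x ^ 6) * κ ^ 2 * (4 * (1 + r) ^ 2 / (r ^ 2 * Q ^ 2))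
      ≤ 1 / (4 * Real.sin x ^ 6) * κ ^ 2 *
        (4 * (4 * r ^ 2) / (r ^ 2 * (μ / Real.sin x ^ 2) ^ 2)) := by gcongr
    _ = 4 * κ ^ 2 / μ ^ 2 * (1 / Real.sin x ^ 2) := by field_simp
    _ ≤ 4 * κ ^ 2 / μ ^ 2 * (Real.pi / (2 * x)) ^ 2 :=
        mul_le_mul_of_nonneg_left (inv_sin_sq_le hx0 hx) (by positivity)

end BlockValue

/-! ### The momenta of a chain of `2 M` spins -/

section Angles

/-- Half the distance from `π` to the momentum with index `M - q` of a chain of `2 M` spins. -/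
def angle (M q : ℕ) : ℝ := (2 * (q : ℝ) + 1) * Real.pi / (4 * (M : ℝ))

variable {M q p : ℕ}

theorem momentum_eq (hM : 1 ≤ M) (hp : p ≤ M) :
    momentum (2 * M) p = Real.pi - 2 * angle M (M - p) := by
  have hM0 : (M : ℝ) ≠ 0 := by positivity
  rw [momentum, angle, Nat.cast_sub hp]
  push_cast
  field_simp
  ring

theorem angle_pos (hM : 1 ≤ M) (q : ℕ) : 0 < angle M q := by
  rw [angle]
  have := Real.pi_pos
  positivity

theorem angle_lt (hq : q < M) : angle M q < Real.pi / 2 := by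
  have hM : (0 : ℝ) < M := by exact_mod_cast (Nat.zero_le q).trans_lt hq
  have h : (q : ℝ) + 1 ≤ M := by exact_mod_cast hq
  rw [angle, div_lt_div_iff₀ (by positivity) two_pos]
  nlinarith [Real.pi_pos]

theorem angle_zero_le (hM : 1 ≤ M) (q : ℕ) : angle M 0 ≤ angle M q := by
  have := Real.pi_pos
  rw [angle, angle]
  gcongr
  exact Nat.zero_le q

theorem two_mul_angle_zero (M : ℕ) : 2 * angle M 0 = Real.pi / ((2 * M : ℕ) : ℝ) := by
  rw [angle]
  push_cast
  rw [← mul_div_assoc, div_eq_div_iff_comm]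
  ring_nf

theorem pi_div_two_mul_angle (hM : 1 ≤ M) (q : ℕ) :
    Real.pi / (2 * angle M q) = ((2 * M : ℕ) : ℝ) * (1 / (2 * (q : ℝ) + 1)) := by
  have hM0 : (0 : ℝ) < M := by positivity
  have := Real.pi_pos
  rw [angle]
  push_cast
  field_simp
  ring

/-- The term `2 / (M + 1)` makes the induction telescope. -/
theorem sum_inv_odd_sq_le (M : ℕ) :
    ∑ q ∈ Finset.range M, (1 / (2 * (q : ℝ) + 1)) ^ 2 ≤ 3 - 2 / ((M : ℝ) + 1) := by
  induction M with
  | zero => norm_num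
  | succ n ih =>
    rw [Finset.sum_range_succ]
    refine (add_le_add_left ih _).trans ?_
    have h : (1 / (2 * (n : ℝ) + 1)) ^ 2 ≤ 2 / ((n : ℝ) + 1) - 2 / ((n : ℝ) + 1 + 1) := by
      have e : 2 / ((n : ℝ) + 1) - 2 / ((n : ℝ) + 1 + 1) =
          2 / (((n : ℝ) + 1) * ((n : ℝ) + 2)) := by
        field_simp
        ring
      rw [e, div_pow, div_le_div_iff₀ (by positivity) (by positivity)]
      nlinarith [(Nat.cast_nonneg n : (0 : ℝ) ≤ n)]
    push_cast
    linarith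

theorem sum_Icc_reflect (f : ℕ → ℝ) (M : ℕ) :
    ∑ p ∈ Finset.Icc 1 M, f (M - p) = ∑ q ∈ Finset.range M, f q := by
  refine Finset.sum_nbij' (fun p => M - p) (fun q => M - q) ?_ ?_ ?_ ?_ ?_ <;>
    simp only [Finset.mem_Icc, Finset.mem_range] <;> intros <;> first | omega | trivial

/-- A quantity bounded at each momentum by a power `k ≥ 2` of `π / (π - φ)` has a sum bounded by
that power of the number of spins: the last few momenta dominate. -/
theorem sum_momenta_le {f : ℝ → ℝ} {C : ℝ} {k : ℕ} (hC : 0 ≤ C) (hk : 2 ≤ k)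
    (hf : ∀ x, 0 < x → x < Real.pi / 2 → f (Real.pi - 2 * x) ≤ C * (Real.pi / (2 * x)) ^ k)
    (hM : 1 ≤ M) :
    ∑ p ∈ Finset.Icc 1 M, f (momentum (2 * M) p) ≤ 3 * C * ((2 * M : ℕ) : ℝ) ^ k := by
  calc ∑ p ∈ Finset.Icc 1 M, f (momentum (2 * M) p)
      = ∑ p ∈ Finset.Icc 1 M, f (Real.pi - 2 * angle M (M - p)) :=
        Finset.sum_congr rfl fun p hp => by rw [momentum_eq hM (Finset.mem_Icc.1 hp).2]
    _ = ∑ q ∈ Finset.range M, f (Real.pi - 2 * angle M q) :=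
        sum_Icc_reflect (fun q => f (Real.pi - 2 * angle M q)) M
    _ ≤ ∑ q ∈ Finset.range M, C * ((2 * M : ℕ) : ℝ) ^ k * (1 / (2 * (q : ℝ) + 1)) ^ 2 := by
        refine Finset.sum_le_sum fun q hq => ?_
        refine (hf _ (angle_pos hM q) (angle_lt (Finset.mem_range.1 hq))).trans ?_
        rw [pi_div_two_mul_angle hM, mul_pow, ← mul_assoc]
        refine mul_le_mul_of_nonneg_left ?_ (by positivity)
        refine pow_le_pow_of_le_one (by positivity) ?_ hk
        rw [div_le_one (by positivity)]
        linarith [(Nat.cast_nonneg q : (0 : ℝ) ≤ q)]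
    _ ≤ C * ((2 * M : ℕ) : ℝ) ^ k * 3 := by
        rw [← Finset.mul_sum]
        refine mul_le_mul_of_nonneg_left ((sum_inv_odd_sq_le M).trans ?_) (by positivity)
        have : 0 ≤ 2 / ((M : ℝ) + 1) := by positivity
        linarith
    _ = 3 * C * ((2 * M : ℕ) : ℝ) ^ k := by ring

end Angles

/-! ### The information of the chain and of its blocks -/

section Chain

variable {γ κ : ℝ} {M p : ℕ}

theorem sin_momentum_pos (hp : p ∈ Finset.Icc 1 M) : 0 < Real.sin (momentum (2 * M) p) := by
  obtain ⟨h1, h2⟩ := Finset.mem_Icc.1 hp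
  have hM := h1.trans h2
  have h := angle_pos hM (M - p)
  have h' : angle M (M - p) < Real.pi / 2 := angle_lt (by omega)
  rw [momentum_eq hM h2]
  exact Real.sin_pos_of_pos_of_lt_pi (by linarith) (by linarith)

theorem hasGroundQFI_blockQFI (hγ : 0 < γ) (hκ : 0 < κ) (hp : p ∈ Finset.Icc 1 M) :
    HasGroundQFI (fun h => blockHamiltonian (momentum (2 * M) p) h γ (γ + κ)) 1
      (blockQFI γ (2 * M) p κ) :=
  (hasGroundQFI_block hγ hκ (sin_momentum_pos hp)).hasGroundQFI_groundQFI

theorem blockQFI_eq (hγ : 0 < γ) (hκ : 0 < κ) (hp : p ∈ Finset.Icc 1 M) :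
    blockQFI γ (2 * M) p κ = blockValue γ κ (momentum (2 * M) p) :=
  (hasGroundQFI_block hγ hκ (sin_momentum_pos hp)).groundQFI_eq

theorem hasGroundQFI_chainQFI (hM : 1 ≤ M) (hγ : 0 < γ) (hκ : 0 < κ) :
    HasGroundQFI (fun h => chainHamiltonian (2 * M) h γ (γ + κ)) 1 (chainQFI γ (2 * M) κ) :=
  (hasGroundQFI_chain hM hγ hκ).hasGroundQFI_groundQFI

theorem chainQFI_eq (hM : 1 ≤ M) (hγ : 0 < γ) (hκ : 0 < κ) :
    chainQFI γ (2 * M) κ = ∑ p ∈ Finset.Icc 1 M, blockQFI γ (2 * M) p κ := by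
  rw [chainQFI, (hasGroundQFI_chain hM hγ hκ).groundQFI_eq,
    Finset.sum_congr rfl fun p hp => blockQFI_eq hγ hκ hp]
  refine Finset.sum_nbij' (fun p => p + 1) (fun p => p - 1) ?_ ?_ ?_ ?_ ?_
  any_goals simp only [Finset.mem_Icc, Finset.mem_range]; intros; omega
  intro p _
  congr 1
  rw [mom, momentum]
  push_cast
  ring

theorem blockQFI_nonneg (hγ : 0 < γ) (hκ : 0 < κ) (hp : p ∈ Finset.Icc 1 M) :
    0 ≤ blockQFI γ (2 * M) p κ := by
  rw [blockQFI_eq hγ hκ hp]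
  exact blockValue_nonneg _ _ _

theorem blockQFI_last_le_chainQFI (hM : 1 ≤ M) (hγ : 0 < γ) (hκ : 0 < κ) :
    blockQFI γ (2 * M) M κ ≤ chainQFI γ (2 * M) κ := by
  rw [chainQFI_eq hM hγ hκ]
  exact Finset.single_le_sum (f := fun p => blockQFI γ (2 * M) p κ)
    (fun p hp => blockQFI_nonneg hγ hκ hp) (Finset.mem_Icc.2 ⟨hM, le_rfl⟩)

theorem momentum_last (hM : 1 ≤ M) : momentum (2 * M) M = Real.pi - 2 * angle M 0 := by
  rw [momentum_eq hM le_rfl, Nat.sub_self]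

theorem chainQFI_le_sixth_power (hM : 1 ≤ M) (hγ : 0 < γ) (hκ : 0 < κ) :
    chainQFI γ (2 * M) κ ≤
      3 * Real.pi ^ 6 / 4 * κ ^ 2 * (((2 * M : ℕ) : ℝ) / Real.pi) ^ 6 := by
  rw [chainQFI_eq hM hγ hκ, Finset.sum_congr rfl fun p hp => blockQFI_eq hγ hκ hp]
  refine (sum_momenta_le (f := blockValue γ κ) (C := κ ^ 2 / 4) (k := 6) (by positivity)
    (by norm_num) (fun x hx0 hx => ?_) hM).trans_eq ?_
  · refine (blockValue_le hγ hκ hx0 hx).trans ?_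
    have := mul_le_mul_of_nonneg_left (leadingCoeff_le hx0 hx) (sq_nonneg κ)
    linarith
  · have := Real.pi_ne_zero
    field_simp

theorem sum_leadingCoeff_le (hM : 1 ≤ M) :
    ∑ p ∈ Finset.Icc 1 M, leadingCoeff (momentum (2 * M) p) ≤
      3 * Real.pi ^ 6 / 4 * (((2 * M : ℕ) : ℝ) / Real.pi) ^ 6 := by
  refine (sum_momenta_le (f := leadingCoeff) (C := 1 / 4) (k := 6) (by norm_num)
    (by norm_num) (fun x hx0 hx => ?_) hM).trans_eq ?_
  · refine (leadingCoeff_le hx0 hx).trans_eq (by ring)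
  · have := Real.pi_ne_zero
    field_simp

theorem le_leadingCoeff_last (hM : 1 ≤ M) :
    2 * (((2 * M : ℕ) : ℝ) / Real.pi) ^ 6 ≤ leadingCoeff (momentum (2 * M) M) := by
  have hle : angle M 0 ≤ Real.pi / 4 := by
    have hM1 : (1 : ℝ) ≤ M := by exact_mod_cast hM
    rw [angle, div_le_div_iff₀ (by positivity) (by norm_num)]
    push_cast
    nlinarith [Real.pi_pos]
  have h := le_leadingCoeff (angle_pos hM 0) hle
  rwa [two_mul_angle_zero, one_div_div, ← two_mul_angle_zero, ← momentum_last hM] at h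

theorem sum_leadingCoeff_isTheta :
    (fun m : ℕ => ∑ p ∈ Finset.Icc 1 m, leadingCoeff (momentum (2 * m) p))
      =Θ[atTop] (fun m : ℕ => (((2 * m : ℕ) : ℝ) / Real.pi) ^ 6) := by
  have hpi := Real.pi_pos
  constructor
  · refine IsBigO.of_bound (3 * Real.pi ^ 6 / 4) ?_
    filter_upwards [eventually_ge_atTop 1] with m hm
    rw [Real.norm_of_nonneg (Finset.sum_nonneg fun p _ => leadingCoeff_nonneg _),
      Real.norm_of_nonneg (by positivity)]
    exact sum_leadingCoeff_le hm
  · refine IsBigO.of_bound 1 ?_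
    filter_upwards [eventually_ge_atTop 1] with m hm
    rw [Real.norm_of_nonneg (Finset.sum_nonneg fun p _ => leadingCoeff_nonneg _),
      Real.norm_of_nonneg (by positivity), one_mul]
    have h0 : 0 ≤ (((2 * m : ℕ) : ℝ) / Real.pi) ^ 6 := by positivity
    have h1 := Finset.single_le_sum (f := fun p => leadingCoeff (momentum (2 * m) p))
      (fun p _ => leadingCoeff_nonneg _) (Finset.mem_Icc.2 ⟨hm, le_rfl⟩)
    have h2 := le_leadingCoeff_last hm
    linarith

theorem tendsto_angle_zero : Tendsto (fun m : ℕ => angle m 0) atTop (𝓝 0) := by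
  have h := tendsto_const_div_atTop_nhds_zero_nat (Real.pi / 4)
  refine h.congr fun m => ?_
  rw [angle]
  push_cast
  ring

theorem tendsto_leadingCoeff_last :
    Tendsto (fun m : ℕ => leadingCoeff (momentum (2 * m) m) /
      (((2 * m : ℕ) : ℝ) / Real.pi) ^ 6) atTop (𝓝 16) := by
  have hlim : Tendsto (fun x : ℝ => 16 * Real.cos x ^ 2 / Real.sinc x ^ 6) (𝓝 0) (𝓝 16) := by
    have hc : ContinuousAt (fun x : ℝ => 16 * Real.cos x ^ 2 / Real.sinc x ^ 6) 0 := by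
      refine ContinuousAt.div (by fun_prop) (Real.continuous_sinc.pow 6).continuousAt (by simp)
    simpa [ContinuousAt] using hc
  refine (hlim.comp tendsto_angle_zero).congr' ?_
  filter_upwards [eventually_ge_atTop 1] with m hm
  have hx0 := angle_pos hm 0
  have hx := angle_lt (q := 0) (M := m) (by omega)
  have hs := (sin_cos_pos hx0 hx).1
  rw [momentum_last hm, leadingCoeff_eq hx0 hx, Function.comp_apply, Real.sinc_of_ne_zero hx0.ne',
    ← one_div_div Real.pi, ← two_mul_angle_zero]
  field_simp
  ring

theorem leadingCoeff_le_last (hp : p ∈ Finset.Icc 1 M) :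
    leadingCoeff (momentum (2 * M) p) ≤ leadingCoeff (momentum (2 * M) M) := by
  obtain ⟨h1, h2⟩ := Finset.mem_Icc.1 hp
  have hM := h1.trans h2
  have hx0 := angle_pos hM 0
  have hle := angle_zero_le hM (M - p)
  have hx : angle M (M - p) < Real.pi / 2 := angle_lt (by omega)
  have hpi := Real.pi_pos
  rw [momentum_last hM, momentum_eq hM h2, leadingCoeff_eq hx0 (by linarith),
    leadingCoeff_eq (hx0.trans_le hle) hx]
  have hs := (sin_cos_pos hx0 (by linarith)).1
  have hc := (sin_cos_pos (hx0.trans_le hle) hx).2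
  have h3 : Real.sin (angle M 0) ≤ Real.sin (angle M (M - p)) :=
    Real.sin_le_sin_of_le_of_le_pi_div_two (by linarith) hx.le hle
  have h4 : Real.cos (angle M (M - p)) ≤ Real.cos (angle M 0) :=
    Real.cos_le_cos_of_nonneg_of_le_pi hx0.le (by linarith) hle
  gcongr

theorem abs_pi_sub_momentum_le (hp : p ∈ Finset.Icc 1 M) :
    |Real.pi - momentum (2 * M) M| ≤ |Real.pi - momentum (2 * M) p| := by
  obtain ⟨h1, h2⟩ := Finset.mem_Icc.1 hp
  have hM := h1.trans h2
  have hx0 := angle_pos hM 0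
  have hle := angle_zero_le hM (M - p)
  rw [momentum_last hM, momentum_eq hM h2, sub_sub_cancel, sub_sub_cancel,
    abs_of_nonneg (by linarith), abs_of_nonneg (by linarith)]
  linarith

theorem blockQFI_sub_isBigO (hγ : 0 < γ) (hp : p ∈ Finset.Icc 1 M) :
    (fun κ : ℝ => blockQFI γ (2 * M) p κ - leadingCoeff (momentum (2 * M) p) * κ ^ 2)
      =O[𝓝[>] 0] fun κ : ℝ => κ ^ 3 := by
  obtain ⟨h1, h2⟩ := Finset.mem_Icc.1 hp
  have hM := h1.trans h2
  have hx0 := angle_pos hM (M - p)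
  have hx : angle M (M - p) < Real.pi / 2 := angle_lt (by omega)
  obtain ⟨x, hxe⟩ : ∃ x, angle M (M - p) = x := ⟨_, rfl⟩
  have hφ := momentum_eq hM h2
  rw [hxe] at hx0 hx hφ
  obtain ⟨hs, hc⟩ := sin_cos_pos hx0 hx
  set D := (2 * γ + 1) * (Real.cos x / Real.sin x) ^ 2 with hD
  have hD0 : 0 < D := by positivity
  refine IsBigO.of_bound (leadingCoeff (momentum (2 * M) p) * (15 * D)) ?_
  have hev : ∀ᶠ κ : ℝ in 𝓝[>] 0, κ < min 1 (1 / D) :=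
    (eventually_lt_nhds (lt_min one_pos (by positivity))).filter_mono nhdsWithin_le_nhds
  filter_upwards [hev, self_mem_nhdsWithin] with κ hκ1 hκ
  have hκ : 0 < κ := hκ
  obtain ⟨hκ1, hκD⟩ := lt_min_iff.1 hκ1
  have hDκ : D * κ ≤ 1 := by
    rw [lt_div_iff₀ hD0] at hκD
    linarith
  set t := (Real.cos x / Real.sin x) ^ 2 with ht
  have ht0 : 0 < t := by positivity
  have hκt : 0 ≤ κ * t := by positivity
  have hG : κ * (2 * γ + κ) * t ≤ D * κ := by
    rw [hD]
    nlinarith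
  have hv : κ ^ 2 * t ≤ D * κ := by
    rw [hD]
    nlinarith
  have hlo := le_correction (by positivity) (by positivity) hG hv hDκ
  have hhi := correction_le_one (G := κ * (2 * γ + κ) * t) (v := κ ^ 2 * t) (by positivity)
    (by positivity)
  rw [blockQFI_eq hγ hκ hp, hφ, blockValue_eq hγ hκ hx0 hx, ← ht]
  have hL := leadingCoeff_nonneg (Real.pi - 2 * x)
  rw [Real.norm_of_nonneg (pow_pos hκ 3).le, Real.norm_eq_abs,
    show ∀ c : ℝ, leadingCoeff (Real.pi - 2 * x) * κ ^ 2 * c -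
      leadingCoeff (Real.pi - 2 * x) * κ ^ 2 = leadingCoeff (Real.pi - 2 * x) * κ ^ 2 * (c - 1)
      from fun c => by ring, abs_mul, abs_of_nonneg (by positivity : 0 ≤
      leadingCoeff (Real.pi - 2 * x) * κ ^ 2)]
  calc _ ≤ leadingCoeff (Real.pi - 2 * x) * κ ^ 2 * (15 * (D * κ)) := by
        refine mul_le_mul_of_nonneg_left ?_ (by positivity)
        rw [abs_le]
        constructor <;> linarith
    _ = _ := by ring

theorem chainQFI_sub_isBigO (hM : 1 ≤ M) (hγ : 0 < γ) :
    (fun κ : ℝ => chainQFI γ (2 * M) κ -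
      (∑ p ∈ Finset.Icc 1 M, leadingCoeff (momentum (2 * M) p)) * κ ^ 2)
      =O[𝓝[>] 0] fun κ : ℝ => κ ^ 3 := by
  have h := IsBigO.sum fun p (hp : p ∈ Finset.Icc 1 M) => blockQFI_sub_isBigO hγ hp
  refine h.congr' ?_ EventuallyEq.rfl
  filter_upwards [self_mem_nhdsWithin] with κ hκ
  rw [chainQFI_eq hM hγ hκ, Finset.sum_mul, Finset.sum_apply, Finset.sum_sub_distrib]

/-! ### Uniform bounds for moderate sizes -/

/-- If `κ` is small compared with the squared distance of the last momentum to `π`, the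
information of the last block is close to its leading order. With `τ ≤ 2 N / π` and `κ ≤ 3`, the
denominator `8 γ + 12 = 4 (2 γ + 3)` makes both `κ (2γ + κ) τ²` and `κ² τ²` at most `η`. -/
theorem exists_correction (hγ : 0 < γ) {η : ℝ} (hη0 : 0 < η) (hη : η ≤ 1) (hM : 1 ≤ M)
    (hκ : 0 < κ) (hκη : κ ≤ η / (8 * γ + 12) * (Real.pi / ((2 * M : ℕ) : ℝ)) ^ 2) :
    ∃ c, 1 - 15 * η ≤ c ∧ c ≤ 1 ∧
      blockQFI γ (2 * M) M κ = leadingCoeff (momentum (2 * M) M) * κ ^ 2 * c := by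
  have hx0 := angle_pos hM 0
  have hx := angle_lt (q := 0) (M := M) (by omega)
  have hcot := cot_le hx0 hx
  obtain ⟨hs, hc⟩ := sin_cos_pos hx0 hx
  rw [← two_mul_angle_zero] at hκη
  rw [blockQFI_eq hγ hκ (Finset.mem_Icc.2 ⟨hM, le_rfl⟩), momentum_last hM,
    blockValue_eq hγ hκ hx0 hx]
  generalize angle M 0 = x at *
  have hd : 0 < 8 * γ + 12 := by linarith
  have ht : (Real.cos x / Real.sin x) ^ 2 ≤ (1 / x) ^ 2 :=
    pow_le_pow_left₀ (by positivity) hcot 2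
  have hκt : κ * (Real.cos x / Real.sin x) ^ 2 ≤ 4 * (η / (8 * γ + 12)) := by
    calc κ * (Real.cos x / Real.sin x) ^ 2
        ≤ (η / (8 * γ + 12) * (2 * x) ^ 2) * (1 / x) ^ 2 := by gcongr
      _ = 4 * (η / (8 * γ + 12)) := by
          field_simp
          norm_num
  have hκ3 : κ ≤ 3 := by
    have h1 : (2 * x) ^ 2 ≤ 16 := by
      have := Real.pi_lt_four
      nlinarith
    have h2 : η / (8 * γ + 12) ≤ 1 / 12 := by
      rw [div_le_div_iff₀ hd (by norm_num)]
      nlinarith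
    have h3 : 0 ≤ η / (8 * γ + 12) := by positivity
    nlinarith
  have he : (2 * γ + 3) * (4 * (η / (8 * γ + 12))) = η := by
    field_simp
    ring
  have h0 : 0 ≤ κ * (Real.cos x / Real.sin x) ^ 2 := by positivity
  set t := (Real.cos x / Real.sin x) ^ 2
  have h1 : (2 * γ + κ) * (κ * t) ≤ η := by
    rw [← he]
    exact mul_le_mul (by linarith) hκt h0 (by linarith)
  have h2 : κ * (κ * t) ≤ η := by nlinarith
  refine ⟨_, le_correction (by positivity) (by positivity) ?_ ?_ hη,
    correction_le_one (by positivity) (by positivity), rfl⟩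
  · linarith
  · linarith

theorem exists_moderate_size_ratio (hγ : 0 < γ) {ε : ℝ} (hε : 0 < ε) :
    ∃ c : ℝ, 0 < c ∧ ∃ N₀ : ℕ, ∀ M : ℕ, 1 ≤ M → N₀ ≤ 2 * M → ∀ κ : ℝ, 0 < κ →
      κ ≤ c * (Real.pi / ((2 * M : ℕ) : ℝ)) ^ 2 →
        |blockQFI γ (2 * M) M κ / (16 * κ ^ 2 * (((2 * M : ℕ) : ℝ) / Real.pi) ^ 6) - 1| ≤ ε := by
  -- The correction is within `15 η ≤ ε / 4` of `1`, and it is multiplied by a ratio `ρ ≤ 2`.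
  set η := min 1 (ε / 60) with hη
  have hη0 : 0 < η := lt_min one_pos (by positivity)
  have hηε : η ≤ ε / 60 := min_le_right _ _
  have hη1 : η ≤ 1 := min_le_left _ _
  have hlim := tendsto_leadingCoeff_last.div_const 16
  rw [div_self (by norm_num)] at hlim
  obtain ⟨N₀, hN₀⟩ := (Metric.tendsto_atTop.1 hlim) (min 1 (ε / 2))
    (lt_min one_pos (by positivity))
  refine ⟨η / (8 * γ + 12), by positivity, 2 * N₀, fun M hM hN κ hκ hκη => ?_⟩
  obtain ⟨c, hc1, hc2, hc⟩ := exists_correction hγ hη0 hη1 hM hκ hκη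
  have h := hN₀ M (by omega)
  rw [Real.dist_eq] at h
  have hpi := Real.pi_pos
  have hN0 : 0 < ((2 * M : ℕ) : ℝ) := by positivity
  set ρ := leadingCoeff (momentum (2 * M) M) / (((2 * M : ℕ) : ℝ) / Real.pi) ^ 6 / 16 with hρ
  have e : blockQFI γ (2 * M) M κ / (16 * κ ^ 2 * (((2 * M : ℕ) : ℝ) / Real.pi) ^ 6) =
      ρ * c := by
    rw [hc, hρ]
    field_simp
  obtain ⟨h1, h2⟩ := lt_min_iff.1 h
  have hρ1 : |ρ| ≤ 2 := by
    have := abs_lt.1 h1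
    rw [abs_le]
    constructor <;> linarith
  have hc3 : |c - 1| ≤ ε / 4 := by
    rw [abs_le]
    constructor <;> linarith
  rw [e, show ρ * c - 1 = ρ * (c - 1) + (ρ - 1) by ring]
  calc |ρ * (c - 1) + (ρ - 1)| ≤ |ρ| * |c - 1| + |ρ - 1| := by
        rw [← abs_mul]
        exact abs_add_le _ _
    _ ≤ 2 * (ε / 4) + ε / 2 := by gcongr
    _ = ε := by ring

theorem exists_moderate_size_bounds (hγ : 0 < γ) :
    ∃ c C₁ C₂ : ℝ, 0 < c ∧ 0 < C₁ ∧ 0 < C₂ ∧ ∀ M : ℕ, 1 ≤ M → ∀ κ : ℝ, 0 < κ →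
      κ ≤ c * (Real.pi / ((2 * M : ℕ) : ℝ)) ^ 2 →
        C₁ * κ ^ 2 * (((2 * M : ℕ) : ℝ) / Real.pi) ^ 6 ≤ chainQFI γ (2 * M) κ ∧
        chainQFI γ (2 * M) κ ≤ C₂ * κ ^ 2 * (((2 * M : ℕ) : ℝ) / Real.pi) ^ 6 := by
  have hpi := Real.pi_pos
  refine ⟨1 / 30 / (8 * γ + 12), 1, 3 * Real.pi ^ 6 / 4, by positivity, one_pos, by positivity,
    fun M hM κ hκ hκη => ⟨?_, chainQFI_le_sixth_power hM hγ hκ⟩⟩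
  obtain ⟨c, hc1, -, hc⟩ := exists_correction hγ (by norm_num) (by norm_num) hM hκ hκη
  refine le_trans ?_ (blockQFI_last_le_chainQFI hM hγ hκ)
  rw [hc]
  have h1 := le_leadingCoeff_last hM
  have h2 : 0 ≤ (((2 * M : ℕ) : ℝ) / Real.pi) ^ 6 := by positivity
  calc 1 * κ ^ 2 * (((2 * M : ℕ) : ℝ) / Real.pi) ^ 6
      = 2 * (((2 * M : ℕ) : ℝ) / Real.pi) ^ 6 * κ ^ 2 * (1 / 2) := by ring
    _ ≤ leadingCoeff (momentum (2 * M) M) * κ ^ 2 * c := by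
        have h3 : 1 / 2 ≤ c := by linarith
        gcongr
        exact mul_nonneg (leadingCoeff_nonneg _) (sq_nonneg κ)

end Chain

/-! ### The thermodynamic limit -/

section Thermodynamic

variable {γ κ x : ℝ}

/-- The block information divided by `τ²`, as a function of `u = 1 / τ`, where `τ = tan (φ/2)` and
`g = κ (2γ + κ)`. It is smooth at `u = 0`, the momentum `π`. -/
def scaledBlockValue (κ g u : ℝ) : ℝ :=
  κ ^ 2 * (1 + u ^ 2) ^ 2 * (u + Real.sqrt (u ^ 2 + g)) ^ 2 /
    ((u ^ 2 + g) * ((u + Real.sqrt (u ^ 2 + g)) ^ 2 + κ ^ 2) ^ 2)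

theorem scaledBlockValue_zero (hγ : 0 < γ) (hκ : 0 < κ) :
    scaledBlockValue κ (κ * (2 * γ + κ)) 0 = 1 / (4 * (γ + κ) ^ 2) := by
  have hg : 0 < κ * (2 * γ + κ) := by positivity
  have e : κ * (2 * γ + κ) + κ ^ 2 = 2 * κ * (γ + κ) := by ring
  have h : Real.sqrt (κ * (2 * γ + κ)) ^ 2 = κ * (2 * γ + κ) := Real.sq_sqrt hg.le
  rw [scaledBlockValue]
  simp only [ne_eq, OfNat.ofNat_ne_zero, not_false_eq_true, zero_pow, zero_add, add_zero, one_pow,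
    mul_one, h, e]
  field_simp
  norm_num

theorem differentiableAt_scaledBlockValue {g : ℝ} (hg : 0 < g) :
    DifferentiableAt ℝ (scaledBlockValue κ g) 0 := by
  have hr : DifferentiableAt ℝ (fun u : ℝ => Real.sqrt (u ^ 2 + g)) 0 :=
    DifferentiableAt.sqrt (by fun_prop) (by simp [hg.ne'])
  unfold scaledBlockValue
  refine DifferentiableAt.div (by fun_prop) (by fun_prop) ?_
  have : 0 < Real.sqrt g := Real.sqrt_pos.2 hg
  simp only [ne_eq, OfNat.ofNat_ne_zero, not_false_eq_true, zero_pow, zero_add]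
  positivity

theorem blockValue_eq_scaledBlockValue (hγ : 0 < γ) (hκ : 0 < κ) (hx0 : 0 < x)
    (hx : x < Real.pi / 2) :
    blockValue γ κ (Real.pi - 2 * x) =
      scaledBlockValue κ (κ * (2 * γ + κ)) (Real.tan x) / Real.tan x ^ 2 := by
  obtain ⟨hs, hc⟩ := sin_cos_pos hx0 hx
  have ht : 0 < Real.tan x := Real.tan_pos_of_pos_of_lt_pi_div_two hx0 hx
  have hg : 0 < κ * (2 * γ + κ) := by positivity
  have hL : leadingCoeff (Real.pi - 2 * x) =
      (1 + Real.tan x ^ 2) ^ 2 / (4 * Real.tan x ^ 6) := by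
    rw [leadingCoeff_eq hx0 hx, Real.tan_eq_sin_div_cos]
    have h1 : 1 + (Real.sin x / Real.cos x) ^ 2 = 1 / Real.cos x ^ 2 := by
      field_simp
      linarith [Real.sin_sq_add_cos_sq x]
    rw [h1]
    field_simp
  have hcot : Real.cos x / Real.sin x = 1 / Real.tan x := by
    rw [Real.tan_eq_sin_div_cos, one_div_div]
  rw [blockValue_eq hγ hκ hx0 hx, hL, hcot, correction, scaledBlockValue]
  generalize Real.tan x = u at *
  generalize κ * (2 * γ + κ) = g at *
  have hsq : Real.sqrt (1 + g * (1 / u) ^ 2) = Real.sqrt (u ^ 2 + g) / u := by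
    rw [← Real.sqrt_sq ht.le, ← Real.sqrt_div' _ (sq_nonneg _), Real.sqrt_sq ht.le]
    congr 1
    field_simp
  rw [hsq]
  have hr0 : 0 < Real.sqrt (u ^ 2 + g) := Real.sqrt_pos.2 (by positivity)
  generalize Real.sqrt (u ^ 2 + g) = r at *
  have e1 : 1 + r / u = (u + r) / u := by field_simp
  have e2 : 1 + g * (1 / u) ^ 2 = (u ^ 2 + g) / u ^ 2 := by field_simp
  have e3 : ((u + r) / u) ^ 2 + κ ^ 2 * (1 / u) ^ 2 = ((u + r) ^ 2 + κ ^ 2) / u ^ 2 := by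
    field_simp
  rw [e1, e2, e3]
  have h1 : u + r ≠ 0 := by positivity
  have h2 : (u + r) ^ 2 + κ ^ 2 ≠ 0 := by positivity
  have h3 : u ^ 2 + g ≠ 0 := by positivity
  generalize (u + r) ^ 2 + κ ^ 2 = Q at *
  generalize u ^ 2 + g = P at *
  field_simp

theorem abs_inv_tan_sq_sub_le (hx0 : 0 < x) (hx : x < Real.pi / 2) :
    |1 / Real.tan x ^ 2 - 1 / x ^ 2| ≤ 1 := by
  obtain ⟨hs, hc⟩ := sin_cos_pos hx0 hx
  have ht : 0 < Real.tan x := Real.tan_pos_of_pos_of_lt_pi_div_two hx0 hx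
  have h1 : 1 / Real.tan x ^ 2 ≤ 1 / x ^ 2 :=
    one_div_le_one_div_of_le (by positivity)
      (pow_le_pow_left₀ hx0.le (Real.lt_tan hx0 hx).le 2)
  have h2 : 1 / x ^ 2 ≤ 1 / Real.sin x ^ 2 :=
    one_div_le_one_div_of_le (by positivity) (pow_le_pow_left₀ hs.le (Real.sin_lt hx0).le 2)
  have h3 : 1 / Real.sin x ^ 2 = 1 + 1 / Real.tan x ^ 2 := by
    rw [Real.tan_eq_sin_div_cos]
    field_simp
    linarith [Real.sin_sq_add_cos_sq x]
  rw [abs_le]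
  constructor <;> linarith

theorem blockQFI_last_sub_isBigO (hγ : 0 < γ) (hκ : 0 < κ) :
    (fun m : ℕ => blockQFI γ (2 * m) m κ
        - 1 / (γ + κ) ^ 2 * (((2 * m : ℕ) : ℝ) / Real.pi) ^ 2)
      =O[atTop] (fun m : ℕ => ((2 * m : ℕ) : ℝ)) := by
  have hpi := Real.pi_pos
  have hg : 0 < κ * (2 * γ + κ) := by positivity
  have hW := (differentiableAt_scaledBlockValue (κ := κ) hg).isBigO_sub
  rw [scaledBlockValue_zero hγ hκ] at hW
  obtain ⟨C, hC⟩ := hW.bound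
  have htan : Tendsto (fun m : ℕ => Real.tan (angle m 0)) atTop (𝓝 0) := by
    have h0 : ContinuousAt Real.tan 0 := Real.continuousAt_tan.2 (by simp)
    have h1 : Tendsto Real.tan (𝓝 0) (𝓝 0) := by simpa [ContinuousAt] using h0
    exact h1.comp tendsto_angle_zero
  set w := 1 / (4 * (γ + κ) ^ 2) with hw
  have hw0 : 0 < w := by positivity
  refine IsBigO.of_bound (max C 0 + w) ?_
  filter_upwards [htan.eventually hC, eventually_ge_atTop 1] with m hm hM
  have hx0 := angle_pos hM 0
  have hx := angle_lt (q := 0) (M := m) (by omega)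
  have hN : 1 ≤ ((2 * m : ℕ) : ℝ) := by exact_mod_cast (by omega : 1 ≤ 2 * m)
  have hangle := two_mul_angle_zero m
  rw [blockQFI_eq hγ hκ (Finset.mem_Icc.2 ⟨hM, le_rfl⟩), momentum_last hM,
    blockValue_eq_scaledBlockValue hγ hκ hx0 hx]
  generalize angle m 0 = x at *
  have hxtan := Real.lt_tan hx0 hx
  have htan2 := abs_inv_tan_sq_sub_le hx0 hx
  have hNx : 1 / x = 2 * (((2 * m : ℕ) : ℝ) / Real.pi) := by
    rw [← one_div_div Real.pi, ← hangle]
    field_simp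
  have hlead : 1 / (γ + κ) ^ 2 * (((2 * m : ℕ) : ℝ) / Real.pi) ^ 2 = w * (1 / x ^ 2) := by
    rw [← one_div_pow x, hNx, hw]
    field_simp
    norm_num
  have hxN : 1 / x ≤ ((2 * m : ℕ) : ℝ) := by
    rw [hNx, ← mul_div_assoc, div_le_iff₀ hpi]
    nlinarith [Real.pi_gt_three]
  generalize ((2 * m : ℕ) : ℝ) = n at *
  rw [hlead, Real.norm_of_nonneg (by linarith : 0 ≤ n), Real.norm_eq_abs]
  generalize scaledBlockValue κ (κ * (2 * γ + κ)) (Real.tan x) = W at *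
  rw [sub_zero, Real.norm_eq_abs, Real.norm_eq_abs] at hm
  generalize Real.tan x = u at *
  have hu : 0 < u := hx0.trans hxtan
  rw [abs_of_pos hu] at hm
  have h1 : |(W - w) / u ^ 2| ≤ max C 0 * n := by
    rw [abs_div, abs_of_nonneg (sq_nonneg u)]
    calc |W - w| / u ^ 2 ≤ max C 0 * u / u ^ 2 := by
          gcongr
          exact hm.trans (mul_le_mul_of_nonneg_right (le_max_left _ _) hu.le)
      _ = max C 0 * (1 / u) := by field_simp
      _ ≤ max C 0 * n := by
          refine mul_le_mul_of_nonneg_left ?_ (le_max_right _ _)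
          exact (one_div_le_one_div_of_le hx0 hxtan.le).trans hxN
  have h2 : |w * (1 / u ^ 2 - 1 / x ^ 2)| ≤ w * n := by
    rw [abs_mul, abs_of_pos hw0]
    exact mul_le_mul_of_nonneg_left (htan2.trans hN) hw0.le
  rw [show W / u ^ 2 - w * (1 / x ^ 2) = (W - w) / u ^ 2 + w * (1 / u ^ 2 - 1 / x ^ 2) by ring]
  refine (abs_add_le _ _).trans ?_
  linarith

theorem chainQFI_isTheta (hγ : 0 < γ) (hκ : 0 < κ) :
    (fun m : ℕ => chainQFI γ (2 * m) κ) =Θ[atTop] (fun m : ℕ => ((2 * m : ℕ) : ℝ) ^ 2) := by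
  have hpi := Real.pi_pos
  have hmono : Tendsto (fun m : ℕ => ((2 * m : ℕ) : ℝ)) atTop atTop :=
    tendsto_natCast_atTop_atTop.comp
      (tendsto_id.const_mul_atTop' (by norm_num : 0 < 2))
  constructor
  · refine IsBigO.of_bound (3 * (4 * κ ^ 2 / min 1 (κ ^ 2) ^ 2)) ?_
    filter_upwards [eventually_ge_atTop 1] with m hm
    rw [Real.norm_of_nonneg ((blockQFI_nonneg hγ hκ (Finset.mem_Icc.2 ⟨hm, le_rfl⟩)).trans
      (blockQFI_last_le_chainQFI hm hγ hκ)), Real.norm_of_nonneg (by positivity),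
      chainQFI_eq hm hγ hκ, Finset.sum_congr rfl fun p hp => blockQFI_eq hγ hκ hp]
    exact sum_momenta_le (f := blockValue γ κ) (by positivity) le_rfl
      (fun x hx0 hx => blockValue_le' hγ hκ hx0 hx) hm
  · -- The last block alone is equivalent to a positive multiple of `N²`.
    set w := 1 / (γ + κ) ^ 2 / Real.pi ^ 2 with hw
    have hw0 : 0 < w := by positivity
    obtain ⟨C, hC⟩ := (blockQFI_last_sub_isBigO hγ hκ).bound
    refine IsBigO.of_bound (2 / w) ?_
    filter_upwards [hC, eventually_ge_atTop 1, hmono.eventually_ge_atTop (2 * C / w)] with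
      m hm hM hN
    have hle := blockQFI_last_le_chainQFI hM hγ hκ
    have hnn := blockQFI_nonneg hγ hκ (Finset.mem_Icc.2 ⟨hM, le_rfl⟩)
    have hn0 : 0 ≤ ((2 * m : ℕ) : ℝ) := Nat.cast_nonneg _
    rw [show 1 / (γ + κ) ^ 2 * (((2 * m : ℕ) : ℝ) / Real.pi) ^ 2 = w * ((2 * m : ℕ) : ℝ) ^ 2 by
      rw [hw]; field_simp] at hm
    rw [Real.norm_of_nonneg (hnn.trans hle), Real.norm_of_nonneg (by positivity)]
    generalize ((2 * m : ℕ) : ℝ) = n at *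
    rw [Real.norm_of_nonneg hn0, Real.norm_eq_abs] at hm
    have h1 := (abs_le.1 hm).1
    rw [div_le_iff₀ hw0] at hN
    have h2 := mul_le_mul_of_nonneg_right hN hn0
    rw [div_mul_eq_mul_div, le_div_iff₀ hw0]
    nlinarith

end Thermodynamic

end IKSEA

end

open IKSEA in
theorem mainTheorem2 (γ : ℝ) (hγ : 0 < γ) :
    -- the quantum Fisher information is well defined and is the sum over the momentum blocks
    (∀ N : ℕ, Even N → 2 ≤ N → ∀ κ : ℝ, 0 < κ →
      HasGroundQFI (fun h => chainHamiltonian N h γ (γ + κ)) 1 (chainQFI γ N κ) ∧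
      (∀ p ∈ Finset.Icc 1 (N / 2),
        HasGroundQFI (fun h => blockHamiltonian (momentum N p) h γ (γ + κ)) 1
          (blockQFI γ N p κ)) ∧
      chainQFI γ N κ = ∑ p ∈ Finset.Icc 1 (N / 2), blockQFI γ N p κ) ∧
    -- finite `N`, `κ → 0⁺`: leading order; the largest coefficient is at the momentum nearest `π`
    (∀ N : ℕ, Even N → 2 ≤ N →
      momentum N (N / 2) = Real.pi - Real.pi / N ∧
      (∀ p ∈ Finset.Icc 1 (N / 2),
        |Real.pi - momentum N (N / 2)| ≤ |Real.pi - momentum N p| ∧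
        leadingCoeff (momentum N p) ≤ leadingCoeff (momentum N (N / 2)) ∧
        (fun κ : ℝ => blockQFI γ N p κ - leadingCoeff (momentum N p) * κ ^ 2)
          =O[𝓝[>] 0] fun κ : ℝ => κ ^ 3) ∧
      (fun κ : ℝ => chainQFI γ N κ
          - (∑ p ∈ Finset.Icc 1 (N / 2), leadingCoeff (momentum N p)) * κ ^ 2)
        =O[𝓝[>] 0] fun κ : ℝ => κ ^ 3) ∧
    -- the leading coefficients scale as `(N/π)⁶`
    Tendsto (fun m : ℕ => leadingCoeff (momentum (2 * m) m) / (((2 * m : ℕ) : ℝ) / Real.pi) ^ 6)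
      atTop (𝓝 16) ∧
    (fun m : ℕ => ∑ p ∈ Finset.Icc 1 m, leadingCoeff (momentum (2 * m) p))
      =Θ[atTop] (fun m : ℕ => (((2 * m : ℕ) : ℝ) / Real.pi) ^ 6) ∧
    -- super-Heisenberg scaling for moderate sizes, uniformly in `N` and `κ`
    (∀ ε : ℝ, 0 < ε → ∃ c : ℝ, 0 < c ∧ ∃ N₀ : ℕ, ∀ N : ℕ, Even N → 2 ≤ N → N₀ ≤ N →
      ∀ κ : ℝ, 0 < κ → κ ≤ c * (Real.pi / N) ^ 2 →
        |blockQFI γ N (N / 2) κ / (16 * κ ^ 2 * ((N : ℝ) / Real.pi) ^ 6) - 1| ≤ ε) ∧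
    (∃ c C₁ C₂ : ℝ, 0 < c ∧ 0 < C₁ ∧ 0 < C₂ ∧ ∀ N : ℕ, Even N → 2 ≤ N →
      ∀ κ : ℝ, 0 < κ → κ ≤ c * (Real.pi / N) ^ 2 →
        C₁ * κ ^ 2 * ((N : ℝ) / Real.pi) ^ 6 ≤ chainQFI γ N κ ∧
        chainQFI γ N κ ≤ C₂ * κ ^ 2 * ((N : ℝ) / Real.pi) ^ 6) ∧
    -- thermodynamic limit at fixed `κ > 0`: Heisenberg scaling
    (∀ κ : ℝ, 0 < κ →
      (fun m : ℕ => blockQFI γ (2 * m) m κ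
          - 1 / (γ + κ) ^ 2 * (((2 * m : ℕ) : ℝ) / Real.pi) ^ 2)
        =O[atTop] (fun m : ℕ => ((2 * m : ℕ) : ℝ)) ∧
      (fun m : ℕ => chainQFI γ (2 * m) κ) =Θ[atTop] (fun m : ℕ => ((2 * m : ℕ) : ℝ) ^ 2)) := by
  have key : ∀ {P : ℕ → Prop}, (∀ M, 1 ≤ M → P (2 * M)) → ∀ N, Even N → 2 ≤ N → P N := by
    intro P hP N hN hN2
    obtain ⟨M, rfl⟩ := hN.two_dvd
    exact hP M (by omega)
  have half : ∀ M : ℕ, 2 * M / 2 = M := fun M => by omega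
  refine ⟨key fun M hM κ hκ => ?_, key fun M hM => ?_, tendsto_leadingCoeff_last,
    sum_leadingCoeff_isTheta, fun ε hε => ?_, ?_, fun κ hκ =>
    ⟨blockQFI_last_sub_isBigO hγ hκ, chainQFI_isTheta hγ hκ⟩⟩
  · rw [half]
    exact ⟨hasGroundQFI_chainQFI hM hγ hκ, fun p hp => hasGroundQFI_blockQFI hγ hκ hp,
      chainQFI_eq hM hγ hκ⟩
  · rw [half]
    exact ⟨by rw [momentum_last hM, two_mul_angle_zero], fun p hp =>
      ⟨abs_pi_sub_momentum_le hp, leadingCoeff_le_last hp, blockQFI_sub_isBigO hγ hp⟩,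
      chainQFI_sub_isBigO hM hγ⟩
  · obtain ⟨c, hc, N₀, h⟩ := exists_moderate_size_ratio hγ hε
    refine ⟨c, hc, N₀, key fun M hM hN κ hκ hκc => ?_⟩
    rw [half]
    exact h M hM hN κ hκ hκc
  · obtain ⟨c, C₁, C₂, hc, hC₁, hC₂, h⟩ := exists_moderate_size_bounds hγ
    exact ⟨c, C₁, C₂, hc, hC₁, hC₂, key h⟩
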